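/- **Setting.** Let $d\in\{1,2,3\}$ and let $\Omega\subset\mathbb{R}^d$ be a polyhedral domain (nonempty, open, connected, equal to the interior of its closure, the closure being a finite union of convex polytopes). Let $\mathcal{A}$ be a symmetric matrix function on $\Omega$ with components in $L_\infty(\Omega)$ whose eigenvalues lie a.e. in $[\alpha,\beta]$, $\alpha>0$, and let $y_d\in L_2(\Omega)$. For $p,y,q,z\in H^1_0(\Omega)$ put $a(y,z)=\int_\Omega(\mathcal{A}\nabla y)\cdot\nabla z\,dx$ and $$\mathcal{B}\big((p,y),(q,z)\big)=a(p,q)+\int_\Omega yq\,dx+\int_\Omega pz\,dx-a(y,z).$$ Let $\mathrm{C_{PF}}$ be any constant with $\|v\|_{L_2(\Omega)}^2\le \mathrm{C_{PF}}|v|_{H^1(\Omega)}^2$ for all $v\in H^1_0(\Omega)$ (such constants exist). Let $\mathcal{T}_H$ be a conforming triangulation of $\Omega$ with mesh size $H=\max_{T\in\mathcal T_H}\operatorname{diam}T$ and let $\mathcal{T}_h$ be a conforming refinement of $\mathcal{T}_H$, both consisting either of $d$-simplices ($P_1$ elements) or of axis-parallel boxes ($Q_1$ elements). Let $V_H,V_h\subset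 H^1_0(\Omega)$ be the corresponding finite element spaces of continuous piecewise $P_1$ (resp. $Q_1$) functions vanishing on $\partial\Omega$. For $\zeta\in H^1_0(\Omega)$ let $\Pi_H\zeta\in V_H$ be the function whose value at each interior vertex $p$ of $\mathcal{T}_H$ is the average of $(Q_T\zeta)(p)$ over the elements $T\in\mathcal{T}_H$ that have $p$ as a vertex, where $Q_T\zeta$ is the $L_2(T)$-orthogonal projection of $\zeta|_T$ into $P_1(T)$ (resp. $Q_1(T)$); $\Pi_H$ is well defined. Let $K_h=\{v\in V_h:\Pi_Hv=0\}$ and $$V_H^{\mathrm{ms},h}=\{v\in V_h\times V_h:\ \mathcal{B}(v,w)=0\ \ \forall\,w\in K_h\times K_h\}.$$ The triangulation $\mathcal{T}_H$ is called shape regular with parameter $\sigma$ if every $T\in\mathcal{T}_H$ contains a ball of some radius $r_T>0$ with $\operatorname{diam}T\le\sigma r_T$ and, when $d=1$, $\operatorname{diam}T\le\sigma\operatorname{diam}T'$ for all $T,T'\in\mathcal T_H$ with a common vertex. **Theorem.** (i) There is a constant $C_0\ge1$, depending only on $d$, on $\sigma$ and on the kind of elements ($P_1$ or $Q_1$), such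 that for all $\Omega$ and all $\mathcal{T}_H$ that are shape regular with parameter $\sigma$ the estimate $$H^{-1}\|v-\Pi_Hv\|_{L_2(\Omega)}+|\Pi_Hv|_{H^1(\Omega)}\le C_\dagger|v|_{H^1(\Omega)}\qquad\forall\,v\in H^1_0(\Omega)\tag{1}$$ holds with $C_\dagger=C_0$. (ii) For such $\Omega$, $\mathcal T_H$ and all $\mathcal T_h$, $\mathcal A$, $y_d$ as above there are a unique $(p_h,y_h)\in V_h\times V_h$ with $\mathcal{B}((p_h,y_h),(q,z))=\int_\Omega y_dq\,dx$ for all $(q,z)\in V_h\times V_h$, and a unique solution $(p_H^{\mathrm{ms},h},y_H^{\mathrm{ms},h})\in V_H^{\mathrm{ms},h}$ of the ideal multiscale method $\mathcal{B}((p_H^{\mathrm{ms},h},y_H^{\mathrm{ms},h}),(q,z))=\int_\Omega y_dq\,dx$ for all $(q,z)\in V_H^{\mathrm{ms},h}$. For every constant $C_\dagger$ for which (1) holds for $\mathcal T_H$ (in particular for $C_\dagger=C_0$), we have $$\|(p_h,y_h)-(p_H^{\mathrm{ms},h},y_H^{\mathrm{ms},h})\|_{L_2(\Omega)\times L_2(\Omega)}\le\Big[1+\frac{\mathrm{C_{PF}}}{\alpha}\Big]\frac{C_\dagger^2}{\alpha}\,H^2\,\|y_d\|_{L_2(\Omega)},$$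 where $\|(q,z)\|_{L_2(\Omega)\times L_2(\Omega)}^2=\|q\|_{L_2(\Omega)}^2+\|z\|_{L_2(\Omega)}^2$. -/

import Mathlib

open MeasureTheory Set
open scoped ContDiff Matrix Gradient

noncomputable section

namespace OCP

/-- Euclidean space `ℝ^d`. -/
abbrev E (d : ℕ) := EuclideanSpace ℝ (Fin d)

/-! ### Function spaces on a domain -/

/-- `L₂(Ω)`. -/
abbrev L2 {d : ℕ} (Ω : Set (E d)) := Lp ℝ 2 (volume.restrict Ω)

/-- Square integrable vector fields, `L₂(Ω)^d`. -/
abbrev L2Vec {d : ℕ} (Ω : Set (E d)) := Lp (E d) 2 (volume.restrict Ω)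

/-- The space of all pairs `(φ, ∇φ)` with `φ ∈ C_c^∞(Ω)`, inside `L₂(Ω) × L₂(Ω)^d`. -/
def testGraph {d : ℕ} (Ω : Set (E d)) : Submodule ℝ (L2 Ω × L2Vec Ω) where
  carrier := {u | ∃ φ : E d → ℝ, ContDiff ℝ ∞ φ ∧ HasCompactSupport φ ∧ tsupport φ ⊆ Ω ∧
    u.1 =ᵐ[volume.restrict Ω] φ ∧ u.2 =ᵐ[volume.restrict Ω] ∇ φ}
  zero_mem' := by
    refine ⟨fun _ => 0, contDiff_const, HasCompactSupport.zero, ?_, ?_, ?_⟩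
    · simp [tsupport]
    · exact Lp.coeFn_zero _ _ _
    · have : ∇ (fun _ : E d => (0 : ℝ)) = 0 := by ext x; simp [gradient]
      rw [this]
      exact Lp.coeFn_zero _ _ _
  add_mem' := by
    rintro u v ⟨φ, h1, h2, h3, h4, h5⟩ ⟨ψ, k1, k2, k3, k4, k5⟩
    refine ⟨φ + ψ, h1.add k1, h2.add k2, ?_, ?_, ?_⟩
    · exact (tsupport_add φ ψ).trans (union_subset h3 k3)
    · filter_upwards [Lp.coeFn_add u.1 v.1, h4, k4] with x a b c
      exact a.trans (congrArg₂ (· + ·) b c)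
    · filter_upwards [Lp.coeFn_add u.2 v.2, h5, k5] with x a b c
      have e1 : DifferentiableAt ℝ φ x := (h1.differentiable (by simp)) x
      have e2 : DifferentiableAt ℝ ψ x := (k1.differentiable (by simp)) x
      refine (a.trans (congrArg₂ (· + ·) b c)).trans ?_
      simp [gradient, fderiv_add e1 e2]
  smul_mem' := by
    rintro c u ⟨φ, h1, h2, h3, h4, h5⟩
    refine ⟨c • φ, h1.const_smul c, h2.smul_left (f := fun _ => c), ?_, ?_, ?_⟩
    · exact (closure_mono (Function.support_const_smul_subset c φ)).trans h3
    · filter_upwards [Lp.coeFn_smul c u.1, h4] with x a b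
      simp [a, b]
    · filter_upwards [Lp.coeFn_smul c u.2, h5] with x a b
      have e1 : DifferentiableAt ℝ φ x := (h1.differentiable (by simp)) x
      simp [a, b, gradient, fderiv_const_smul e1 c]

/-- `H^1_0(Ω)`, the closure of `C_c^∞(Ω)` in the `H^1` norm. An element is stored as the pair
`(v, ∇v)` of a function and its weak gradient (which is determined by `v`). -/
def H10 {d : ℕ} (Ω : Set (E d)) : Submodule ℝ (L2 Ω × L2Vec Ω) :=
  (testGraph Ω).topologicalClosure

/-- The underlying `L₂` function of an element of `H^1_0(Ω)`. -/
def toL2 {d : ℕ} {Ω : Set (E d)} (v : H10 Ω) : L2 Ω := v.1.1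

/-- The weak gradient of an element of `H^1_0(Ω)`. -/
def weakGrad {d : ℕ} {Ω : Set (E d)} (v : H10 Ω) : L2Vec Ω := v.1.2

/-- The norm `‖v‖_{L₂(Ω)}`. -/
def l2Norm {d : ℕ} {Ω : Set (E d)} (v : H10 Ω) : ℝ := ‖toL2 v‖

/-- The seminorm `|v|_{H^1(Ω)} = ‖∇v‖_{L₂(Ω)}`. -/
def h1Seminorm {d : ℕ} {Ω : Set (E d)} (v : H10 Ω) : ℝ := ‖weakGrad v‖

/-- The norm of `L₂(Ω) × L₂(Ω)`. -/
def l2l2Norm {d : ℕ} {Ω : Set (E d)} (x : H10 Ω × H10 Ω) : ℝ :=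
  Real.sqrt (l2Norm x.1 ^ 2 + l2Norm x.2 ^ 2)

/-- `C` is a constant in the Poincaré-Friedrichs inequality on `Ω`. -/
def PoincareFriedrichs {d : ℕ} (Ω : Set (E d)) (C : ℝ) : Prop :=
  ∀ v : H10 Ω, l2Norm v ^ 2 ≤ C * h1Seminorm v ^ 2

/-! ### The optimal control problem -/

/-- Admissible diffusion matrices on `Ω`: symmetric, with components in `L_∞(Ω)` and
eigenvalues in `[α, β]`, where `α > 0`. -/
structure IsDiffusion {d : ℕ} (Ω : Set (E d)) (α β : ℝ)
    (A : E d → Matrix (Fin d) (Fin d) ℝ) : Prop where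
  pos : 0 < α
  memLp : ∀ i j, MemLp (fun x => A x i j) ⊤ (volume.restrict Ω)
  symm : ∀ᵐ x ∂(volume.restrict Ω), (A x).IsSymm
  eigenvalues : ∀ᵐ x ∂(volume.restrict Ω), ∀ μ ∈ spectrum ℝ (A x), α ≤ μ ∧ μ ≤ β

/-- The bilinear form `a(v, w) = ∫_Ω (A ∇v) · ∇w dx`. -/
def aForm {d : ℕ} {Ω : Set (E d)} (A : E d → Matrix (Fin d) (Fin d) ℝ) (v w : H10 Ω) : ℝ :=
  ∫ x in Ω, (A x *ᵥ (weakGrad v x).ofLp) ⬝ᵥ (weakGrad w x).ofLp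

/-- The bilinear form `B((p, y), (q, z)) = a(p, q) + ∫ y q + ∫ p z - a(y, z)`. -/
def bForm {d : ℕ} {Ω : Set (E d)} (A : E d → Matrix (Fin d) (Fin d) ℝ)
    (u v : H10 Ω × H10 Ω) : ℝ :=
  aForm A u.1 v.1 + (∫ x in Ω, toL2 u.2 x * toL2 v.1 x) + (∫ x in Ω, toL2 u.1 x * toL2 v.2 x)
    - aForm A u.2 v.2

/-- `u = (p, y)` is the Galerkin solution in `W ⊆ H^1_0(Ω) × H^1_0(Ω)` of
`B((p, y), (q, z)) = ∫ y_d q`. -/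
def IsGalerkinSolution {d : ℕ} {Ω : Set (E d)} (A : E d → Matrix (Fin d) (Fin d) ℝ)
    (yd : L2 Ω) (W : Set (H10 Ω × H10 Ω)) (u : H10 Ω × H10 Ω) : Prop :=
  u ∈ W ∧ ∀ w ∈ W, bForm A u w = ∫ x in Ω, yd x * toL2 w.1 x

/-! ### Triangulations -/

/-- A polyhedral domain: a connected nonempty open set that is the interior of its closure,
the closure being a finite union of convex polytopes. -/
structure IsPolyhedralDomain {d : ℕ} (Ω : Set (E d)) : Prop where
  isOpen : IsOpen Ω
  isConnected : IsConnected Ω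
  interior_closure : interior (closure Ω) = Ω
  polytopes : ∃ S : Finset (Finset (E d)),
    closure Ω = ⋃ V ∈ S, convexHull ℝ (V : Set (E d))

/-- The two families of finite elements: `P₁` on simplices, `Q₁` on axis-parallel boxes. -/
inductive ElementKind
  | P1
  | Q1

/-- `V` is the vertex set of a (nondegenerate) element of the given kind: a `d`-simplex for `P₁`,
a box `∏ [a i, b i]` for `Q₁`. The element itself is the convex hull of `V`. -/
def IsElement {d : ℕ} (k : ElementKind) (V : Finset (E d)) : Prop :=
  match k with
  | .P1 => V.card = d + 1 ∧ AffineIndependent ℝ (fun p : V => (p : E d))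
  | .Q1 => ∃ a b : E d, (∀ i, a i < b i) ∧
      (V : Set (E d)) = {x | ∀ i, x i = a i ∨ x i = b i}

/-- A conforming triangulation of `Ω`, given by the vertex sets of its elements: the elements
cover the closure of `Ω`, and two elements meet in the hull of their common vertices (so in a
common face, or not at all). -/
structure IsTriangulation {d : ℕ} (k : ElementKind) (Ω : Set (E d))
    (T : Finset (Finset (E d))) : Prop where
  isElement : ∀ V ∈ T, IsElement k V
  cover : ⋃ V ∈ T, convexHull ℝ (V : Set (E d)) = closure Ω
  conforming : ∀ V ∈ T, ∀ V' ∈ T,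
    convexHull ℝ (V : Set (E d)) ∩ convexHull ℝ (V' : Set (E d)) =
      convexHull ℝ ((V : Set (E d)) ∩ (V' : Set (E d)))

/-- `T'` is a refinement of `T`: each element of `T'` lies in an element of `T`. -/
def IsRefinement {d : ℕ} (T' T : Finset (Finset (E d))) : Prop :=
  ∀ V' ∈ T', ∃ V ∈ T, convexHull ℝ (V' : Set (E d)) ⊆ convexHull ℝ (V : Set (E d))

/-- The diameter of the element with vertex set `V`. -/
def elementDiam {d : ℕ} (V : Finset (E d)) : ℝ := Metric.diam (convexHull ℝ (V : Set (E d)))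

/-- The mesh size, the largest diameter of an element. -/
def meshSize {d : ℕ} (T : Finset (Finset (E d))) : ℝ :=
  sSup (elementDiam '' (T : Set (Finset (E d))))

/-- The shape regularity of `T` is controlled by `σ`: each element contains a ball of radius `r`
with `diam ≤ σ r`. In one dimension, where this says nothing, the lengths of two adjacent
intervals are comparable (in higher dimensions this follows for elements with a common edge). -/
structure IsShapeRegular {d : ℕ} (σ : ℝ) (T : Finset (Finset (E d))) : Prop where
  ball : ∀ V ∈ T, ∃ (c : E d) (r : ℝ), 0 < r ∧
    Metric.closedBall c r ⊆ convexHull ℝ (V : Set (E d)) ∧ elementDiam V ≤ σ * r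
  adjacent : d = 1 → ∀ V ∈ T, ∀ V' ∈ T, ((V : Set (E d)) ∩ (V' : Set (E d))).Nonempty →
    elementDiam V ≤ σ * elementDiam V'

/-- `P₁` (total degree at most one) or `Q₁` (degree at most one in each coordinate) polynomial
functions, spanned by the monomials `∏_{i ∈ s} x_i` with `|s| ≤ 1`, or with any `s`. -/
def localPoly (d : ℕ) (k : ElementKind) : Submodule ℝ (E d → ℝ) :=
  match k with
  | .P1 => Submodule.span ℝ {f | ∃ s : Finset (Fin d), s.card ≤ 1 ∧ f = fun x => ∏ i ∈ s, x i}
  | .Q1 => Submodule.span ℝ {f | ∃ s : Finset (Fin d), f = fun x => ∏ i ∈ s, x i}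

/-- `f` is a continuous, piecewise `P₁` (or `Q₁`) function that vanishes outside `Ω`. -/
structure IsFEFunction {d : ℕ} (k : ElementKind) (Ω : Set (E d)) (T : Finset (Finset (E d)))
    (f : E d → ℝ) : Prop where
  continuous : Continuous f
  eq_zero : ∀ x ∉ Ω, f x = 0
  piecewise : ∀ V ∈ T, ∃ q ∈ localPoly d k, EqOn f q (convexHull ℝ (V : Set (E d)))

/-- The element `v` of `H^1_0(Ω)` is represented by the function `f`. -/
def Represents {d : ℕ} {Ω : Set (E d)} (f : E d → ℝ) (v : H10 Ω) : Prop :=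
  toL2 v =ᵐ[volume.restrict Ω] f

/-- The `P₁` or `Q₁` finite element subspace of `H^1_0(Ω)` associated with `T`. -/
def feSpace {d : ℕ} (k : ElementKind) (Ω : Set (E d)) (T : Finset (Finset (E d))) :
    Set (H10 Ω) :=
  {v | ∃ f, IsFEFunction k Ω T f ∧ Represents f v}

/-! ### The projection operator and the ideal multiscale space -/

/-- `q` is the `L₂` orthogonal projection of `v` (restricted to the element with vertex set `V`)
into the `P₁` or `Q₁` polynomials. -/
def IsLocalProjection {d : ℕ} {Ω : Set (E d)} (k : ElementKind) (V : Finset (E d)) (v : H10 Ω)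
    (q : E d → ℝ) : Prop :=
  q ∈ localPoly d k ∧
    ∀ r ∈ localPoly d k, ∫ x in convexHull ℝ (V : Set (E d)), (toL2 v x - q x) * r x = 0

open Classical in
/-- `w = Π_H v`: `w` is the finite element function whose value at each vertex `p ∈ Ω` of the
triangulation is the average, over the elements that share the vertex `p`, of the values at `p`
of the local `L₂` projections of `v`. -/
def IsPi {d : ℕ} {Ω : Set (E d)} (k : ElementKind) (T : Finset (Finset (E d)))
    (v w : H10 Ω) : Prop :=
  ∃ (Q : Finset (E d) → E d → ℝ) (f : E d → ℝ),
    (∀ V ∈ T, IsLocalProjection k V v (Q V)) ∧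
    IsFEFunction k Ω T f ∧ Represents f w ∧
    ∀ p ∈ Ω, (∃ V ∈ T, p ∈ V) →
      f p = (∑ V ∈ T.filter (fun V => p ∈ V), Q V p) / ((T.filter (fun V => p ∈ V)).card : ℝ)

/-- `C` is a constant in the interpolation error estimate
`H⁻¹ ‖v - Π_H v‖_{L₂} + |Π_H v|_{H^1} ≤ C |v|_{H^1}` on `H^1_0(Ω)`. -/
def InterpolationEstimate {d : ℕ} (k : ElementKind) (Ω : Set (E d)) (T : Finset (Finset (E d)))
    (C : ℝ) : Prop :=
  ∀ v w : H10 Ω, IsPi k T v w →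
    (meshSize T)⁻¹ * l2Norm (v - w) + h1Seminorm w ≤ C * h1Seminorm v

/-- The kernel of `Π_H` on the fine space `V_h`; here `TH` and `Th` are the coarse and the fine
triangulation. -/
def kernelPi {d : ℕ} (k : ElementKind) (Ω : Set (E d)) (TH Th : Finset (Finset (E d))) :
    Set (H10 Ω) :=
  {v | v ∈ feSpace k Ω Th ∧ IsPi k TH v 0}

/-- The ideal multiscale finite element space: the members of `V_h × V_h` that are
`B`-orthogonal to the product of the kernels. -/
def msSpace {d : ℕ} (k : ElementKind) (Ω : Set (E d)) (A : E d → Matrix (Fin d) (Fin d) ℝ)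
    (TH Th : Finset (Finset (E d))) : Set (H10 Ω × H10 Ω) :=
  {v | v ∈ feSpace k Ω Th ×ˢ feSpace k Ω Th ∧
    ∀ w ∈ kernelPi k Ω TH Th ×ˢ kernelPi k Ω TH Th, bForm A v w = 0}

end OCP

end

/-! ### Poincaré inequalities on convex sets, from integrals along segments. -/

noncomputable section

namespace OCP


/-! The error estimate is short once (1) is available. The form `B` is symmetric and indefinite, but
pairing `(p, y)` with `(p, -y)` cancels the coupling terms and leaves `a(p, p) + a(y, y)`
(`bForm_twist`). The twist maps every product `W × W` to itself, so `B` is nondegenerate on `V_h ×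
V_h` and on `K_h × K_h`, and hence on the `B`-orthogonal complement of the latter in the former,
which is the multiscale space. This gives unique solvability. It also places the error `e = (p, y)`
in `K_h × K_h`, where it solves the same variational problem (`sub_mem_of_galerkin`). Testing with
`(p, -y)` gives `α |p|² ≤ ‖y_d‖ ‖p‖`; since `Π_H p = 0`, (1) reads `‖p‖ ≤ C_† H |p|`, and together
`‖p‖ ≤ C_†² H² ‖y_d‖ / α`. Testing with `(0, y)` gives `a(y, y) = ∫ p y`, so `‖y‖ ≤ C_PF ‖p‖ / α`.
Adding the two bounds gives the claim (`l2l2Norm_le_of_kernel`).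

Most of the work is (1), with a constant that sees only `d` and `σ`. It rests on one local bound,
`sq_sub_cellMean_le`: a nodal value of `Π_H v` at a vertex `p` of an element `V₀` differs from the
mean of `v` on `V₀` by at most a constant times `h^(1 - d/2)` times the `H^1` seminorm on the
elements around `p`. Summing over elements with bounded overlap gives (1) (`interpolationEstimate`).

For the local bound, the value of a local projection at a vertex is compared with the mean on the
same element by an inverse estimate and the Poincaré inequality. Means on two elements with a common
facet are compared through a ball centred on that facet. A facet on the boundary of the domain
bounds the mean itself, because `v` extends by zero across it. These comparisons are chained along
facets around `p`. The boundary may be wild enough that the elements at a boundary vertex are not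
connected through facets, so the chain relies on a dichotomy (`reachable_or_boundary`): starting
from `V₀`, either all elements at `p` are reached and `p` is interior, or some element with a
boundary facet at `p` is reached, and then the nodal value is zero. It is proved by following a
generic segment near `p`, which never meets two facets of an element at once. A packing argument
bounds the number of elements at `p`, hence the length of the chain, and the diameters of neighbours
are comparable.

Every inequality on `H^1_0` is closed in `(v, ∇v)` and therefore only needs proof for test
functions, where one integrates the gradient along segments (`H10.closure_induction`). That finite
element functions belong to `H^1_0`, without which `Π_H` would have no values, follows by
truncation, mollification and a weak limit (`exists_represents_of_lipschitz`). -/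

theorem lintegral_comp_smul_add {d : ℕ} (F : E d → ENNReal) (hF : Measurable F) {t : ℝ} (ht : t ≠ 0)
    (c : E d) : ∫⁻ x, F (t • x + c) = ENNReal.ofReal |(t ^ d)⁻¹| * ∫⁻ x, F x := by
  have h1 := Measure.map_addHaar_smul (volume : Measure (E d)) ht
  rw [finrank_euclideanSpace_fin] at h1
  have h2 : ∫⁻ x, F (t • x + c) = ∫⁻ z, F (z + c) ∂(Measure.map (t • ·) volume) := by
    rw [lintegral_map (f := fun z => F (z + c)) (hF.comp (measurable_add_const c))
      (measurable_const_smul t)]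
  rw [h2, h1, lintegral_smul_measure, lintegral_add_right_eq_self F c, smul_eq_mul]

/-- Contracting a convex set by a factor at least one half costs at most a factor `2 ^ d`. -/
theorem setLIntegral_comp_contraction_le {d : ℕ} {K : Set (E d)} (hK : Convex ℝ K)
    (hKm : MeasurableSet K) (G : E d → ENNReal) (hG : Measurable G) {y : E d} (hy : y ∈ K) {t : ℝ}
    (h2 : 1 / 2 ≤ t) (h1 : t ≤ 1) :
    ∫⁻ x in K, G (y + t • (x - y)) ≤ 2 ^ d * ∫⁻ x in K, G x := by
  have ht : 0 < t := by linarith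
  have e : ∀ x, y + t • (x - y) = t • x + (1 - t) • y := fun x => by module
  rw [← lintegral_indicator hKm, ← lintegral_indicator hKm]
  calc ∫⁻ x, K.indicator (fun x => G (y + t • (x - y))) x
      ≤ ∫⁻ x, K.indicator G (t • x + (1 - t) • y) := by
        refine lintegral_mono fun x => ?_
        by_cases hx : x ∈ K
        · have : t • x + (1 - t) • y ∈ K := hK hx hy ht.le (by linarith) (by ring)
          simp only [indicator_of_mem hx, indicator_of_mem this, e, le_refl]
        · simp [indicator_of_notMem hx]
    _ = ENNReal.ofReal |(t ^ d)⁻¹| * ∫⁻ x, K.indicator G x :=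
        lintegral_comp_smul_add _ (hG.indicator hKm) ht.ne' _
    _ ≤ 2 ^ d * ∫⁻ x, K.indicator G x := by
        gcongr
        rw [abs_of_pos (by positivity), ← inv_pow]
        calc ENNReal.ofReal (t⁻¹ ^ d) ≤ ENNReal.ofReal (2 ^ d) := by
              apply ENNReal.ofReal_le_ofReal
              have : t⁻¹ ≤ 2 := by
                rw [inv_le_comm₀ ht (by norm_num)]; linarith
              gcongr
          _ = 2 ^ d := by rw [ENNReal.ofReal_pow (by norm_num)]; norm_num

theorem sq_lintegral_le {α : Type*} [MeasurableSpace α] (μ : Measure α) {g : α → ENNReal}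
    (hg : AEMeasurable g μ) : (∫⁻ t, g t ∂μ) ^ 2 ≤ μ univ * ∫⁻ t, g t ^ 2 ∂μ := by
  have h := ENNReal.lintegral_mul_le_Lp_mul_Lq μ
    (p := 2) (q := 2) (by constructor <;> norm_num) hg (aemeasurable_const (b := (1 : ENNReal)))
  simp only [Pi.mul_apply, mul_one, ENNReal.one_rpow, lintegral_const, one_mul] at h
  calc (∫⁻ t, g t ∂μ) ^ 2
      ≤ ((∫⁻ t, g t ^ (2 : ℝ) ∂μ) ^ (1 / 2 : ℝ) * μ univ ^ (1 / 2 : ℝ)) ^ 2 := by gcongr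
    _ = μ univ * ∫⁻ t, g t ^ 2 ∂μ := by
        rw [mul_pow, ← ENNReal.rpow_natCast, ← ENNReal.rpow_natCast, ← ENNReal.rpow_mul,
          ← ENNReal.rpow_mul, mul_comm]
        simp

/-- `g` is an upper gradient of `f` along the segments between the sets `A` and `B`. -/
def IsUpperGradient {d : ℕ} (A B : Set (E d)) (f : E d → ℝ) (g : E d → ENNReal) : Prop :=
  ∀ x ∈ A, ∀ y ∈ B, ‖f x - f y‖ₑ ≤ ‖x - y‖ₑ * ∫⁻ t in Ioc (0 : ℝ) 1, g (y + t • (x - y))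

/-- Split the segment in the middle. For `t ≤ 1/2` fix `x` and integrate over `y` first: the point
moves by a contraction towards `x` with factor `1 - t ≥ 1/2`. For `t ≥ 1/2` exchange the roles of
`x` and `y`. No contraction factor below one half ever occurs, so the Jacobian costs only `2 ^ d`.
-/
theorem lintegral_lintegral_segment_le {d : ℕ} {K : Set (E d)} (hK : Convex ℝ K)
    (hKm : MeasurableSet K) (G : E d → ENNReal) (hG : Measurable G) :
    ∫⁻ x in K, ∫⁻ y in K, ∫⁻ t in Ioc (0 : ℝ) 1, G (y + t • (x - y)) ≤
      2 ^ d * volume K * ∫⁻ x in K, G x := by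
  have hm : Measurable fun z : E d × E d × ℝ => G (z.2.1 + z.2.2 • (z.1 - z.2.1)) :=
    hG.comp (by fun_prop)
  set J := ∫⁻ x in K, G x
  have hsplit : ∀ x y : E d, ∫⁻ t in Ioc (0 : ℝ) 1, G (y + t • (x - y)) ≤
      (∫⁻ t in Ioc (0 : ℝ) (1/2), G (y + t • (x - y))) +
        ∫⁻ t in Ioc (1/2 : ℝ) 1, G (y + t • (x - y)) := fun x y => by
    rw [← Ioc_union_Ioc_eq_Ioc (a := (0 : ℝ)) (b := 1/2) (c := 1) (by norm_num) (by norm_num)]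
    exact lintegral_union_le _ _ _
  have hA : ∀ x ∈ K, ∫⁻ y in K, ∫⁻ t in Ioc (0 : ℝ) (1/2), G (y + t • (x - y)) ≤
      2 ^ d * J * ENNReal.ofReal (1 / 2) := fun x hx => by
    rw [lintegral_lintegral_swap
      (f := fun y t => G (y + t • (x - y)))
      (hG.comp (by fun_prop : Measurable fun z : E d × ℝ => z.1 + z.2 • (x - z.1))).aemeasurable]
    calc _ ≤ ∫⁻ t in Ioc (0 : ℝ) (1/2), 2 ^ d * J := by
          refine setLIntegral_mono' measurableSet_Ioc fun t ht => ?_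
          have := setLIntegral_comp_contraction_le hK hKm G hG hx (t := 1 - t)
            (by linarith [ht.2]) (by linarith [ht.1])
          refine le_trans (le_of_eq ?_) this
          congr 1; ext y; congr 1; module
      _ = _ := by simp [Real.volume_Ioc]
  have hB : ∀ y ∈ K, ∫⁻ x in K, ∫⁻ t in Ioc (1/2 : ℝ) 1, G (y + t • (x - y)) ≤
      2 ^ d * J * ENNReal.ofReal (1 / 2) := fun y hy => by
    rw [lintegral_lintegral_swap
      (f := fun x t => G (y + t • (x - y)))
      (hG.comp (by fun_prop : Measurable fun z : E d × ℝ => y + z.2 • (z.1 - y))).aemeasurable]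
    calc _ ≤ ∫⁻ t in Ioc (1/2 : ℝ) 1, 2 ^ d * J := by
          refine setLIntegral_mono' measurableSet_Ioc fun t ht => ?_
          exact setLIntegral_comp_contraction_le hK hKm G hG hy (by linarith [ht.1]) ht.2
      _ = _ := by rw [setLIntegral_const, Real.volume_Ioc]; congr 2; norm_num
  have hmi : ∀ a b : ℝ, Measurable fun z : E d × E d =>
      ∫⁻ t in Ioc a b, G (z.2 + t • (z.1 - z.2)) := fun a b =>
    Measurable.lintegral_prod_right' (f := fun w : (E d × E d) × ℝ =>
      G (w.1.2 + w.2 • (w.1.1 - w.1.2))) (hG.comp (by fun_prop))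
  calc ∫⁻ x in K, ∫⁻ y in K, ∫⁻ t in Ioc (0 : ℝ) 1, G (y + t • (x - y))
      ≤ ∫⁻ x in K, ∫⁻ y in K, ((∫⁻ t in Ioc (0 : ℝ) (1/2), G (y + t • (x - y))) +
        ∫⁻ t in Ioc (1/2 : ℝ) 1, G (y + t • (x - y))) :=
        lintegral_mono fun x => lintegral_mono fun y => hsplit x y
    _ = (∫⁻ x in K, ∫⁻ y in K, ∫⁻ t in Ioc (0 : ℝ) (1/2), G (y + t • (x - y))) +
        ∫⁻ x in K, ∫⁻ y in K, ∫⁻ t in Ioc (1/2 : ℝ) 1, G (y + t • (x - y)) := by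
        rw [← lintegral_add_left (Measurable.lintegral_prod_right' (hmi 0 (1/2)))]
        refine lintegral_congr fun x => ?_
        exact lintegral_add_left ((hmi 0 (1/2)).comp measurable_prodMk_left) _
    _ ≤ (∫⁻ x in K, 2 ^ d * J * ENNReal.ofReal (1 / 2)) +
        ∫⁻ y in K, 2 ^ d * J * ENNReal.ofReal (1 / 2) := by
        gcongr ?_ + ?_
        · exact setLIntegral_mono' hKm hA
        · rw [lintegral_lintegral_swap (hmi (1/2) 1).aemeasurable]
          exact setLIntegral_mono' hKm hB
    _ = 2 ^ d * volume K * J := by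
        have : ENNReal.ofReal (1 / 2) + ENNReal.ofReal (1 / 2) = 1 := by
          rw [← ENNReal.ofReal_add (by norm_num) (by norm_num)]; norm_num
        rw [setLIntegral_const, ← add_mul, ← mul_add, this]; ring

/-- The Poincaré inequality on convex sets, in the form of a double integral. -/
theorem IsUpperGradient.lintegral_lintegral_sub_sq_le {d : ℕ} {K : Set (E d)} (hK : Convex ℝ K)
    (hKm : MeasurableSet K) {A B : Set (E d)} (hA : A ⊆ K) (hB : B ⊆ K)
    (hAm : MeasurableSet A) (hBm : MeasurableSet B) {f : E d → ℝ} {g : E d → ENNReal}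
    (hfg : IsUpperGradient A B f g)
    (hg : Measurable g) {D : ENNReal} (hD : ∀ x ∈ K, ∀ y ∈ K, ‖x - y‖ₑ ≤ D) :
    ∫⁻ x in A, ∫⁻ y in B, ‖f x - f y‖ₑ ^ 2 ≤ 2 ^ d * D ^ 2 * volume K * ∫⁻ x in K, g x ^ 2 := by
  have hg2 : Measurable fun x => g x ^ 2 := hg.pow_const 2
  have hmi : Measurable fun z : E d × E d =>
      ∫⁻ t in Ioc (0 : ℝ) 1, g (z.2 + t • (z.1 - z.2)) ^ 2 :=
    Measurable.lintegral_prod_right' (f := fun w : (E d × E d) × ℝ =>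
      g (w.1.2 + w.2 • (w.1.1 - w.1.2)) ^ 2) (hg2.comp (by fun_prop))
  calc ∫⁻ x in A, ∫⁻ y in B, ‖f x - f y‖ₑ ^ 2
      ≤ ∫⁻ x in A, ∫⁻ y in B, D ^ 2 * ∫⁻ t in Ioc (0 : ℝ) 1, g (y + t • (x - y)) ^ 2 := by
        refine setLIntegral_mono' hAm fun x hx => setLIntegral_mono' hBm fun y hy => ?_
        calc ‖f x - f y‖ₑ ^ 2
            ≤ (D * ∫⁻ t in Ioc (0 : ℝ) 1, g (y + t • (x - y))) ^ 2 := by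
              gcongr
              exact (hfg x hx y hy).trans (by gcongr; exact hD x (hA hx) y (hB hy))
          _ ≤ _ := by
              rw [mul_pow]
              gcongr
              refine (sq_lintegral_le _ (hg.comp (by fun_prop)).aemeasurable).trans ?_
              simp [Real.volume_Ioc]
    _ ≤ ∫⁻ x in K, ∫⁻ y in K, D ^ 2 * ∫⁻ t in Ioc (0 : ℝ) 1, g (y + t • (x - y)) ^ 2 :=
        lintegral_mono' (Measure.restrict_mono hA le_rfl) fun x =>
          lintegral_mono' (Measure.restrict_mono hB le_rfl) fun y => le_rfl
    _ = D ^ 2 * ∫⁻ x in K, ∫⁻ y in K, ∫⁻ t in Ioc (0 : ℝ) 1, g (y + t • (x - y)) ^ 2 := by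
        rw [← lintegral_const_mul _ (Measurable.lintegral_prod_right' hmi)]
        refine lintegral_congr fun x => ?_
        exact lintegral_const_mul _ (hmi.comp measurable_prodMk_left)
    _ ≤ D ^ 2 * (2 ^ d * volume K * ∫⁻ x in K, g x ^ 2) := by
        gcongr
        exact lintegral_lintegral_segment_le hK hKm _ hg2
    _ = _ := by ring

/-- Mean values over two subsets of a convex set. -/
theorem IsUpperGradient.enorm_average_sub_average_sq_le {d : ℕ} {K : Set (E d)} (hK : Convex ℝ K)
    (hKm : MeasurableSet K) {A B : Set (E d)} (hA : A ⊆ K) (hB : B ⊆ K)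
    (hAm : MeasurableSet A) (hBm : MeasurableSet B) {f : E d → ℝ} {g : E d → ENNReal}
    (hfg : IsUpperGradient A B f g)
    (hg : Measurable g) {D : ENNReal} (hD : ∀ x ∈ K, ∀ y ∈ K, ‖x - y‖ₑ ≤ D) (hf : Measurable f)
    (hA0 : volume A ≠ 0) (hB0 : volume B ≠ 0) (hA1 : volume A ≠ ⊤) (hB1 : volume B ≠ ⊤)
    (hfA : IntegrableOn f A) (hfB : IntegrableOn f B) :
    ‖(⨍ x in A, f x) - ⨍ x in B, f x‖ₑ ^ 2 * (volume A * volume B) ≤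
      2 ^ d * D ^ 2 * volume K * ∫⁻ x in K, g x ^ 2 := by
  have : IsFiniteMeasure (volume.restrict A) := ⟨by simpa using hA1.lt_top⟩
  have : IsFiniteMeasure (volume.restrict B) := ⟨by simpa using hB1.lt_top⟩
  set μ := (volume.restrict A).prod (volume.restrict B) with hμ
  have hμu : μ univ = volume A * volume B := by
    rw [hμ, ← univ_prod_univ, Measure.prod_prod]; simp
  have hm : Measurable fun z : E d × E d => ‖f z.1 - f z.2‖ₑ :=
    ((hf.comp measurable_fst).sub (hf.comp measurable_snd)).enorm
  -- The difference of the means is the mean of `f x - f y` over `A × B`, so Cauchy–Schwarz reduces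
  -- the claim to the double integral.
  have hint : ∫ z, (f z.1 - f z.2) ∂μ =
      volume.real A * volume.real B * ((⨍ x in A, f x) - ⨍ x in B, f x) := by
    have hAr : volume.real A ≠ 0 := ENNReal.toReal_ne_zero.2 ⟨hA0, hA1⟩
    have hBr : volume.real B ≠ 0 := ENNReal.toReal_ne_zero.2 ⟨hB0, hB1⟩
    rw [integral_sub (hfA.integrable.comp_fst _) (hfB.integrable.comp_snd _), integral_fun_fst,
      integral_fun_snd, setAverage_eq, setAverage_eq]
    simp only [measureReal_restrict_apply_univ, smul_eq_mul]
    field_simp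
  have hle : ‖(⨍ x in A, f x) - ⨍ x in B, f x‖ₑ * (volume A * volume B) ≤
      ∫⁻ z, ‖f z.1 - f z.2‖ₑ ∂μ := by
    refine le_trans (le_of_eq ?_) (enorm_integral_le_lintegral_enorm _)
    rw [hint, enorm_mul, enorm_mul, mul_comm]
    simp [measureReal_def, Real.enorm_of_nonneg, hA1, hB1]
  have hV0 : volume A * volume B ≠ 0 := mul_ne_zero hA0 hB0
  have hV1 : volume A * volume B ≠ ⊤ := ENNReal.mul_ne_top hA1 hB1
  have h2 : (‖(⨍ x in A, f x) - ⨍ x in B, f x‖ₑ * (volume A * volume B)) ^ 2 ≤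
      (volume A * volume B) * ∫⁻ z, ‖f z.1 - f z.2‖ₑ ^ 2 ∂μ := by
    refine (pow_le_pow_left' hle 2).trans ?_
    rw [← hμu]
    exact sq_lintegral_le μ hm.aemeasurable
  have h3 : ‖(⨍ x in A, f x) - ⨍ x in B, f x‖ₑ ^ 2 * (volume A * volume B) ≤
      ∫⁻ z, ‖f z.1 - f z.2‖ₑ ^ 2 ∂μ := by
    refine (ENNReal.mul_le_mul_iff_right hV0 hV1).1 (le_trans (le_of_eq ?_) h2)
    ring
  refine h3.trans (le_trans (le_of_eq ?_)
    (hfg.lintegral_lintegral_sub_sq_le hK hKm hA hB hAm hBm hg hD))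
  rw [hμ, lintegral_prod _ (hm.pow_const 2).aemeasurable]

/-- The Poincaré inequality on convex sets. -/
theorem IsUpperGradient.lintegral_sub_average_sq_le {d : ℕ} {K : Set (E d)} (hK : Convex ℝ K)
    (hKm : MeasurableSet K) {f : E d → ℝ} {g : E d → ENNReal} (hfg : IsUpperGradient K K f g)
    (hg : Measurable g) {D : ENNReal} (hD : ∀ x ∈ K, ∀ y ∈ K, ‖x - y‖ₑ ≤ D) (hf : Measurable f)
    (hK0 : volume K ≠ 0) (hK1 : volume K ≠ ⊤) (hfK : IntegrableOn f K) :
    ∫⁻ x in K, ‖f x - ⨍ y in K, f y‖ₑ ^ 2 ≤ 2 ^ d * D ^ 2 * ∫⁻ x in K, g x ^ 2 := by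
  have : IsFiniteMeasure (volume.restrict K) := ⟨by simpa using hK1.lt_top⟩
  have hpt : ∀ x, volume K * ‖f x - ⨍ y in K, f y‖ₑ ^ 2 ≤ ∫⁻ y in K, ‖f x - f y‖ₑ ^ 2 := by
    intro x
    have hKr : volume.real K ≠ 0 := ENNReal.toReal_ne_zero.2 ⟨hK0, hK1⟩
    have hint : ∫ y in K, (f x - f y) = volume.real K * (f x - ⨍ y in K, f y) := by
      rw [integral_sub (integrable_const _) hfK, setAverage_eq]
      simp only [integral_const, measureReal_restrict_apply_univ, smul_eq_mul]
      field_simp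
    have hle : volume K * ‖f x - ⨍ y in K, f y‖ₑ ≤ ∫⁻ y in K, ‖f x - f y‖ₑ := by
      refine le_trans (le_of_eq ?_) (enorm_integral_le_lintegral_enorm _)
      rw [hint, enorm_mul]
      simp [measureReal_def, Real.enorm_of_nonneg, hK1]
    have h2 := (pow_le_pow_left' hle 2).trans
      (sq_lintegral_le (volume.restrict K) (hf.const_sub (f x)).enorm.aemeasurable)
    rw [Measure.restrict_apply_univ] at h2
    refine (ENNReal.mul_le_mul_iff_right hK0 hK1).1 (le_trans (le_of_eq ?_) h2)
    ring
  have h := hfg.lintegral_lintegral_sub_sq_le hK hKm subset_rfl subset_rfl hKm hKm hg hD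
  refine (ENNReal.mul_le_mul_iff_right hK0 hK1).1 ?_
  rw [← lintegral_const_mul _ ((hf.sub_const _).enorm.pow_const 2)]
  refine (lintegral_mono fun x => hpt x).trans (h.trans (le_of_eq (by ring)))

end OCP

end

/-! ### Weak gradients of functions in `H^1_0`. -/

noncomputable section

namespace OCP

variable {d : ℕ} {Ω : Set (E d)}

@[simp] theorem toL2_add (v w : H10 Ω) : toL2 (v + w) = toL2 v + toL2 w := rfl
@[simp] theorem toL2_sub (v w : H10 Ω) : toL2 (v - w) = toL2 v - toL2 w := rfl
@[simp] theorem toL2_neg (v : H10 Ω) : toL2 (-v) = -toL2 v := rfl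
@[simp] theorem toL2_smul (c : ℝ) (v : H10 Ω) : toL2 (c • v) = c • toL2 v := rfl
@[simp] theorem toL2_zero : toL2 (0 : H10 Ω) = 0 := rfl
@[simp] theorem weakGrad_add (v w : H10 Ω) : weakGrad (v + w) = weakGrad v + weakGrad w := rfl
@[simp] theorem weakGrad_smul (c : ℝ) (v : H10 Ω) : weakGrad (c • v) = c • weakGrad v := rfl

/-- A closed property of pairs `(v, ∇v)` holds on `H^1_0(Ω)` if it holds for test functions. -/
theorem H10.closure_induction {P : L2 Ω × L2Vec Ω → Prop} (hP : IsClosed {u | P u})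
    (h : ∀ u ∈ testGraph Ω, P u) (v : H10 Ω) : P (toL2 v, weakGrad v) :=
  closure_minimal (s := (testGraph Ω : Set (L2 Ω × L2Vec Ω))) h hP v.2

/-- An inner product with a fixed function. It makes integration by parts and bounds on mean values
closed conditions, as the density argument requires. -/
theorem continuous_integral_mul {α : Type*} [MeasurableSpace α] {μ : Measure α} {χ : α → ℝ}
    (hχ : MemLp χ 2 μ) : Continuous fun u : Lp ℝ 2 μ => ∫ x, u x * χ x ∂μ := by
  have : (fun u : Lp ℝ 2 μ => ∫ x, u x * χ x ∂μ) = fun u => inner ℝ (hχ.toLp χ) u := by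
    ext u
    rw [L2.inner_def]
    refine integral_congr_ae ?_
    filter_upwards [hχ.coeFn_toLp] with x hx
    simp [hx]
  rw [this]
  fun_prop

theorem continuous_integral_inner_mul {α : Type*} [MeasurableSpace α] {μ : Measure α} {χ : α → ℝ}
    (hχ : MemLp χ 2 μ) (e : E d) :
    Continuous fun u : Lp (E d) 2 μ => ∫ x, inner ℝ (u x) e * χ x ∂μ := by
  have hm : MemLp (fun x => χ x • e) 2 μ := by
    refine (hχ.const_mul ‖e‖).of_le (hχ.1.smul_const e) (.of_forall fun x => ?_)
    simp [norm_smul, mul_comm]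
  have : (fun u : Lp (E d) 2 μ => ∫ x, inner ℝ (u x) e * χ x ∂μ) =
      fun u => inner ℝ (hm.toLp _) u := by
    ext u
    rw [L2.inner_def]
    refine integral_congr_ae ?_
    filter_upwards [hm.coeFn_toLp] with x hx
    rw [hx, real_inner_smul_left, real_inner_comm, mul_comm]
  rw [this]
  fun_prop

theorem inner_gradient {φ : E d → ℝ} (x e : E d) : inner ℝ (∇ φ x) e = fderiv ℝ φ x e := by
  simp [gradient]

theorem norm_gradient {φ : E d → ℝ} (x : E d) : ‖∇ φ x‖ = ‖fderiv ℝ φ x‖ := by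
  simp [gradient]

theorem continuous_gradient {φ : E d → ℝ} (h : ContDiff ℝ ∞ φ) : Continuous (∇ φ) :=
  (InnerProductSpace.toDual ℝ (E d)).symm.continuous.comp (h.continuous_fderiv (by simp))

/-- Integration by parts for the weak gradient of a function in `H^1_0(Ω)`. -/
theorem integral_toL2_mul_fderiv (v : H10 Ω) {ψ : E d → ℝ} (hψ : ContDiff ℝ ∞ ψ)
    (hc : HasCompactSupport ψ) (e : E d) :
    ∫ x in Ω, toL2 v x * fderiv ℝ ψ x e = -∫ x in Ω, inner ℝ (weakGrad v x) e * ψ x := by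
  have hdψ : Continuous fun x => fderiv ℝ ψ x e :=
    (hψ.continuous_fderiv (by simp)).clm_apply continuous_const
  have hdc : HasCompactSupport fun x => fderiv ℝ ψ x e := hc.fderiv_apply ℝ e
  refine H10.closure_induction (P := fun u => ∫ x in Ω, u.1 x * fderiv ℝ ψ x e =
    -∫ x in Ω, inner ℝ (u.2 x) e * ψ x) ?_ ?_ v
  · exact isClosed_eq ((continuous_integral_mul (hdψ.memLp_of_hasCompactSupport hdc)).comp
      continuous_fst) ((continuous_integral_inner_mul
        (hψ.continuous.memLp_of_hasCompactSupport hc) e).comp continuous_snd).neg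
  · rintro u ⟨φ, h1, h2, h3, h4, h5⟩
    have e1 : ∫ x in Ω, u.1 x * fderiv ℝ ψ x e = ∫ x in Ω, φ x * fderiv ℝ ψ x e := by
      refine integral_congr_ae ?_
      filter_upwards [h4] with x hx
      rw [hx]
    have e2 : ∫ x in Ω, inner ℝ (u.2 x) e * ψ x = ∫ x in Ω, fderiv ℝ φ x e * ψ x := by
      refine integral_congr_ae ?_
      filter_upwards [h5] with x hx
      rw [hx, inner_gradient]
    have hz : ∀ x ∉ Ω, x ∉ tsupport φ := fun x hx hx' => hx (h3 hx')
    have hdφ : Continuous fun x => fderiv ℝ φ x e :=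
      (h1.continuous_fderiv (by simp)).clm_apply continuous_const
    rw [e1, e2, setIntegral_eq_integral_of_forall_compl_eq_zero,
      setIntegral_eq_integral_of_forall_compl_eq_zero]
    · refine integral_mul_fderiv_eq_neg_fderiv_mul_of_integrable ?_ ?_ ?_ ?_ ?_
      · exact (hdφ.mul hψ.continuous).integrable_of_hasCompactSupport hc.mul_left
      · exact (h1.continuous.mul hdψ).integrable_of_hasCompactSupport hdc.mul_left
      · exact (h1.continuous.mul hψ.continuous).integrable_of_hasCompactSupport hc.mul_left
      · exact fun x _ => h1.differentiable (by simp) x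
      · exact fun x _ => hψ.differentiable (by simp) x
    · intro x hx
      rw [fderiv_of_notMem_tsupport ℝ (hz x hx)]; simp
    · intro x hx
      rw [image_eq_zero_of_notMem_tsupport (hz x hx), zero_mul]

/-- Where a function in `H^1_0(Ω)` is smooth, its weak gradient is the classical one. -/
theorem weakGrad_ae_eq_gradient (v : H10 Ω) {U : Set (E d)} (hU : IsOpen U) (hUΩ : U ⊆ Ω)
    {q : E d → ℝ} (hq : ContDiff ℝ ∞ q) (hv : toL2 v =ᵐ[volume.restrict U] q) :
    weakGrad v =ᵐ[volume.restrict U] ∇ q := by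
  have hle : volume.restrict U ≤ volume.restrict Ω := Measure.restrict_mono hUΩ le_rfl
  have hwm : MemLp (weakGrad v) 2 (volume.restrict U) := (Lp.memLp (weakGrad v)).mono_measure hle
  have key : ∀ e : E d, ∀ᵐ x, x ∈ U → inner ℝ (weakGrad v x) e - fderiv ℝ q x e = 0 := by
    intro e
    have hdq : Continuous fun x => fderiv ℝ q x e :=
      (hq.continuous_fderiv (by simp)).clm_apply continuous_const
    have hwl : LocallyIntegrableOn (fun x => inner ℝ (weakGrad v x) e) U := by
      rw [locallyIntegrableOn_iff hU.isLocallyClosed]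
      intro k hk hkc
      have : IsFiniteMeasure (volume.restrict k) := ⟨by simpa using hkc.measure_lt_top⟩
      have h1 : MemLp (weakGrad v) 2 (volume.restrict k) :=
        hwm.mono_measure (Measure.restrict_mono hk le_rfl)
      exact (h1.integrable (by norm_num)).inner_const e
    -- Fundamental lemma of the calculus of variations: test functions supported in `U` suffice. For
    -- those, integrating by parts over `Ω` (for `v`) and over the whole space (for `q`) gives the
    -- same left-hand side.
    refine hU.ae_eq_zero_of_integral_contDiff_smul_eq_zero (hwl.sub
      (hdq.locallyIntegrable.locallyIntegrableOn _)) fun ψ h1 h2 h3 => ?_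
    have hz : ∀ x ∉ U, ψ x = 0 := fun x hx =>
      image_eq_zero_of_notMem_tsupport fun hx' => hx (h3 hx')
    have hz' : ∀ x ∉ U, fderiv ℝ ψ x e = 0 := fun x hx => by
      rw [fderiv_of_notMem_tsupport ℝ fun hx' => hx (h3 hx')]; simp
    have i1 : Integrable fun x => inner ℝ (weakGrad v x) e * ψ x := by
      refine (integrableOn_iff_integrable_of_support_subset (s := U) fun x hx => ?_).1 ?_
      · by_contra h
        exact hx (by simp [hz x h])
      · exact (hwm.inner_const e).integrable_mul
          ((h1.continuous.memLp_of_hasCompactSupport (p := 2) h2).restrict U)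
    have hdψ : Continuous fun x => fderiv ℝ ψ x e :=
      (h1.continuous_fderiv (by simp)).clm_apply continuous_const
    have i2 : Integrable fun x => fderiv ℝ q x e * ψ x :=
      (hdq.mul h1.continuous).integrable_of_hasCompactSupport h2.mul_left
    have a1 := integral_toL2_mul_fderiv v h1 h2 e
    have a2 : ∫ x in Ω, toL2 v x * fderiv ℝ ψ x e = ∫ x in U, q x * fderiv ℝ ψ x e := by
      rw [setIntegral_eq_integral_of_forall_compl_eq_zero fun x hx => by
          rw [hz' x fun h => hx (hUΩ h), mul_zero],
        ← setIntegral_eq_integral_of_forall_compl_eq_zero (s := U) fun x hx => by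
          rw [hz' x hx, mul_zero]]
      refine integral_congr_ae ?_
      filter_upwards [hv] with x hx
      rw [hx]
    have a3 : ∫ x in Ω, inner ℝ (weakGrad v x) e * ψ x = ∫ x, inner ℝ (weakGrad v x) e * ψ x :=
      setIntegral_eq_integral_of_forall_compl_eq_zero fun x hx => by
        rw [hz x fun h => hx (hUΩ h), mul_zero]
    have a4 : ∫ x in U, q x * fderiv ℝ ψ x e = ∫ x, q x * fderiv ℝ ψ x e :=
      setIntegral_eq_integral_of_forall_compl_eq_zero fun x hx => by rw [hz' x hx, mul_zero]
    have a5 : ∫ x, q x * fderiv ℝ ψ x e = -∫ x, fderiv ℝ q x e * ψ x :=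
      integral_mul_fderiv_eq_neg_fderiv_mul_of_integrable i2
        ((hq.continuous.mul hdψ).integrable_of_hasCompactSupport (h2.fderiv_apply ℝ e).mul_left)
        ((hq.continuous.mul h1.continuous).integrable_of_hasCompactSupport h2.mul_left)
        (fun x _ => hq.differentiable (by simp) x) (fun x _ => h1.differentiable (by simp) x)
    have : ∀ x, ψ x • (inner ℝ (weakGrad v x) e - fderiv ℝ q x e) =
        inner ℝ (weakGrad v x) e * ψ x - fderiv ℝ q x e * ψ x := fun x => by
      rw [smul_eq_mul]; ring
    simp_rw [this]
    rw [integral_sub i1 i2]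
    linarith
  have hall : ∀ᵐ x, ∀ i : Fin d, x ∈ U →
      inner ℝ (weakGrad v x) (EuclideanSpace.single i (1 : ℝ)) -
        fderiv ℝ q x (EuclideanSpace.single i 1) = 0 := ae_all_iff.2 fun i => key _
  filter_upwards [ae_restrict_of_ae hall, ae_restrict_mem hU.measurableSet] with x hx hxU
  ext i
  have := hx i hxU
  rw [← inner_gradient, sub_eq_zero, EuclideanSpace.inner_single_right,
    EuclideanSpace.inner_single_right] at this
  simpa using this

/-- A function in `H^1_0(Ω)` determines its weak gradient. -/
theorem toL2_injective (hΩ : IsOpen Ω) : Function.Injective (toL2 : H10 Ω → L2 Ω) := by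
  intro v w h
  have h0 : toL2 (v - w) =ᵐ[volume.restrict Ω] fun _ => (0 : ℝ) := by
    rw [toL2_sub, h, sub_self]; exact Lp.coeFn_zero _ _ _
  have h1 := weakGrad_ae_eq_gradient (v - w) hΩ subset_rfl contDiff_const h0
  have h2 : weakGrad (v - w) = 0 := by
    refine Lp.ext (h1.trans ?_)
    filter_upwards [Lp.coeFn_zero (E d) 2 (volume.restrict Ω)] with x hx
    rw [hx]; simp [gradient]
  have h3 : weakGrad v = weakGrad w := sub_eq_zero.1 h2
  exact Subtype.ext (Prod.ext h h3)

end OCP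

end

/-! ### Local energies and the Poincaré inequality in `H^1_0`. -/

noncomputable section

namespace OCP

variable {d : ℕ} {Ω : Set (E d)}

/-- The segment may start at any parameter `s` because the truncation argument at a boundary facet
uses only the part of it on one side of a hyperplane. -/
theorem enorm_sub_segment_le {φ : E d → ℝ} (hφ : ContDiff ℝ ∞ φ) (x y : E d) {s : ℝ}
    (hs : s ≤ 1) :
    ‖φ x - φ (y + s • (x - y))‖ₑ ≤
      ‖x - y‖ₑ * ∫⁻ t in Ioc s 1, ‖∇ φ (y + t • (x - y))‖ₑ := by
  have hd : ∀ t : ℝ, HasDerivAt (fun t : ℝ => φ (y + t • (x - y)))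
      (fderiv ℝ φ (y + t • (x - y)) (x - y)) t := fun t => by
    have h1 : HasDerivAt (fun t : ℝ => y + t • (x - y)) (x - y) t := by
      simpa using ((hasDerivAt_id t).smul_const (x - y)).const_add y
    exact ((hφ.differentiable (by simp) _).hasFDerivAt).comp_hasDerivAt t h1
  have hc : Continuous fun t : ℝ => fderiv ℝ φ (y + t • (x - y)) (x - y) :=
    ((hφ.continuous_fderiv (by simp)).comp (by fun_prop)).clm_apply continuous_const
  have h := intervalIntegral.integral_eq_sub_of_hasDerivAt (a := s) (b := 1)
    (fun t _ => hd t) (hc.intervalIntegrable _ _)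
  rw [one_smul, add_sub_cancel] at h
  have hm : Measurable fun t : ℝ => ‖∇ φ (y + t • (x - y))‖ₑ :=
    ((continuous_gradient hφ).comp (by fun_prop :
      Continuous fun t : ℝ => y + t • (x - y))).enorm.measurable
  rw [← h, intervalIntegral.integral_of_le hs, ← lintegral_const_mul _ hm]
  refine (enorm_integral_le_lintegral_enorm _).trans (lintegral_mono fun t => ?_)
  rw [← inner_gradient, ← ofReal_norm, ← ofReal_norm, ← ofReal_norm,
    ← ENNReal.ofReal_mul (norm_nonneg _), mul_comm]
  exact ENNReal.ofReal_le_ofReal (norm_inner_le_norm _ _)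

theorem isUpperGradient_gradient {φ : E d → ℝ} (hφ : ContDiff ℝ ∞ φ) (A B : Set (E d)) :
    IsUpperGradient A B φ fun x => ‖∇ φ x‖ₑ := fun x _ y _ => by
  simpa using enorm_sub_segment_le hφ x y (zero_le_one)

theorem lintegral_enorm_sq {α F : Type*} [MeasurableSpace α] {μ : Measure α}
    [NormedAddCommGroup F] {f : α → F} (hf : MemLp f 2 μ) :
    ∫⁻ x, ‖f x‖ₑ ^ 2 ∂μ = ENNReal.ofReal (∫ x, ‖f x‖ ^ 2 ∂μ) := by
  rw [ofReal_integral_eq_lintegral_ofReal ((memLp_two_iff_integrable_sq_norm hf.1).1 hf)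
    (.of_forall fun x => by positivity)]
  refine lintegral_congr fun x => ?_
  rw [ENNReal.ofReal_pow (norm_nonneg _), ofReal_norm]

theorem norm_sq_eq_integral {α F : Type*} [MeasurableSpace α] {μ : Measure α}
    [NormedAddCommGroup F] (f : Lp F 2 μ) : ‖f‖ ^ 2 = ∫ x, ‖f x‖ ^ 2 ∂μ := by
  have h := lintegral_enorm_sq (Lp.memLp f)
  have h2 : ENNReal.ofReal (‖f‖ ^ 2) = ∫⁻ x, ‖f x‖ₑ ^ 2 ∂μ := by
    rw [Lp.norm_def, eLpNorm_eq_lintegral_rpow_enorm_toReal (by norm_num) (by norm_num),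
      ENNReal.ofReal_pow ENNReal.toReal_nonneg, ENNReal.ofReal_toReal]
    · rw [← ENNReal.rpow_natCast, ← ENNReal.rpow_mul]; simp
    · have := (Lp.memLp f).2
      rw [eLpNorm_eq_lintegral_rpow_enorm_toReal (by norm_num) (by norm_num)] at this
      exact this.ne
  have := h2.trans h
  rwa [ENNReal.ofReal_eq_ofReal_iff (by positivity) (integral_nonneg fun x => by positivity)] at this

/-- A measurable set that is contained in `Ω` up to a null set. -/
structure IsEssentialSubset (K Ω : Set (E d)) : Prop where
  measurableSet : MeasurableSet K
  null : volume (K \ Ω) = 0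

theorem IsEssentialSubset.restrict_restrict {K : Set (E d)} (h : IsEssentialSubset K Ω) :
    (volume.restrict Ω).restrict K = volume.restrict K := by
  rw [Measure.restrict_restrict h.measurableSet]
  refine Measure.restrict_congr_set ?_
  rw [← inter_comm, inter_comm]
  refine Filter.EventuallyLE.antisymm (inter_subset_left.eventuallyLE) ?_
  rw [ae_le_set]
  simpa using h.null

theorem IsEssentialSubset.restrict_le {K : Set (E d)} (h : IsEssentialSubset K Ω) :
    volume.restrict K ≤ volume.restrict Ω := by
  rw [← h.restrict_restrict]; exact Measure.restrict_le_self

/-- The energy `∫_K ‖f‖²`. -/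
def energyOn {F : Type*} [NormedAddCommGroup F] (K : Set (E d)) (f : E d → F) : ℝ :=
  ∫ x in K, ‖f x‖ ^ 2

theorem energyOn_nonneg {F : Type*} [NormedAddCommGroup F] (K : Set (E d)) (f : E d → F) :
    0 ≤ energyOn K f := integral_nonneg fun x => by positivity

theorem IsEssentialSubset.continuous_energyOn {F : Type*} [NormedAddCommGroup F]
    [NormedSpace ℝ F] {K : Set (E d)} (h : IsEssentialSubset K Ω) :
    Continuous fun u : Lp F 2 (volume.restrict Ω) => energyOn K u := by
  have : (fun u : Lp F 2 (volume.restrict Ω) => energyOn K u) = fun u =>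
      ‖LpToLpRestrictCLM (E d) F ℝ (volume.restrict Ω) 2 K u‖ ^ 2 := by
    ext u
    rw [norm_sq_eq_integral, energyOn, ← h.restrict_restrict]
    refine integral_congr_ae ?_
    filter_upwards [LpToLpRestrictCLM_coeFn ℝ K u] with x hx
    rw [hx]
  rw [this]
  fun_prop

theorem IsEssentialSubset.memLp {F : Type*} [NormedAddCommGroup F] {K : Set (E d)}
    (h : IsEssentialSubset K Ω) (u : Lp F 2 (volume.restrict Ω)) :
    MemLp u 2 (volume.restrict K) := (Lp.memLp u).mono_measure h.restrict_le

theorem IsEssentialSubset.continuous_setAverage {K : Set (E d)} (h : IsEssentialSubset K Ω)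
    (hK : volume K ≠ ⊤) : Continuous fun u : L2 Ω => ⨍ x in K, u x := by
  have hi : MemLp (K.indicator fun _ => (1 : ℝ)) 2 (volume.restrict Ω) :=
    memLp_indicator_const 2 h.measurableSet 1 (Or.inr (ne_top_of_le_ne_top hK
      (Measure.restrict_apply_le _ _)))
  have : (fun u : L2 Ω => ⨍ x in K, u x) = fun u => (volume.real K)⁻¹ *
      ∫ x in Ω, u x * K.indicator (fun _ => (1 : ℝ)) x := by
    ext u
    rw [setAverage_eq, smul_eq_mul]
    congr 1
    rw [← h.restrict_restrict, ← integral_indicator h.measurableSet]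
    refine integral_congr_ae (.of_forall fun x => ?_)
    by_cases hx : x ∈ K <;> simp [hx]
  rw [this]
  exact continuous_const.mul (continuous_integral_mul hi)

/-- Expanding the square leaves a polynomial in the energy and the mean value, both continuous in
`u`; hence the left side of the Poincaré inequality is continuous as well. -/
theorem energyOn_sub_const {K : Set (E d)} (hK : volume K ≠ ⊤) {u : E d → ℝ}
    (hu : MemLp u 2 (volume.restrict K)) (c : ℝ) :
    energyOn K (fun x => u x - c) =
      energyOn K u - 2 * c * (volume.real K * ⨍ x in K, u x) + volume.real K * c ^ 2 := by
  have : IsFiniteMeasure (volume.restrict K) := ⟨by simpa using hK.lt_top⟩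
  have hi : IntegrableOn u K := hu.integrable (by norm_num)
  have h2 : ∀ x, ‖u x - c‖ ^ 2 = ‖u x‖ ^ 2 - 2 * c * u x + c ^ 2 := fun x => by
    simp only [Real.norm_eq_abs, sq_abs]; ring
  have h3 : volume.real K * ⨍ x in K, u x = ∫ x in K, u x := by
    by_cases h0 : volume.real K = 0
    · have : volume.restrict K = 0 := by
        rw [Measure.restrict_eq_zero]
        exact (measureReal_eq_zero_iff hK).1 h0
      rw [h0, this]; simp
    · rw [setAverage_eq, smul_eq_mul, mul_inv_cancel_left₀ h0]
  simp only [energyOn, h2]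
  have hs : IntegrableOn (fun x => ‖u x‖ ^ 2) K := (memLp_two_iff_integrable_sq_norm hu.1).1 hu
  have hs2 : IntegrableOn (fun x => ‖u x‖ ^ 2 - 2 * c * u x) K := hs.sub (hi.const_mul _)
  rw [integral_add hs2 (integrable_const _), integral_sub hs (hi.const_mul _),
    integral_const_mul, h3]
  simp

theorem IsEssentialSubset.continuous_energyOn_sub_average {K : Set (E d)}
    (h : IsEssentialSubset K Ω) (hK : volume K ≠ ⊤) :
    Continuous fun u : L2 Ω => energyOn K fun x => u x - ⨍ y in K, u y := by
  have : (fun u : L2 Ω => energyOn K fun x => u x - ⨍ y in K, u y) = fun u : L2 Ω =>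
      energyOn K u - 2 * (⨍ x in K, u x) * (volume.real K * ⨍ x in K, u x) +
        volume.real K * (⨍ x in K, u x) ^ 2 := by
    ext u
    exact energyOn_sub_const hK (h.memLp u) _
  rw [this]
  have h1 := h.continuous_setAverage hK
  exact ((h.continuous_energyOn.sub ((continuous_const.mul h1).mul (continuous_const.mul h1)))).add
    (continuous_const.mul (h1.pow 2))

theorem energyOn_congr_ae {F : Type*} [NormedAddCommGroup F] {K : Set (E d)} {f g : E d → F}
    (h : f =ᵐ[volume.restrict K] g) : energyOn K f = energyOn K g := by
  refine integral_congr_ae ?_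
  filter_upwards [h] with x hx
  rw [hx]

theorem lintegral_enorm_sq_eq_energyOn {F : Type*} [NormedAddCommGroup F] {K : Set (E d)}
    {f : E d → F} (hf : MemLp f 2 (volume.restrict K)) :
    ∫⁻ x in K, ‖f x‖ₑ ^ 2 = ENNReal.ofReal (energyOn K f) := lintegral_enorm_sq hf

theorem enorm_sub_le_of_diam {K : Set (E d)} {D : ℝ}
    (hD : ∀ x ∈ K, ∀ y ∈ K, ‖x - y‖ ≤ D) : ∀ x ∈ K, ∀ y ∈ K, ‖x - y‖ₑ ≤ ENNReal.ofReal D :=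
  fun x hx y hy => by
    rw [← ofReal_norm]; exact ENNReal.ofReal_le_ofReal (hD x hx y hy)

/-- The Poincaré inequality for functions in `H^1_0(Ω)` on a convex subset of `Ω`. -/
theorem H10.energyOn_sub_average_le {K : Set (E d)} (h : IsEssentialSubset K Ω)
    (hKc : Convex ℝ K) (hK0 : volume K ≠ 0) (hK1 : volume K ≠ ⊤) {D : ℝ} (hD0 : 0 ≤ D)
    (hD : ∀ x ∈ K, ∀ y ∈ K, ‖x - y‖ ≤ D) (v : H10 Ω) :
    energyOn K (fun x => toL2 v x - ⨍ y in K, toL2 v y) ≤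
      2 ^ d * D ^ 2 * energyOn K (weakGrad v) := by
  have : IsFiniteMeasure (volume.restrict K) := ⟨by simpa using hK1.lt_top⟩
  refine H10.closure_induction (P := fun u => energyOn K (fun x => u.1 x - ⨍ y in K, u.1 y) ≤
      2 ^ d * D ^ 2 * energyOn K u.2) ?_ ?_ v
  · exact isClosed_le ((h.continuous_energyOn_sub_average hK1).comp continuous_fst)
      (continuous_const.mul (h.continuous_energyOn.comp continuous_snd))
  · rintro u ⟨φ, h1, h2, h3, h4, h5⟩
    have h4' := ae_mono h.restrict_le h4
    have h5' := ae_mono h.restrict_le h5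
    have hav : ⨍ y in K, u.1 y = ⨍ y in K, φ y := average_congr h4'
    have hφ : MemLp φ 2 (volume.restrict K) := (memLp_congr_ae h4').1 (h.memLp u.1)
    have hg : MemLp (∇ φ) 2 (volume.restrict K) := (memLp_congr_ae h5').1 (h.memLp u.2)
    rw [hav, energyOn_congr_ae h5', energyOn_congr_ae (g := fun x => φ x - ⨍ y in K, φ y)
      (by filter_upwards [h4'] with x hx; rw [hx])]
    have := (isUpperGradient_gradient h1 K K).lintegral_sub_average_sq_le hKc h.measurableSet
      (continuous_gradient h1).enorm.measurable (enorm_sub_le_of_diam hD)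
      h1.continuous.measurable hK0 hK1 (hφ.integrable (by norm_num))
    rw [lintegral_enorm_sq_eq_energyOn (f := fun x => φ x - ⨍ y in K, φ y)
      (hφ.sub (memLp_const _)), lintegral_enorm_sq_eq_energyOn hg,
      show (2 : ENNReal) ^ d = ENNReal.ofReal (2 ^ d) by
        rw [ENNReal.ofReal_pow (by norm_num)]; norm_num,
      ← ENNReal.ofReal_pow hD0, ← ENNReal.ofReal_mul (by positivity),
      ← ENNReal.ofReal_mul (by positivity)] at this
    exact (ENNReal.ofReal_le_ofReal_iff (mul_nonneg (by positivity) (energyOn_nonneg _ _))).1 this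

end OCP

end

/-! ### Comparison of mean values, and zero boundary values on a hyperplane. -/

noncomputable section

namespace OCP

variable {d : ℕ} {Ω : Set (E d)}

theorem ENNReal_two_pow (d : ℕ) : (2 : ENNReal) ^ d = ENNReal.ofReal (2 ^ d) := by
  rw [ENNReal.ofReal_pow (by norm_num)]; norm_num

theorem ofReal_volumeReal {K : Set (E d)} (hK : volume K ≠ ⊤) :
    volume K = ENNReal.ofReal (volume.real K) := (ENNReal.ofReal_toReal hK).symm

/-- Mean values of a function in `H^1_0(Ω)` over two parts of a convex subset of `Ω`. -/
theorem H10.sq_average_sub_average_le {K A B : Set (E d)} (h : IsEssentialSubset K Ω)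
    (hKc : Convex ℝ K) (hA : A ⊆ K) (hB : B ⊆ K) (hAm : MeasurableSet A) (hBm : MeasurableSet B)
    (hA0 : volume A ≠ 0) (hB0 : volume B ≠ 0) (hK1 : volume K ≠ ⊤) {D : ℝ} (hD0 : 0 ≤ D)
    (hD : ∀ x ∈ K, ∀ y ∈ K, ‖x - y‖ ≤ D) (v : H10 Ω) :
    ((⨍ y in A, toL2 v y) - ⨍ y in B, toL2 v y) ^ 2 * (volume.real A * volume.real B) ≤
      2 ^ d * D ^ 2 * volume.real K * energyOn K (weakGrad v) := by
  have : IsFiniteMeasure (volume.restrict K) := ⟨by simpa using hK1.lt_top⟩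
  have hA1 : volume A ≠ ⊤ := ne_top_of_le_ne_top hK1 (measure_mono hA)
  have hB1 : volume B ≠ ⊤ := ne_top_of_le_ne_top hK1 (measure_mono hB)
  have hAe : IsEssentialSubset A Ω :=
    ⟨hAm, measure_mono_null (sdiff_subset_sdiff_left hA) h.null⟩
  have hBe : IsEssentialSubset B Ω :=
    ⟨hBm, measure_mono_null (sdiff_subset_sdiff_left hB) h.null⟩
  refine H10.closure_induction (P := fun u => ((⨍ y in A, u.1 y) - ⨍ y in B, u.1 y) ^ 2 *
    (volume.real A * volume.real B) ≤ 2 ^ d * D ^ 2 * volume.real K * energyOn K u.2) ?_ ?_ v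
  · refine isClosed_le (((((hAe.continuous_setAverage hA1).comp continuous_fst).sub
      ((hBe.continuous_setAverage hB1).comp continuous_fst)).pow 2).mul continuous_const)
      (continuous_const.mul (h.continuous_energyOn.comp continuous_snd))
  · rintro u ⟨φ, h1, h2, h3, h4, h5⟩
    have h5' := ae_mono h.restrict_le h5
    have hg : MemLp (∇ φ) 2 (volume.restrict K) := (memLp_congr_ae h5').1 (h.memLp u.2)
    rw [average_congr (ae_mono hAe.restrict_le h4), average_congr (ae_mono hBe.restrict_le h4),
      energyOn_congr_ae h5']
    have hi : Integrable φ := h1.continuous.integrable_of_hasCompactSupport h2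
    have := (isUpperGradient_gradient h1 A B).enorm_average_sub_average_sq_le hKc h.measurableSet
      hA hB hAm hBm (continuous_gradient h1).enorm.measurable (enorm_sub_le_of_diam hD)
      h1.continuous.measurable hA0 hB0 hA1 hB1 hi.integrableOn hi.integrableOn
    rw [lintegral_enorm_sq_eq_energyOn hg, ENNReal_two_pow, ← ENNReal.ofReal_pow hD0,
      ofReal_volumeReal hA1, ofReal_volumeReal hB1, ofReal_volumeReal hK1, ← ofReal_norm,
      ← ENNReal.ofReal_pow (norm_nonneg _), ← ENNReal.ofReal_mul measureReal_nonneg,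
      ← ENNReal.ofReal_mul (by positivity), ← ENNReal.ofReal_mul (by positivity),
      ← ENNReal.ofReal_mul (by positivity), ← ENNReal.ofReal_mul (by positivity),
      Real.norm_eq_abs, sq_abs] at this
    exact (ENNReal.ofReal_le_ofReal_iff (mul_nonneg (by positivity) (energyOn_nonneg _ _))).1 this

theorem affine_segment (g : E d →ᵃ[ℝ] ℝ) (x y : E d) (t : ℝ) :
    g (y + t • (x - y)) = g y + t * (g x - g y) := by
  rw [add_comm, ← AffineMap.lineMap_apply_module', AffineMap.apply_lineMap,
    AffineMap.lineMap_apply_module', smul_eq_mul, add_comm]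

/-- A segment from `g < 0` to `0 ≤ g` crosses the hyperplane at a point where `φ = 0`, and only the
piece after the crossing contributes. Hence truncation of `φ` to one side needs no gradient on the
other side, where `φ` is irrelevant. -/
theorem isUpperGradient_truncation {φ : E d → ℝ} (hφ : ContDiff ℝ ∞ φ) {K : Set (E d)}
    (hK : Convex ℝ K) (g : E d →ᵃ[ℝ] ℝ) (h0 : ∀ x ∈ K, g x = 0 → φ x = 0) :
    IsUpperGradient (K ∩ {x | 0 ≤ g x}) (K ∩ {x | g x < 0}) ({x | 0 ≤ g x}.indicator φ)
      ({x | 0 ≤ g x}.indicator fun x => ‖∇ φ x‖ₑ) := by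
  rintro x ⟨hxK, hx⟩ y ⟨hyK, hy⟩
  simp only [mem_ofPred_eq] at hx hy
  have hgt : ∀ t : ℝ, g (y + t • (x - y)) = g y + t * (g x - g y) := affine_segment g x y
  set s := -g y / (g x - g y) with hs
  have hpos : 0 < g x - g y := by linarith
  have hs0 : 0 ≤ s := div_nonneg (by linarith) hpos.le
  have hs1 : s ≤ 1 := by rw [hs, div_le_one hpos]; linarith
  have hgs : g (y + s • (x - y)) = 0 := by rw [hgt, hs]; field_simp; ring
  have hφs : φ (y + s • (x - y)) = 0 := h0 _ (hK.add_smul_sub_mem hyK hxK ⟨hs0, hs1⟩) hgs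
  rw [indicator_of_mem (show x ∈ {x | 0 ≤ g x} from hx),
    indicator_of_notMem (show y ∉ {x | 0 ≤ g x} from not_le.2 hy)]
  have h := enorm_sub_segment_le hφ x y hs1
  rw [hφs] at h
  refine h.trans (mul_le_mul_right ?_ _)
  calc ∫⁻ t in Ioc s 1, ‖∇ φ (y + t • (x - y))‖ₑ
      = ∫⁻ t in Ioc s 1, {x | 0 ≤ g x}.indicator (fun x => ‖∇ φ x‖ₑ) (y + t • (x - y)) := by
        refine setLIntegral_congr_fun measurableSet_Ioc fun t ht => ?_
        rw [indicator_of_mem]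
        have : s * (g x - g y) = - g y := by rw [hs]; field_simp
        have := mul_le_mul_of_nonneg_right ht.1.le hpos.le
        simp only [mem_ofPred_eq, hgt]; linarith
    _ ≤ _ := lintegral_mono_set (Ioc_subset_Ioc_left hs0)

/-- A bound for the mean value of a function in `H^1_0(Ω)` over the part of a convex set on one side
of a hyperplane that carries zero boundary values. -/
theorem H10.sq_average_le_of_boundary {K : Set (E d)} (hKm : MeasurableSet K)
    (hKc : Convex ℝ K) (g : E d →ᵃ[ℝ] ℝ) (h : IsEssentialSubset (K ∩ {x | 0 ≤ g x}) Ω)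
    (h0 : ∀ x ∈ K, g x = 0 → x ∉ Ω) (hA0 : volume (K ∩ {x | 0 ≤ g x}) ≠ 0)
    (hB0 : volume (K ∩ {x | g x < 0}) ≠ 0) (hK1 : volume K ≠ ⊤) {D : ℝ} (hD0 : 0 ≤ D)
    (hD : ∀ x ∈ K, ∀ y ∈ K, ‖x - y‖ ≤ D) (v : H10 Ω) :
    (⨍ y in K ∩ {x | 0 ≤ g x}, toL2 v y) ^ 2 *
        (volume.real (K ∩ {x | 0 ≤ g x}) * volume.real (K ∩ {x | g x < 0})) ≤
      2 ^ d * D ^ 2 * volume.real K * energyOn (K ∩ {x | 0 ≤ g x}) (weakGrad v) := by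
  have hgm : Measurable g := (AffineMap.continuous_of_finiteDimensional g).measurable
  have hPm : MeasurableSet {x | 0 ≤ g x} := measurableSet_le measurable_const hgm
  have hBm : MeasurableSet (K ∩ {x | g x < 0}) := hKm.inter (measurableSet_lt hgm measurable_const)
  set A := K ∩ {x | 0 ≤ g x} with hA
  set B := K ∩ {x | g x < 0} with hB
  have hA1 : volume A ≠ ⊤ := ne_top_of_le_ne_top hK1 (measure_mono inter_subset_left)
  have hB1 : volume B ≠ ⊤ := ne_top_of_le_ne_top hK1 (measure_mono inter_subset_left)
  refine H10.closure_induction (P := fun u => (⨍ y in A, u.1 y) ^ 2 *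
    (volume.real A * volume.real B) ≤ 2 ^ d * D ^ 2 * volume.real K * energyOn A u.2) ?_ ?_ v
  · exact isClosed_le ((((h.continuous_setAverage hA1).comp continuous_fst).pow 2).mul
      continuous_const) (continuous_const.mul (h.continuous_energyOn.comp continuous_snd))
  · rintro u ⟨φ, h1, h2, h3, h4, h5⟩
    have h5' := ae_mono h.restrict_le h5
    have hg : MemLp (∇ φ) 2 (volume.restrict A) := (memLp_congr_ae h5').1 (h.memLp u.2)
    rw [average_congr (ae_mono h.restrict_le h4), energyOn_congr_ae h5']
    have hi : Integrable ({x | 0 ≤ g x}.indicator φ) :=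
      (h1.continuous.integrable_of_hasCompactSupport h2).indicator hPm
    have hφ0 : ∀ x ∈ K, g x = 0 → φ x = 0 := fun x hx hgx =>
      image_eq_zero_of_notMem_tsupport fun hx' => h0 x hx hgx (h3 hx')
    have := (isUpperGradient_truncation h1 hKc g hφ0).enorm_average_sub_average_sq_le hKc hKm
      inter_subset_left inter_subset_left h.measurableSet hBm
      ((continuous_gradient h1).enorm.measurable.indicator hPm) (enorm_sub_le_of_diam hD)
      (h1.continuous.measurable.indicator hPm) hA0 hB0 hA1 hB1 hi.integrableOn hi.integrableOn
    have e1 : ⨍ x in A, {x | 0 ≤ g x}.indicator φ x = ⨍ x in A, φ x := by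
      refine average_congr ?_
      filter_upwards [ae_restrict_mem h.measurableSet] with x hx
      rw [indicator_of_mem hx.2]
    -- The truncation vanishes on `B`, so the comparison of two means becomes a bound on the mean
    -- over `A` alone.
    have e2 : ⨍ x in B, {x | 0 ≤ g x}.indicator φ x = 0 := by
      rw [average_congr (g := fun _ => (0 : ℝ))]
      · simp [average]
      · filter_upwards [ae_restrict_mem hBm] with x hx
        rw [indicator_of_notMem]
        have : g x < 0 := hx.2
        exact not_le.2 this
    have e3 : ∫⁻ x in K, {x | 0 ≤ g x}.indicator (fun x => ‖∇ φ x‖ₑ) x ^ 2 =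
        ∫⁻ x in A, ‖∇ φ x‖ₑ ^ 2 := by
      rw [hA, inter_comm, ← Measure.restrict_restrict hPm, ← lintegral_indicator hPm]
      refine lintegral_congr fun x => ?_
      by_cases hx : x ∈ {x | 0 ≤ g x}
      · rw [indicator_of_mem hx, indicator_of_mem hx]
      · rw [indicator_of_notMem hx, indicator_of_notMem hx]; simp
    rw [e1, e2, e3, sub_zero, lintegral_enorm_sq_eq_energyOn hg, ENNReal_two_pow,
      ← ENNReal.ofReal_pow hD0,
      ofReal_volumeReal hA1, ofReal_volumeReal hB1, ofReal_volumeReal hK1, ← ofReal_norm,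
      ← ENNReal.ofReal_pow (norm_nonneg _), ← ENNReal.ofReal_mul measureReal_nonneg,
      ← ENNReal.ofReal_mul (by positivity), ← ENNReal.ofReal_mul (by positivity),
      ← ENNReal.ofReal_mul (by positivity), ← ENNReal.ofReal_mul (by positivity),
      Real.norm_eq_abs, sq_abs] at this
    exact (ENNReal.ofReal_le_ofReal_iff (mul_nonneg (by positivity) (energyOn_nonneg _ _))).1 this

end OCP

end

/-! ### The Poincaré–Friedrichs inequality. -/

noncomputable section

namespace OCP

variable {d : ℕ} {Ω : Set (E d)}

theorem exists_testGraph {φ : E d → ℝ} (h1 : ContDiff ℝ ∞ φ) (h2 : HasCompactSupport φ)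
    (h3 : tsupport φ ⊆ Ω) : ∃ u ∈ testGraph Ω, u.1 =ᵐ[volume.restrict Ω] φ ∧
      u.2 =ᵐ[volume.restrict Ω] ∇ φ := by
  have m1 : MemLp φ 2 (volume.restrict Ω) := h1.continuous.memLp_of_hasCompactSupport h2
  have hc : HasCompactSupport (∇ φ) :=
    (h2.fderiv ℝ).comp_left (g := (InnerProductSpace.toDual ℝ (E d)).symm) (by simp)
  have m2 : MemLp (∇ φ) 2 (volume.restrict Ω) :=
    (continuous_gradient h1).memLp_of_hasCompactSupport hc
  exact ⟨(m1.toLp, m2.toLp), ⟨φ, h1, h2, h3, m1.coeFn_toLp, m2.coeFn_toLp⟩, m1.coeFn_toLp,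
    m2.coeFn_toLp⟩

theorem exists_l2Norm_pos (hΩ : IsOpen Ω) (hne : Ω.Nonempty) : ∃ v : H10 Ω, 0 < l2Norm v := by
  obtain ⟨c, hc⟩ := hne
  obtain ⟨r, hr, hrΩ⟩ := Metric.nhds_basis_closedBall.mem_iff.1 (hΩ.mem_nhds hc)
  let b : ContDiffBump c := ⟨r / 2, r, by positivity, by linarith⟩
  obtain ⟨u, hu, hu1, -⟩ := exists_testGraph (Ω := Ω) b.contDiff b.hasCompactSupport
    (by rw [b.tsupport_eq]; exact hrΩ)
  refine ⟨⟨u, (testGraph Ω).le_topologicalClosure hu⟩, ?_⟩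
  rw [l2Norm, norm_pos_iff]
  intro h0
  have h : (b : E d → ℝ) =ᵐ[volume.restrict Ω] fun _ => 0 := by
    have h0' : u.1 = 0 := h0
    rw [h0'] at hu1
    exact hu1.symm.trans (Lp.coeFn_zero _ _ _)
  have := Measure.eqOn_open_of_ae_eq h hΩ b.continuous.continuousOn continuousOn_const hc
  rw [b.one_of_mem_closedBall (Metric.mem_closedBall_self b.rIn_pos.le)] at this
  exact one_ne_zero this

/-- A bump function has positive `L₂` norm, which excludes `C ≤ 0`. The error estimate is stated for
arbitrary admissible constants and needs this sign. -/
theorem PoincareFriedrichs.pos {C : ℝ} (h : PoincareFriedrichs Ω C) (hΩ : IsOpen Ω)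
    (hne : Ω.Nonempty) : 0 < C := by
  obtain ⟨v, hv⟩ := exists_l2Norm_pos hΩ hne
  have h1 := h v
  by_contra hC
  have h2 : 0 < l2Norm v ^ 2 := by positivity
  have h3 := mul_nonpos_of_nonpos_of_nonneg (not_lt.1 hC) (sq_nonneg (h1Seminorm v))
  linarith

theorem ofReal_norm_sq_eq_lintegral {F : Type*} [NormedAddCommGroup F]
    (u : Lp F 2 (volume.restrict Ω)) {f : E d → F} (h : u =ᵐ[volume.restrict Ω] f) :
    ENNReal.ofReal (‖u‖ ^ 2) = ∫⁻ x in Ω, ‖f x‖ₑ ^ 2 := by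
  rw [norm_sq_eq_integral, ← lintegral_enorm_sq (Lp.memLp u)]
  refine lintegral_congr_ae ?_
  filter_upwards [h] with x hx
  rw [hx]

/-- Test functions vanish on a unit ball `B` away from `Ω`. The double integral of `|φ x - φ y|²`
over `A × B`, with `A` a ball around `Ω`, is then `|B| ‖φ‖²`, and the convex Poincaré inequality on
a ball containing both bounds it. -/
theorem exists_poincareFriedrichs (hd : 1 ≤ d) (hΩ : IsOpen Ω) (hb : Bornology.IsBounded Ω) :
    ∃ C, PoincareFriedrichs Ω C := by
  obtain ⟨R, hR, hΩR⟩ := hb.subset_closedBall_lt 0 0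
  have : Nonempty (Fin d) := ⟨⟨0, hd⟩⟩
  -- The norm exceeds `R + 1` so that the unit ball at `p` misses the ball of radius `R`; such a
  -- point exists because `d ≥ 1`.
  obtain ⟨p, hp⟩ := NormedSpace.exists_lt_norm ℝ (E d) (R + 1)
  set K := Metric.closedBall (0 : E d) (‖p‖ + 1) with hK
  set A := Metric.closedBall (0 : E d) R with hA
  set B := Metric.closedBall p 1 with hB
  have hAK : A ⊆ K := Metric.closedBall_subset_closedBall (by linarith)
  have hBK : B ⊆ K := Metric.closedBall_subset_closedBall' (by simp [add_comm])
  have hBΩ : ∀ y ∈ B, y ∉ Ω := fun y hy hyΩ => by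
    have h1 := hΩR hyΩ
    rw [hB, mem_closedBall_iff_norm'] at hy
    rw [hA, mem_closedBall_zero_iff] at h1
    linarith [norm_sub_norm_le p y]
  have hKm : MeasurableSet K := Metric.isClosed_closedBall.measurableSet
  have hAm : MeasurableSet A := Metric.isClosed_closedBall.measurableSet
  have hBm : MeasurableSet B := Metric.isClosed_closedBall.measurableSet
  have hB0 : volume B ≠ 0 := (Metric.measure_closedBall_pos _ _ one_pos).ne'
  have hB1 : volume B ≠ ⊤ := measure_closedBall_lt_top.ne
  have hK1 : volume K ≠ ⊤ := measure_closedBall_lt_top.ne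
  set D : ENNReal := ENNReal.ofReal (2 * (‖p‖ + 1))
  have hD : ∀ x ∈ K, ∀ y ∈ K, ‖x - y‖ₑ ≤ D := enorm_sub_le_of_diam fun x hx y hy => by
    rw [hK, mem_closedBall_zero_iff] at hx hy
    linarith [norm_sub_le x y]
  set M : ENNReal := 2 ^ d * D ^ 2 * volume K / volume B with hM
  have hM1 : M ≠ ⊤ := ENNReal.div_ne_top (ENNReal.mul_ne_top (ENNReal.mul_ne_top (by simp)
    (ENNReal.pow_ne_top ENNReal.ofReal_ne_top)) hK1) hB0
  refine ⟨M.toReal, fun v => ?_⟩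
  refine H10.closure_induction (P := fun u => ‖u.1‖ ^ 2 ≤ M.toReal * ‖u.2‖ ^ 2) ?_ ?_ v
  · exact isClosed_le (by fun_prop) (by fun_prop)
  · rintro u ⟨φ, h1, h2, h3, h4, h5⟩
    have h := (isUpperGradient_gradient h1 A B).lintegral_lintegral_sub_sq_le
      (convex_closedBall _ _) hKm hAK hBK hAm hBm (continuous_gradient h1).enorm.measurable hD
    have e1 : ∫⁻ x in A, ∫⁻ y in B, ‖φ x - φ y‖ₑ ^ 2 =
        volume B * ∫⁻ x in A, ‖φ x‖ₑ ^ 2 := by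
      rw [← lintegral_const_mul _ (h1.continuous.enorm.measurable.pow_const 2)]
      refine lintegral_congr fun x => ?_
      rw [setLIntegral_congr_fun (g := fun _ => ‖φ x‖ₑ ^ 2) hBm fun y hy => ?_,
        setLIntegral_const, mul_comm]
      simp only
      rw [image_eq_zero_of_notMem_tsupport fun h' => hBΩ y hy (h3 h'), sub_zero]
    have e2 : ∫⁻ x in K, ‖∇ φ x‖ₑ ^ 2 = ∫⁻ x in Ω, ‖∇ φ x‖ₑ ^ 2 := by
      have hz : ∀ x ∉ Ω, ‖∇ φ x‖ₑ ^ 2 = 0 := fun x hx => by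
        rw [← ofReal_norm, norm_gradient,
          fderiv_of_notMem_tsupport ℝ fun h' => hx (h3 h')]
        simp
      rw [← lintegral_indicator hKm, ← lintegral_indicator hΩ.measurableSet]
      refine lintegral_congr fun x => ?_
      by_cases hx : x ∈ Ω
      · rw [indicator_of_mem hx, indicator_of_mem (hAK (hΩR hx))]
      · rw [indicator_of_notMem hx]
        by_cases hxK : x ∈ K
        · rw [indicator_of_mem hxK, hz x hx]
        · rw [indicator_of_notMem hxK]
    rw [e1, e2] at h
    have h6 : ∫⁻ x in Ω, ‖φ x‖ₑ ^ 2 ≤ M * ∫⁻ x in Ω, ‖∇ φ x‖ₑ ^ 2 := by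
      refine (lintegral_mono_set hΩR).trans ((ENNReal.mul_le_mul_iff_right hB0 hB1).1 (h.trans ?_))
      rw [hM, ← mul_assoc, ENNReal.mul_div_cancel hB0 hB1]
    rw [← ofReal_norm_sq_eq_lintegral u.1 h4, ← ofReal_norm_sq_eq_lintegral u.2 h5,
      ← ENNReal.ofReal_toReal hM1, ← ENNReal.ofReal_mul ENNReal.toReal_nonneg] at h6
    exact (ENNReal.ofReal_le_ofReal_iff (by positivity)).1 h6

end OCP

end

/-! ### Lipschitz functions with zero boundary values belong to `H^1_0`. -/

noncomputable section

namespace OCP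

open Filter Topology

variable {d : ℕ} {Ω : Set (E d)}

/-- A bounded sequence in a closed subspace of a Hilbert space has a weak cluster point in it. -/
theorem exists_weak_limit {H : Type*} [NormedAddCommGroup H] [InnerProductSpace ℝ H]
    [CompleteSpace H] (G : Submodule ℝ H) (hG : IsClosed (G : Set H)) (u : ℕ → H)
    (hu : ∀ n, u n ∈ G) {C : ℝ} (hC : ∀ n, ‖u n‖ ≤ C) :
    ∃ w ∈ G, ∀ x c, Tendsto (fun n => inner ℝ (u n) x) atTop (𝓝 c) → inner ℝ w x = c := by
  have hb : ∀ n x, |inner ℝ (u n) x| ≤ C * ‖x‖ := fun n x =>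
    (abs_real_inner_le_norm _ _).trans (by gcongr; exact hC n)
  -- Along a nonprincipal ultrafilter all the bounded sequences `⟨u n, x⟩` converge at once. The
  -- limits are linear and bounded in `x`, so the Riesz theorem supplies `w`.
  let F : Ultrafilter ℕ := hyperfilter ℕ
  have hF : (F : Filter ℕ) ≤ atTop := by
    rw [← Nat.cofinite_eq_atTop]; exact hyperfilter_le_cofinite
  have hex : ∀ x, ∃ c ∈ Icc (-(C * ‖x‖)) (C * ‖x‖),
      Tendsto (fun n => inner ℝ (u n) x) F (𝓝 c) := fun x =>
    (isCompact_Icc).ultrafilter_le_nhds' (F.map fun n => inner ℝ (u n) x)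
      (Ultrafilter.mem_map.2 (univ_mem' fun n => abs_le.1 (hb n x)))
  choose ℓ hℓb hℓ using hex
  have hadd : ∀ x y, ℓ (x + y) = ℓ x + ℓ y := fun x y =>
    tendsto_nhds_unique (hℓ (x + y)) (by simpa only [inner_add_right] using (hℓ x).add (hℓ y))
  have hsmul : ∀ (c : ℝ) x, ℓ (c • x) = c • ℓ x := fun c x =>
    tendsto_nhds_unique (hℓ (c • x)) (by
      simpa only [real_inner_smul_right, smul_eq_mul] using (hℓ x).const_mul c)
  let Λ : H →L[ℝ] ℝ := LinearMap.mkContinuous ⟨⟨ℓ, hadd⟩, hsmul⟩ C fun x => abs_le.2 (hℓb x)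
  refine ⟨(InnerProductSpace.toDual ℝ H).symm Λ, ?_, fun x c hc => ?_⟩
  · have : CompleteSpace G := hG.completeSpace_coe
    rw [← Submodule.orthogonal_orthogonal G, Submodule.mem_orthogonal]
    intro x hx
    rw [real_inner_comm, InnerProductSpace.toDual_symm_apply]
    have h0 : ∀ n, inner ℝ (u n) x = 0 := fun n => (Submodule.mem_orthogonal _ _).1 hx _ (hu n)
    refine tendsto_nhds_unique (hℓ x) ?_
    simp only [h0]
    exact tendsto_const_nhds
  · rw [InnerProductSpace.toDual_symm_apply]
    exact tendsto_nhds_unique (hℓ x) (hc.mono_left hF)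

/-- Soft thresholding. -/
def softThreshold (ε t : ℝ) : ℝ := t - max (-ε) (min t ε)

theorem abs_softThreshold_sub_le (ε a b : ℝ) :
    |softThreshold ε a - softThreshold ε b| ≤ |a - b| := by
  unfold softThreshold
  rcases abs_cases (a - b) with ⟨h, _⟩ | ⟨h, _⟩ <;> rw [h, abs_le] <;>
  rcases max_cases (-ε) (min a ε) with ⟨h1, _⟩ | ⟨h1, _⟩ <;>
  rcases max_cases (-ε) (min b ε) with ⟨h2, _⟩ | ⟨h2, _⟩ <;>
  rcases min_cases a ε with ⟨h3, _⟩ | ⟨h3, _⟩ <;>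
  rcases min_cases b ε with ⟨h4, _⟩ | ⟨h4, _⟩ <;>
  rw [h1, h2] <;> constructor <;> linarith

theorem abs_softThreshold_sub_self_le {ε : ℝ} (hε : 0 ≤ ε) (a : ℝ) :
    |softThreshold ε a - a| ≤ ε := by
  rw [softThreshold, sub_sub_cancel_left, abs_neg, abs_le]
  exact ⟨le_max_left _ _, max_le (by linarith) (min_le_right _ _)⟩

theorem softThreshold_eq_zero {ε a : ℝ} (h : |a| ≤ ε) : softThreshold ε a = 0 := by
  rw [softThreshold, min_eq_left (abs_le.1 h).2, max_eq_right (abs_le.1 h).1, sub_self]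

-- Soft thresholding moves the support of `f` into the compact set `|f| ≥ η / 2` inside `Ω` without
-- raising the Lipschitz constant. This leaves room to mollify.
open scoped Convolution in
open ContinuousLinearMap in
theorem exists_smooth_approx (hΩ : IsOpen Ω) (hb : Bornology.IsBounded Ω) {f : E d → ℝ}
    {L : NNReal} (hf : LipschitzWith L f) (h0 : ∀ x ∉ Ω, f x = 0) {η : ℝ} (hη : 0 < η) :
    ∃ ψ : E d → ℝ, ContDiff ℝ ∞ ψ ∧ HasCompactSupport ψ ∧ tsupport ψ ⊆ Ω ∧
      LipschitzWith L ψ ∧ ∀ x, |ψ x - f x| ≤ η := by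
  set g : E d → ℝ := fun x => softThreshold (η / 2) (f x) with hg
  have hgL : LipschitzWith L g := LipschitzWith.of_dist_le_mul fun x y => by
    rw [Real.dist_eq]
    exact (abs_softThreshold_sub_le _ _ _).trans (by rw [← Real.dist_eq]; exact hf.dist_le_mul x y)
  set K := {x | η / 2 ≤ |f x|} with hK
  have hKc : IsClosed K := isClosed_le continuous_const hf.continuous.abs
  have hKΩ : K ⊆ Ω := fun x hx => by
    by_contra h
    rw [hK, mem_ofPred_eq, h0 x h, abs_zero] at hx
    linarith
  have hKk : IsCompact K := Metric.isCompact_of_isClosed_isBounded hKc (hb.subset hKΩ)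
  have hgK : Function.support g ⊆ K := fun x hx => by
    by_contra h
    rw [hK, mem_ofPred_eq, not_le] at h
    exact hx (softThreshold_eq_zero h.le)
  have hgt : tsupport g ⊆ K := closure_minimal hgK hKc
  have hgc : HasCompactSupport g := hKk.of_isClosed_subset (isClosed_tsupport g) hgt
  obtain ⟨δ, hδ, hδΩ⟩ := hKk.exists_cthickening_subset_open hΩ hKΩ
  -- The first bound keeps the mollified support in `Ω`, the second keeps the mollification error
  -- below `η / 2`; `L + 1` allows for `L = 0`.
  set ρ := min δ (η / (2 * (L + 1))) with hρ
  have hρ0 : 0 < ρ := lt_min hδ (by positivity)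
  let b : ContDiffBump (0 : E d) := ⟨ρ / 2, ρ, by positivity, by linarith⟩
  set ψ : E d → ℝ := b.normed volume ⋆[lsmul ℝ ℝ, volume] g with hψ
  have hψx : ∀ x, ψ x = ∫ t, b.normed volume t * g (x - t) := fun x => by
    rw [hψ, convolution_def]; simp
  have hint : ∀ x, Integrable fun t => b.normed volume t * g (x - t) := fun x =>
    (b.continuous_normed.mul (hgL.continuous.comp (by fun_prop))).integrable_of_hasCompactSupport
      b.hasCompactSupport_normed.mul_right
  refine ⟨ψ, b.hasCompactSupport_normed.contDiff_convolution_left _ b.contDiff_normed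
    hgL.continuous.locallyIntegrable, b.hasCompactSupport_normed.convolution _ hgc, ?_, ?_, ?_⟩
  · refine (closure_minimal ?_ Metric.isClosed_cthickening).trans hδΩ
    refine (support_convolution_subset _).trans ?_
    rw [b.support_normed_eq]
    rintro _ ⟨x, hx, y, hy, rfl⟩
    refine Metric.mem_cthickening_of_dist_le _ y _ _ (hgK hy) ?_
    rw [dist_eq_norm]
    simp only [add_sub_cancel_right]
    rw [mem_ball_zero_iff] at hx
    exact hx.le.trans (min_le_left _ _)
  · refine LipschitzWith.of_dist_le_mul fun x y => ?_
    rw [Real.dist_eq, hψx, hψx, ← integral_sub (hint x) (hint y), ← Real.norm_eq_abs]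
    calc ‖∫ t, (b.normed volume t * g (x - t) - b.normed volume t * g (y - t))‖
        ≤ ∫ t, b.normed volume t * (L * dist x y) := by
          refine norm_integral_le_of_norm_le (b.integrable_normed.mul_const _)
            (.of_forall fun t => ?_)
          rw [← mul_sub, norm_mul, Real.norm_of_nonneg (b.nonneg_normed t), ← dist_eq_norm]
          gcongr
          · exact b.nonneg_normed t
          · simpa using hgL.dist_le_mul (x - t) (y - t)
      _ = L * dist x y := by rw [integral_mul_const, b.integral_normed, one_mul]
  · intro x
    have h1 : dist (ψ x) (g x) ≤ η / 2 := by
      refine b.dist_normed_convolution_le hgL.continuous.aestronglyMeasurable fun y hy => ?_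
      refine (hgL.dist_le_mul y x).trans ?_
      have h2 : dist y x ≤ η / (2 * (L + 1)) := (Metric.mem_ball.1 hy).le.trans (min_le_right _ _)
      calc (L : ℝ) * dist y x ≤ (L + 1) * (η / (2 * (L + 1))) := by gcongr; linarith
        _ = η / 2 := by field_simp
    rw [Real.dist_eq] at h1
    have h2 := abs_softThreshold_sub_self_le (by positivity : 0 ≤ η / 2) (f x)
    calc |ψ x - f x| ≤ |ψ x - g x| + |g x - f x| := abs_sub_le _ _ _
      _ ≤ η := by linarith

/-- Lipschitz functions that vanish outside a bounded open set belong to `H^1_0`. -/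
theorem exists_represents_of_lipschitz (hΩ : IsOpen Ω) (hb : Bornology.IsBounded Ω) {f : E d → ℝ}
    {L : NNReal} (hf : LipschitzWith L f) (h0 : ∀ x ∉ Ω, f x = 0) :
    ∃ v : H10 Ω, Represents f v := by
  have : IsFiniteMeasure (volume.restrict Ω) := ⟨by simpa using hb.measure_lt_top⟩
  have hη : ∀ n : ℕ, (0 : ℝ) < 1 / (n + 1) := fun n => by positivity
  choose ψ h1 h2 h3 hL h5 using fun n : ℕ => exists_smooth_approx hΩ hb hf h0 (hη n)
  choose u huG hu1 hu2 using fun n : ℕ => exists_testGraph (h1 n) (h2 n) (h3 n)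
  have hfc : HasCompactSupport f := by
    refine HasCompactSupport.of_support_subset_isCompact hb.isCompact_closure fun x hx => ?_
    by_contra h
    exact hx (h0 x fun h' => h (subset_closure h'))
  have hfm : MemLp f 2 (volume.restrict Ω) := hf.continuous.memLp_of_hasCompactSupport hfc
  set F : L2 Ω := hfm.toLp f with hF
  set m : ℝ := (measureUnivNNReal (volume.restrict Ω) : ℝ) ^ ((2 : ENNReal).toReal)⁻¹ with hm
  have hd1 : ∀ n, ‖(u n).1 - F‖ ≤ m * (1 / (n + 1)) := fun n => by
    refine Lp.norm_le_of_ae_bound (hη n).le ?_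
    filter_upwards [Lp.coeFn_sub (u n).1 F, hu1 n, hfm.coeFn_toLp] with x a b c
    rw [a, Pi.sub_apply, b, c]
    exact h5 n x
  have hd2 : ∀ n, ‖(u n).2‖ ≤ m * L := fun n => by
    refine Lp.norm_le_of_ae_bound L.2 ?_
    filter_upwards [hu2 n] with x a
    rw [a, norm_gradient]
    exact norm_fderiv_le_of_lipschitz ℝ (hL n)
  have hm0 : 0 ≤ m := by positivity
  have hlim : Tendsto (fun n => (u n).1) atTop (𝓝 F) := by
    rw [tendsto_iff_norm_sub_tendsto_zero]
    refine squeeze_zero (fun n => norm_nonneg _) hd1 ?_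
    simpa using (tendsto_one_div_add_atTop_nhds_zero_nat (𝕜 := ℝ)).const_mul m
  -- The gradients are only bounded, so a weak limit is taken, in the pair space with its Hilbert
  -- norm. The limit stays in the closed subspace `H^1_0`, and its first component is `F` because
  -- the functions converge strongly.
  let e := WithLp.prodContinuousLinearEquiv 2 ℝ (L2 Ω) (L2Vec Ω)
  let G : Submodule ℝ (WithLp 2 (L2 Ω × L2Vec Ω)) := (H10 Ω).comap e.toLinearEquiv.toLinearMap
  have hGc : IsClosed (G : Set (WithLp 2 (L2 Ω × L2Vec Ω))) :=
    (testGraph Ω).isClosed_topologicalClosure.preimage e.continuous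
  have hub : ∀ n, ‖e.symm (u n)‖ ≤ (‖F‖ + m) + m * L := fun n => by
    have a1 : ‖(u n).1‖ ≤ ‖F‖ + m := by
      have := norm_le_norm_add_norm_sub' (u n).1 F
      have h' : m * (1 / ((n : ℝ) + 1)) ≤ m * 1 := by
        gcongr
        rw [div_le_one (by positivity)]; linarith [(Nat.cast_nonneg n : (0 : ℝ) ≤ n)]
      linarith [hd1 n]
    have a2 : ‖e.symm (u n)‖ ≤ ‖(u n).1‖ + ‖(u n).2‖ := by
      rw [WithLp.prod_norm_eq_of_L2, Real.sqrt_le_left (by positivity)]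
      have e1 : (e.symm (u n)).fst = (u n).1 := rfl
      have e2 : (e.symm (u n)).snd = (u n).2 := rfl
      rw [e1, e2]
      nlinarith [norm_nonneg (u n).1, norm_nonneg (u n).2]
    linarith [hd2 n]
  obtain ⟨w, hwG, hw⟩ := exists_weak_limit G hGc (fun n => e.symm (u n))
    (fun n => (testGraph Ω).le_topologicalClosure (huG n)) hub
  refine ⟨⟨e w, hwG⟩, ?_⟩
  have hwF : w.fst = F := by
    refine ext_inner_right ℝ fun x => ?_
    have h := hw (WithLp.toLp 2 (x, 0)) (inner ℝ F x) ?_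
    · simpa [WithLp.prod_inner_apply] using h
    · have : ∀ n, inner ℝ (e.symm (u n)) (WithLp.toLp 2 (x, (0 : L2Vec Ω))) =
          inner ℝ (u n).1 x := fun n => by
        rw [WithLp.prod_inner_apply]; simp [e]
      simp only [this]
      exact hlim.inner tendsto_const_nhds
  have : toL2 (⟨e w, hwG⟩ : H10 Ω) = F := hwF
  rw [Represents, this]
  exact hfm.coeFn_toLp

end OCP

end

/-! ### Simplices and boxes under a common description. -/

noncomputable section

namespace OCP

variable {d : ℕ} {Ω : Set (E d)} {k : ElementKind}

/-- The element with vertex set `V`. -/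
abbrev cell (V : Finset (E d)) : Set (E d) := convexHull ℝ (V : Set (E d))

/-- `G` is the set of normalized facet functionals of the element `V`, and `N v` is the nodal basis
function of the vertex `v`. -/
structure IsShape (k : ElementKind) (V : Finset (E d)) (G : Finset (E d →ᵃ[ℝ] ℝ))
    (N : E d → E d → ℝ) : Prop where
  mem_iff : ∀ x, x ∈ cell V ↔ ∀ g ∈ G, 0 ≤ g x
  vertex : ∀ g ∈ G, ∀ v ∈ V, g v = 0 ∨ g v = 1
  facet_sep : ∀ g ∈ G, ∀ g' ∈ G, g ≠ g' → ∃ v ∈ V, g v = 0 ∧ g' v = 1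
  facet_nonempty : ∀ g ∈ G, ∃ v ∈ V, g v = 0
  exists_eq_one : ∀ g ∈ G, ∃ v ∈ V, g v = 1
  vertex_sep : ∀ u ∈ V, ∀ w ∈ V, u ≠ w → ∃ g ∈ G, g u = 0 ∧ g w = 1
  nodal_mem : ∀ v ∈ V, N v ∈ localPoly d k
  nodal_nonneg : ∀ v ∈ V, ∀ x ∈ cell V, 0 ≤ N v x
  interp : ∀ q ∈ localPoly d k, ∀ x, q x = ∑ v ∈ V, q v * N v x
  nodal_ne_zero : ∀ v ∈ V, ∀ x ∈ cell V, N v x ≠ 0 ↔ ∀ g ∈ G, g x = 0 → g v = 0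
  nodal_vertex : ∀ v ∈ V, ∀ w ∈ V, w ≠ v → N v w = 0
  nodal_near : ∀ w ∈ V, ∀ x ∈ cell V, ∀ ε ∈ Icc (0 : ℝ) 1, 1 - d * ε ≤ N w (w + ε • (x - w))
  nodal_lipschitz : ∀ ℓ : ℝ, (∀ g ∈ G, ∀ x y, |g x - g y| ≤ ℓ * ‖x - y‖) →
    ∀ v ∈ V, ∀ x ∈ cell V, ∀ y ∈ cell V, |N v x - N v y| ≤ d * ℓ * ‖x - y‖
  card_le : V.card ≤ 2 ^ d

/-! ### Polynomials -/

theorem localPoly_P1_le (d : ℕ) (k : ElementKind) : localPoly d .P1 ≤ localPoly d k := by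
  cases k
  · exact le_rfl
  · exact Submodule.span_mono fun f ⟨s, _, hf⟩ => ⟨s, hf⟩

theorem prod_mem_localPoly_P1 (s : Finset (Fin d)) (hs : s.card ≤ 1) :
    (fun x : E d => ∏ i ∈ s, x i) ∈ localPoly d .P1 := Submodule.subset_span ⟨s, hs, rfl⟩

theorem prod_mem_localPoly_Q1 (s : Finset (Fin d)) :
    (fun x : E d => ∏ i ∈ s, x i) ∈ localPoly d .Q1 := Submodule.subset_span ⟨s, rfl⟩

theorem const_mem_localPoly (k : ElementKind) (c : ℝ) : (fun _ : E d => c) ∈ localPoly d k := by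
  have h := (localPoly_P1_le d k) (prod_mem_localPoly_P1 ∅ (by simp))
  convert (localPoly d k).smul_mem c h using 1
  ext
  simp

theorem coord_mem_localPoly (k : ElementKind) (i : Fin d) :
    (fun x : E d => x i) ∈ localPoly d k := by
  have h := (localPoly_P1_le d k) (prod_mem_localPoly_P1 {i} (by simp))
  simpa using h

theorem affine_mem_localPoly (k : ElementKind) (g : E d →ᵃ[ℝ] ℝ) : ⇑g ∈ localPoly d k := by
  have h : ⇑g = (fun _ => g 0) + ∑ i, g.linear (EuclideanSpace.single i 1) • fun x : E d => x i := by
    ext x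
    have h1 : g x = g.linear x + g 0 := by
      have := g.map_vadd 0 x
      simpa using this
    have h2 : x = ∑ i, x i • EuclideanSpace.single i (1 : ℝ) := by
      ext j
      simp [Finset.sum_apply, Pi.single_apply]
    rw [h1]
    conv_lhs => rw [h2]
    simp [Finset.sum_apply, mul_comm, add_comm]
  rw [h]
  exact add_mem (const_mem_localPoly k _)
    (sum_mem fun i _ => Submodule.smul_mem _ _ (coord_mem_localPoly k i))

theorem localPoly_le_Q1 (d : ℕ) (k : ElementKind) : localPoly d k ≤ localPoly d .Q1 := by
  cases k
  · exact localPoly_P1_le d _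
  · exact le_rfl

theorem contDiff_of_mem_localPoly {q : E d → ℝ} (hq : q ∈ localPoly d k) : ContDiff ℝ ∞ q := by
  have hq' := localPoly_le_Q1 d k hq
  clear hq
  induction hq' using Submodule.span_induction with
  | mem x h =>
    obtain ⟨s, rfl⟩ := h
    exact contDiff_prod fun i _ => by fun_prop
  | zero => exact contDiff_const
  | add x y _ _ hx hy => exact hx.add hy
  | smul a x _ hx => exact hx.const_smul a

theorem sum_mul_eq_of_span {V : Finset (E d)} {N : E d → E d → ℝ} {S : Set (E d → ℝ)}
    (h : ∀ q ∈ S, ∀ x, q x = ∑ v ∈ V, q v * N v x) {q : E d → ℝ} (hq : q ∈ Submodule.span ℝ S)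
    (x : E d) : q x = ∑ v ∈ V, q v * N v x := by
  induction hq using Submodule.span_induction with
  | mem q hq => exact h q hq x
  | zero => simp
  | add p q _ _ hp hq => simp only [Pi.add_apply, add_mul, Finset.sum_add_distrib, ← hp, ← hq]
  | smul a q _ hq => simp only [Pi.smul_apply, smul_eq_mul, mul_assoc, ← Finset.mul_sum, ← hq]

/-! ### Simplices -/

-- The barycentric coordinates serve both as facet functionals and as nodal functions. That the
-- nodal functions are affine is recorded because the compatibility of neighbouring elements depends
-- on it.
open Classical in
theorem exists_isShape_P1 (hd : 1 ≤ d) {V : Finset (E d)} (hV : IsElement .P1 V) :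
    ∃ G N, IsShape .P1 V G N ∧ ∀ v ∈ V, ∃ g : E d →ᵃ[ℝ] ℝ, N v = g := by
  obtain ⟨hcard, hind⟩ := hV
  have htop : affineSpan ℝ (range fun p : V => (p : E d)) = ⊤ := by
    rw [hind.affineSpan_eq_top_iff_card_eq_finrank_add_one]
    simp [hcard]
  let b : AffineBasis V ℝ (E d) := ⟨fun p => p, hind, htop⟩
  have hbv : ∀ p : V, b p = p := fun _ => rfl
  have hrange : range b = (V : Set (E d)) := by
    have : ⇑b = (Subtype.val : V → E d) := rfl
    rw [this]; exact Subtype.range_coe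
  let N : E d → E d → ℝ := fun v x => if h : v ∈ V then b.coord ⟨v, h⟩ x else 0
  let G : Finset (E d →ᵃ[ℝ] ℝ) := Finset.univ.image b.coord
  have hN : ∀ p : V, N p = b.coord p := fun p => by ext x; simp [N]
  have hG : ∀ g, g ∈ G ↔ ∃ p : V, b.coord p = g := by simp [G]
  have hcoord : ∀ p q : V, b.coord p (q : E d) = if p = q then 1 else 0 := fun p q =>
    b.coord_apply p q
  have hmem : ∀ x, x ∈ cell V ↔ ∀ p : V, 0 ≤ b.coord p x := fun x => by
    rw [cell, ← hrange, b.convexHull_eq_nonneg_coord]; rfl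
  have hsum1 : ∀ x, ∑ v ∈ V, N v x = 1 := fun x => by
    rw [← Finset.sum_coe_sort, ← b.sum_coord_apply_eq_one x]
    exact Finset.sum_congr rfl fun p _ => by rw [hN]
  have hsumx : ∀ x, ∑ v ∈ V, N v x • v = x := fun x => by
    rw [← Finset.sum_coe_sort]
    conv_rhs => rw [← b.linear_combination_coord_eq_self x]
    exact Finset.sum_congr rfl fun p _ => by rw [hN]; rfl
  refine ⟨G, N, ⟨?_, ?_, ?_, ?_, ?_, ?_, ?_, ?_, ?_, ?_, ?_, ?_, ?_, ?_⟩, fun v hv => ⟨_, hN ⟨v, hv⟩⟩⟩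
  · intro x
    rw [hmem]
    refine ⟨fun h g hg => ?_, fun h p => h _ ((hG _).2 ⟨p, rfl⟩)⟩
    obtain ⟨p, rfl⟩ := (hG g).1 hg
    exact h p
  · rintro g hg v hv
    obtain ⟨p, rfl⟩ := (hG g).1 hg
    have := hcoord p ⟨v, hv⟩
    simp only at this
    rw [this]
    split_ifs <;> simp
  · rintro g hg g' hg' hne
    obtain ⟨p, rfl⟩ := (hG g).1 hg
    obtain ⟨q, rfl⟩ := (hG g').1 hg'
    refine ⟨q, q.2, ?_, ?_⟩
    · rw [hcoord, if_neg fun h => hne (by rw [h])]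
    · rw [hcoord, if_pos rfl]
  · rintro g hg
    obtain ⟨p, rfl⟩ := (hG g).1 hg
    -- As `d ≥ 1`, there is a second vertex, where the coordinate of `p` vanishes.
    obtain ⟨q, hq, hqp⟩ := Finset.exists_mem_ne (by omega : 1 < V.card) (p : E d)
    refine ⟨q, hq, ?_⟩
    have := hcoord p ⟨q, hq⟩
    simp only at this
    rw [this, if_neg fun h => hqp (by rw [h])]
  · rintro g hg
    obtain ⟨p, rfl⟩ := (hG g).1 hg
    exact ⟨p, p.2, by rw [hcoord, if_pos rfl]⟩
  · intro u hu w hw hne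
    refine ⟨b.coord ⟨w, hw⟩, (hG _).2 ⟨_, rfl⟩, ?_, ?_⟩
    · have := hcoord ⟨w, hw⟩ ⟨u, hu⟩
      simp only at this
      rw [this, if_neg fun h => hne (by simpa using h.symm)]
    · have := hcoord ⟨w, hw⟩ ⟨w, hw⟩
      simpa using this
  · intro v hv
    rw [hN ⟨v, hv⟩]
    exact affine_mem_localPoly _ _
  · intro v hv x hx
    rw [hN ⟨v, hv⟩]
    exact (hmem x).1 hx _
  · intro q hq x
    refine sum_mul_eq_of_span ?_ hq x
    rintro _ ⟨s, hs, rfl⟩ x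
    rcases Nat.le_one_iff_eq_zero_or_eq_one.1 hs with h | h
    · rw [Finset.card_eq_zero.1 h]
      simp [hsum1]
    · obtain ⟨i, rfl⟩ := Finset.card_eq_one.1 h
      simp only [Finset.prod_singleton]
      conv_lhs => rw [← hsumx x]
      simp [mul_comm]
  · intro v hv x hx
    rw [hN ⟨v, hv⟩]
    constructor
    · rintro h g hg hgx
      obtain ⟨p, rfl⟩ := (hG g).1 hg
      have := hcoord p ⟨v, hv⟩
      simp only at this
      rw [this, if_neg]
      rintro rfl
      exact h hgx
    · intro h h0
      have h1 := h _ ((hG _).2 ⟨_, rfl⟩) h0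
      have := hcoord ⟨v, hv⟩ ⟨v, hv⟩
      simp only [if_true] at this
      rw [h1] at this
      exact zero_ne_one this
  · intro v hv w hw hne
    rw [hN ⟨v, hv⟩]
    have := hcoord ⟨v, hv⟩ ⟨w, hw⟩
    simp only at this
    rw [this, if_neg fun h => hne (by simpa using h.symm)]
  · intro w hw x hx ε hε
    rw [hN ⟨w, hw⟩, affine_segment]
    have h1 := hcoord ⟨w, hw⟩ ⟨w, hw⟩
    simp only [if_true] at h1
    rw [h1]
    have h2 := (hmem x).1 hx ⟨w, hw⟩
    have h3 : (1 : ℝ) ≤ d := by exact_mod_cast hd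
    nlinarith [hε.1, mul_nonneg hε.1 h2]
  · intro ℓ hℓ v hv x hx y hy
    rw [hN ⟨v, hv⟩]
    have h1 := hℓ _ ((hG _).2 ⟨⟨v, hv⟩, rfl⟩) x y
    refine h1.trans ?_
    have h3 : (1 : ℝ) ≤ d := by exact_mod_cast hd
    nlinarith [(abs_nonneg _).trans h1]
  · rw [hcard]
    exact Nat.lt_two_pow_self

/-! ### Boxes -/

/-- The two affine functionals of a box in direction `i`; the index `true` belongs to the one that
is one at the upper end. -/
def boxHat (a b : E d) (i : Fin d) (β : Bool) : E d →ᵃ[ℝ] ℝ :=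
  let m : ℝ := (b i - a i)⁻¹
  let π : E d →ᵃ[ℝ] ℝ := (EuclideanSpace.proj (𝕜 := ℝ) i : E d →L[ℝ] ℝ).toLinearMap.toAffineMap
  if β then m • (π - AffineMap.const ℝ _ (a i)) else m • (AffineMap.const ℝ _ (b i) - π)

theorem boxHat_true (a b : E d) (i : Fin d) (x : E d) :
    boxHat a b i true x = (b i - a i)⁻¹ * (x i - a i) := by
  simp [boxHat]

theorem boxHat_false (a b : E d) (i : Fin d) (x : E d) :
    boxHat a b i false x = (b i - a i)⁻¹ * (b i - x i) := by
  simp [boxHat]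

/-- The vertices of a box, indexed by the choices of an end in each direction. -/
def boxVertex (a b : E d) (c : Fin d → Bool) : E d :=
  WithLp.toLp 2 fun i => if c i then b i else a i

theorem boxVertex_apply (a b : E d) (c : Fin d → Bool) (i : Fin d) :
    boxVertex a b c i = if c i then b i else a i := rfl

open Classical in
/-- The nodal basis functions of a box. -/
def boxNodal (a b : E d) (v x : E d) : ℝ := ∏ i, boxHat a b i (decide (v i = b i)) x

/-- Replace the factors one at a time. Applied to the `d` hat functions of a box, it produces the
factor `d` in `nodal_lipschitz`. -/
theorem abs_prod_sub_prod_le {ι : Type*} (s : Finset ι) (f g : ι → ℝ)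
    (hf : ∀ i ∈ s, f i ∈ Icc (0 : ℝ) 1) (hg : ∀ i ∈ s, g i ∈ Icc (0 : ℝ) 1) :
    |∏ i ∈ s, f i - ∏ i ∈ s, g i| ≤ ∑ i ∈ s, |f i - g i| := by
  classical
  induction s using Finset.induction_on with
  | empty => simp
  | insert i s hi ih =>
    rw [Finset.prod_insert hi, Finset.prod_insert hi, Finset.sum_insert hi]
    have h1 := ih (fun j hj => hf j (Finset.mem_insert_of_mem hj))
      (fun j hj => hg j (Finset.mem_insert_of_mem hj))
    have hF0 : 0 ≤ ∏ j ∈ s, f j :=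
      Finset.prod_nonneg fun j hj => (hf j (Finset.mem_insert_of_mem hj)).1
    have hF1 : ∏ j ∈ s, f j ≤ 1 :=
      Finset.prod_le_one (fun j hj => (hf j (Finset.mem_insert_of_mem hj)).1)
        fun j hj => (hf j (Finset.mem_insert_of_mem hj)).2
    have hgi := hg i (Finset.mem_insert_self i s)
    calc |f i * ∏ j ∈ s, f j - g i * ∏ j ∈ s, g j|
        = |(f i - g i) * ∏ j ∈ s, f j + g i * (∏ j ∈ s, f j - ∏ j ∈ s, g j)| := by
          congr 1; ring
      _ ≤ |f i - g i| * ∏ j ∈ s, f j + g i * |∏ j ∈ s, f j - ∏ j ∈ s, g j| := by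
          refine (abs_add_le _ _).trans ?_
          rw [abs_mul, abs_mul, abs_of_nonneg hF0, abs_of_nonneg hgi.1]
      _ ≤ |f i - g i| * 1 + 1 * |∏ j ∈ s, f j - ∏ j ∈ s, g j| := by
          gcongr
          exact hgi.2
      _ ≤ _ := by linarith

theorem boxHat_not_add (a b : E d) (hab : ∀ i, a i < b i) (i : Fin d) (β : Bool) (x : E d) :
    boxHat a b i (!β) x = 1 - boxHat a b i β x := by
  have := (sub_pos.2 (hab i)).ne'
  cases β <;> simp only [Bool.not_false, Bool.not_true, boxHat_true, boxHat_false] <;>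
    field_simp <;> ring

theorem boxHat_boxVertex (a b : E d) (hab : ∀ i, a i < b i) (i : Fin d) (β : Bool)
    (c : Fin d → Bool) : boxHat a b i β (boxVertex a b c) = if c i = β then 1 else 0 := by
  have := (sub_pos.2 (hab i)).ne'
  cases β <;> cases h : c i <;> simp [boxHat_true, boxHat_false, boxVertex_apply, h, this]

theorem boxNodal_boxVertex (a b : E d) (hab : ∀ i, a i < b i) (c : Fin d → Bool) (x : E d) :
    boxNodal a b (boxVertex a b c) x = ∏ i, boxHat a b i (c i) x := by
  unfold boxNodal
  refine Finset.prod_congr rfl fun i _ => ?_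
  have := (hab i).ne
  cases h : c i <;> simp [boxVertex_apply, h, this]

theorem boxVertex_injective (a b : E d) (hab : ∀ i, a i < b i) :
    Function.Injective (boxVertex a b) := fun c c' h => by
  ext i
  have h1 := boxHat_boxVertex a b hab i true c
  rw [h, boxHat_boxVertex a b hab] at h1
  cases hc : c i <;> cases hc' : c' i <;> simp_all

/-- Summands and nodal functions are products over the directions, so the sum over the corners
factors into one-dimensional interpolation identities. -/
theorem sum_boxVertex_mul_boxNodal (a b : E d) (hab : ∀ i, a i < b i) (s : Finset (Fin d))
    (x : E d) : ∑ c : Fin d → Bool, (∏ i ∈ s, boxVertex a b c i) *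
      boxNodal a b (boxVertex a b c) x = ∏ i ∈ s, x i := by
  classical
  have h1 : ∀ c : Fin d → Bool, (∏ i ∈ s, boxVertex a b c i) * boxNodal a b (boxVertex a b c) x =
      ∏ i, (if i ∈ s then (if c i then b i else a i) else 1) * boxHat a b i (c i) x := fun c => by
    rw [boxNodal_boxVertex a b hab, Finset.prod_mul_distrib, Finset.prod_ite_mem,
      Finset.univ_inter]
    rfl
  simp only [h1]
  have h2 := Finset.prod_univ_sum (fun _ : Fin d => (Finset.univ : Finset Bool)) fun i β =>
    (if i ∈ s then (if β then b i else a i) else 1) * boxHat a b i β x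
  rw [Fintype.piFinset_univ] at h2
  rw [← h2, ← Finset.univ_inter s, ← Finset.prod_ite_mem]
  refine Finset.prod_congr rfl fun i _ => ?_
  have := (sub_pos.2 (hab i)).ne'
  simp only [Fintype.sum_bool, boxHat_true, boxHat_false, Finset.univ_inter, if_true,
    Bool.false_eq_true, if_false]
  split_ifs <;> field_simp <;> ring

theorem affine_prod_mem_localPoly_Q1 (g : Fin d → E d → ℝ)
    (hg : ∀ i, ∃ m c : ℝ, ∀ x, g i x = m * x i + c) :
    (fun x : E d => ∏ i, g i x) ∈ localPoly d .Q1 := by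
  classical
  choose m c h using hg
  have : (fun x : E d => ∏ i, g i x) = ∑ t : Finset (Fin d),
      ((∏ i ∈ t, m i) * ∏ i ∈ Finset.univ \ t, c i) • fun x : E d => ∏ i ∈ t, x i := by
    ext x
    simp only [h, Finset.prod_add, Finset.powerset_univ, Finset.sum_apply, Pi.smul_apply,
      smul_eq_mul, Finset.prod_mul_distrib]
    exact Finset.sum_congr rfl fun t _ => by ring
  rw [this]
  exact sum_mem fun t _ => Submodule.smul_mem _ _ (prod_mem_localPoly_Q1 t)

-- Corners are the maps `Fin d → Bool` and facets the pairs `(i, β)`; by `boxHat_boxVertex` the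
-- combinatorial claims become comparisons of Booleans.
open Classical in
theorem isShape_box {V : Finset (E d)} {a b : E d} (hab : ∀ i, a i < b i)
    (hV : (V : Set (E d)) = {x | ∀ i, x i = a i ∨ x i = b i}) :
    IsShape .Q1 V (Finset.univ.image fun p : Fin d × Bool => boxHat a b p.1 p.2)
      (boxNodal a b) := by
  have hVc : V = Finset.univ.image (boxVertex a b) := by
    ext x
    rw [← Finset.mem_coe, hV, Finset.mem_image]
    constructor
    · intro h
      refine ⟨fun i => decide (x i = b i), Finset.mem_univ _, ?_⟩
      ext i
      rw [boxVertex_apply]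
      rcases h i with h | h
      · simp [h, (hab i).ne]
      · simp [h]
    · rintro ⟨c, -, rfl⟩ i
      rw [boxVertex_apply]
      split_ifs <;> simp
  have hmemV : ∀ v, v ∈ V ↔ ∃ c, boxVertex a b c = v := by simp [hVc]
  have hG : ∀ g, g ∈ Finset.univ.image (fun p : Fin d × Bool => boxHat a b p.1 p.2) ↔
      ∃ i β, boxHat a b i β = g := by simp
  have hsum : ∀ F : E d → ℝ, ∑ v ∈ V, F v = ∑ c, F (boxVertex a b c) := fun F => by
    rw [hVc, Finset.sum_image fun c _ c' _ h => boxVertex_injective a b hab h]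
  have hinterp : ∀ (s : Finset (Fin d)) (x : E d),
      ∏ i ∈ s, x i = ∑ v ∈ V, (∏ i ∈ s, v i) * boxNodal a b v x := fun s x => by
    rw [hsum]; exact (sum_boxVertex_mul_boxNodal a b hab s x).symm
  have hnonneg : ∀ v ∈ V, ∀ x, (∀ i β, 0 ≤ boxHat a b i β x) → 0 ≤ boxNodal a b v x :=
    fun v _ x hx => Finset.prod_nonneg fun i _ => hx i _
  have hmem : ∀ x, x ∈ cell V ↔ ∀ i β, 0 ≤ boxHat a b i β x := by
    intro x
    constructor
    · intro hx i β
      have hc : Convex ℝ {x | 0 ≤ boxHat a b i β x} :=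
        (convex_Ici (0 : ℝ)).affine_preimage (boxHat a b i β)
      refine convexHull_min ?_ hc hx
      intro v hv
      obtain ⟨c, rfl⟩ := (hmemV v).1 hv
      simp only [mem_ofPred_eq, boxHat_boxVertex a b hab]
      split_ifs <;> norm_num
    · intro hx
      have h1 : ∑ v ∈ V, boxNodal a b v x = 1 := by simpa using (hinterp ∅ x).symm
      have h2 : ∑ v ∈ V, boxNodal a b v x • v = x := by
        ext i
        have := hinterp {i} x
        simp only [Finset.prod_singleton] at this
        simp [this, mul_comm]
      rw [← h2]
      exact (convex_convexHull ℝ _).sum_mem (fun v hv => hnonneg v hv x hx) h1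
        fun v hv => subset_convexHull ℝ _ hv
  have hle1 : ∀ x ∈ cell V, ∀ i β, boxHat a b i β x ∈ Icc (0 : ℝ) 1 := fun x hx i β => by
    have h1 := (hmem x).1 hx i β
    have h2 := (hmem x).1 hx i (!β)
    rw [boxHat_not_add a b hab] at h2
    exact ⟨h1, by linarith⟩
  refine ⟨?_, ?_, ?_, ?_, ?_, ?_, ?_, ?_, ?_, ?_, ?_, ?_, ?_, ?_⟩
  · intro x
    rw [hmem]
    refine ⟨fun h g hg => ?_, fun h i β => h _ ((hG _).2 ⟨i, β, rfl⟩)⟩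
    obtain ⟨i, β, rfl⟩ := (hG g).1 hg
    exact h i β
  · rintro g hg v hv
    obtain ⟨i, β, rfl⟩ := (hG g).1 hg
    obtain ⟨c, rfl⟩ := (hmemV v).1 hv
    rw [boxHat_boxVertex a b hab]
    split_ifs <;> simp
  · rintro g hg g' hg' hne
    obtain ⟨i, β, rfl⟩ := (hG g).1 hg
    obtain ⟨j, γ, rfl⟩ := (hG g').1 hg'
    -- The corner must have `γ` in direction `j` and not `β` in direction `i`. If `i = j`, these
    -- agree, since different functionals in one direction have `γ ≠ β`.
    refine ⟨_, (hmemV _).2 ⟨fun t => if t = j then γ else !β, rfl⟩, ?_, ?_⟩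
    · rw [boxHat_boxVertex a b hab, if_neg]
      by_cases hij : i = j
      · subst hij
        simp only [if_true]
        rintro rfl
        exact hne rfl
      · simp [hij]
    · rw [boxHat_boxVertex a b hab, if_pos (by simp)]
  · rintro g hg
    obtain ⟨i, β, rfl⟩ := (hG g).1 hg
    refine ⟨_, (hmemV _).2 ⟨fun _ => !β, rfl⟩, ?_⟩
    rw [boxHat_boxVertex a b hab, if_neg (by simp)]
  · rintro g hg
    obtain ⟨i, β, rfl⟩ := (hG g).1 hg
    refine ⟨_, (hmemV _).2 ⟨fun _ => β, rfl⟩, ?_⟩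
    rw [boxHat_boxVertex a b hab, if_pos rfl]
  · intro u hu w hw hne
    obtain ⟨c, rfl⟩ := (hmemV u).1 hu
    obtain ⟨c', rfl⟩ := (hmemV w).1 hw
    have : c ≠ c' := fun h => hne (by rw [h])
    obtain ⟨i, hi⟩ := Function.ne_iff.1 this
    refine ⟨_, (hG _).2 ⟨i, c' i, rfl⟩, ?_, ?_⟩
    · rw [boxHat_boxVertex a b hab, if_neg hi]
    · rw [boxHat_boxVertex a b hab, if_pos rfl]
  · intro v hv
    refine affine_prod_mem_localPoly_Q1 (fun i => boxHat a b i (decide (v i = b i))) fun i => ?_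
    cases decide (v i = b i)
    · exact ⟨-(b i - a i)⁻¹, (b i - a i)⁻¹ * b i, fun x => by rw [boxHat_false]; ring⟩
    · exact ⟨(b i - a i)⁻¹, -(b i - a i)⁻¹ * a i, fun x => by rw [boxHat_true]; ring⟩
  · intro v hv x hx
    exact hnonneg v hv x ((hmem x).1 hx)
  · intro q hq x
    refine sum_mul_eq_of_span ?_ hq x
    rintro _ ⟨s, rfl⟩ x
    exact hinterp s x
  · intro v hv x hx
    obtain ⟨c, rfl⟩ := (hmemV v).1 hv
    rw [boxNodal_boxVertex a b hab, Finset.prod_ne_zero_iff]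
    constructor
    · rintro h g hg hgx
      obtain ⟨i, β, rfl⟩ := (hG g).1 hg
      rw [boxHat_boxVertex a b hab, if_neg]
      rintro rfl
      exact h i (Finset.mem_univ i) hgx
    · intro h i _ h0
      have := h _ ((hG _).2 ⟨i, c i, rfl⟩) h0
      rw [boxHat_boxVertex a b hab, if_pos rfl] at this
      exact one_ne_zero this
  · intro v hv w hw hne
    obtain ⟨c, rfl⟩ := (hmemV v).1 hv
    obtain ⟨c', rfl⟩ := (hmemV w).1 hw
    have : c' ≠ c := fun h => hne (by rw [h])
    obtain ⟨i, hi⟩ := Function.ne_iff.1 this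
    rw [boxNodal_boxVertex a b hab]
    refine Finset.prod_eq_zero (Finset.mem_univ i) ?_
    rw [boxHat_boxVertex a b hab, if_neg hi]
  · intro w hw x hx ε hε
    obtain ⟨c, rfl⟩ := (hmemV w).1 hw
    rw [boxNodal_boxVertex a b hab]
    -- Each of the `d` hat factors is at least `1 - ε` there; Bernoulli's inequality bounds their
    -- product.
    calc 1 - (d : ℝ) * ε = 1 + (d : ℝ) * (-ε) := by ring
      _ ≤ (1 + -ε) ^ d := one_add_mul_le_pow (by linarith [hε.2]) d
      _ = ∏ i : Fin d, (1 + -ε) := by simp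
      _ ≤ _ := by
          refine Finset.prod_le_prod (fun i _ => by linarith [hε.2]) fun i _ => ?_
          rw [affine_segment, boxHat_boxVertex a b hab, if_pos rfl]
          have := mul_nonneg hε.1 ((hmem x).1 hx i (c i))
          linarith
  · intro ℓ hℓ v hv x hx y hy
    refine (abs_prod_sub_prod_le _ _ _ (fun i _ => hle1 x hx i _) fun i _ => hle1 y hy i _).trans ?_
    calc _ ≤ ∑ i : Fin d, ℓ * ‖x - y‖ :=
          Finset.sum_le_sum fun i _ => hℓ _ ((hG _).2 ⟨i, _, rfl⟩) x y
      _ = _ := by simp [mul_assoc]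
  · rw [hVc]
    refine Finset.card_image_le.trans ?_
    simp

/-! ### Compatibility of the elements of a triangulation -/

/-- Shapes for all elements of a triangulation such that the nodal functions match on common
points. -/
structure IsMesh (k : ElementKind) (T : Finset (Finset (E d)))
    (G : Finset (E d) → Finset (E d →ᵃ[ℝ] ℝ)) (N : Finset (E d) → E d → E d → ℝ) : Prop where
  shape : ∀ V ∈ T, IsShape k V (G V) (N V)
  mem_of_ne_zero : ∀ V ∈ T, ∀ V' ∈ T, ∀ x ∈ cell V, x ∈ cell V' → ∀ v ∈ V, N V v x ≠ 0 → v ∈ V'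
  agree : ∀ V ∈ T, ∀ V' ∈ T, ∀ x ∈ cell V, x ∈ cell V' → ∀ v ∈ V, v ∈ V' → N V v x = N V' v x

theorem affine_eqOn_convexHull {S : Set (E d)} (f g : E d →ᵃ[ℝ] ℝ) (h : EqOn f g S) :
    EqOn f g (convexHull ℝ S) := by
  have hc : Convex ℝ {x | f x = g x} := by
    have : {x | f x = g x} = (f - g) ⁻¹' {0} := by
      ext x; simp [sub_eq_zero]
    rw [this]
    exact (convex_singleton (0 : ℝ)).affine_preimage (f - g)
  exact fun x hx => convexHull_min (fun y hy => h hy) hc hx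

/-- By conformity a common point lies in the hull of the common vertices, where affine nodal
functions are determined by their values at those vertices. -/
theorem IsTriangulation.exists_isMesh_P1 (hd : 1 ≤ d) {T : Finset (Finset (E d))}
    (h : IsTriangulation .P1 Ω T) : ∃ G N, IsMesh .P1 T G N := by
  classical
  have hex : ∀ V : Finset (E d), ∃ G N, V ∈ T → IsShape .P1 V G N ∧
      ∀ v ∈ V, ∃ g : E d →ᵃ[ℝ] ℝ, N v = g := fun V => by
    by_cases hV : V ∈ T
    · obtain ⟨G, N, h1⟩ := exists_isShape_P1 hd (h.isElement V hV)
      exact ⟨G, N, fun _ => h1⟩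
    · exact ⟨∅, 0, fun h => absurd h hV⟩
  choose G N hGN using hex
  have hN1 : ∀ V ∈ T, ∀ v ∈ V, ∀ w ∈ V, N V v w = if w = v then 1 else 0 := by
    intro V hV v hv w hw
    split_ifs with hvw
    · subst hvw
      have h1 := (hGN V hV).1.interp _ (const_mem_localPoly _ 1) w
      simp only [one_mul] at h1
      rw [Finset.sum_eq_single w (fun u hu hne => (hGN V hV).1.nodal_vertex u hu w hw hne.symm)
        fun h => absurd hw h] at h1
      exact h1.symm
    · exact (hGN V hV).1.nodal_vertex v hv w hw hvw
  refine ⟨G, N, fun V hV => (hGN V hV).1, ?_, ?_⟩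
  · intro V hV V' hV' x hx hx' v hv hne
    by_contra hv'
    have hxc : x ∈ convexHull ℝ ((V : Set (E d)) ∩ (V' : Set (E d))) := by
      rw [← h.conforming V hV V' hV']; exact ⟨hx, hx'⟩
    obtain ⟨g, hg⟩ := (hGN V hV).2 v hv
    rw [hg] at hne
    refine hne (affine_eqOn_convexHull g 0 (fun u hu => ?_) hxc)
    rw [← hg, hN1 V hV v hv u hu.1, if_neg]
    · rfl
    · rintro rfl; exact hv' hu.2
  · intro V hV V' hV' x hx hx' v hv hv'
    have hxc : x ∈ convexHull ℝ ((V : Set (E d)) ∩ (V' : Set (E d))) := by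
      rw [← h.conforming V hV V' hV']; exact ⟨hx, hx'⟩
    obtain ⟨g, hg⟩ := (hGN V hV).2 v hv
    obtain ⟨g', hg'⟩ := (hGN V' hV').2 v hv'
    rw [hg, hg']
    refine affine_eqOn_convexHull g g' (fun u hu => ?_) hxc
    rw [← hg, ← hg', hN1 V hV v hv u hu.1, hN1 V' hV' v hv' u hu.2]

open Classical in
theorem IsTriangulation.exists_isMesh_Q1 {T : Finset (Finset (E d))}
    (h : IsTriangulation .Q1 Ω T) : ∃ G N, IsMesh .Q1 T G N := by
  have hex : ∀ V : Finset (E d), ∃ a b : E d, V ∈ T → (∀ i, a i < b i) ∧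
      (V : Set (E d)) = {x | ∀ i, x i = a i ∨ x i = b i} := fun V => by
    by_cases hV : V ∈ T
    · obtain ⟨a, b, h1⟩ := h.isElement V hV
      exact ⟨a, b, fun _ => h1⟩
    · exact ⟨0, 0, fun h => absurd h hV⟩
  choose a b hab using hex
  have hmemV : ∀ V ∈ T, ∀ v, v ∈ V ↔ ∀ i, v i = a V i ∨ v i = b V i := fun V hV v => by
    rw [← Finset.mem_coe, (hab V hV).2]; rfl
  -- Nodal functions of boxes are not affine, so the comparison goes direction by direction. Two
  -- common vertices that differ in direction `i` force equal intervals there. Otherwise all common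
  -- vertices have the same `i`-th coordinate, and `x`, being in their hull, has it too.
  have hdir : ∀ V ∈ T, ∀ V' ∈ T, ∀ x ∈ cell V, x ∈ cell V' → ∀ i,
      (a V i = a V' i ∧ b V i = b V' i) ∨
        ∃ u ∈ V, u ∈ V' ∧ x i = u i ∧ ∀ w ∈ V, w ∈ V' → w i = u i := by
    intro V hV V' hV' x hx hx' i
    have hxc : x ∈ convexHull ℝ ((V : Set (E d)) ∩ (V' : Set (E d))) := by
      rw [← h.conforming V hV V' hV']; exact ⟨hx, hx'⟩
    obtain ⟨u, hu⟩ := convexHull_nonempty_iff.1 ⟨x, hxc⟩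
    by_cases hall : ∀ w ∈ V, w ∈ V' → w i = u i
    · refine Or.inr ⟨u, hu.1, hu.2, ?_, hall⟩
      have := affine_eqOn_convexHull (EuclideanSpace.proj (𝕜 := ℝ) i :
        E d →L[ℝ] ℝ).toLinearMap.toAffineMap (AffineMap.const ℝ _ (u i))
        (fun w hw => hall w hw.1 hw.2) hxc
      exact this
    · push Not at hall
      obtain ⟨w, hw, hw', hne⟩ := hall
      left
      have h1 := (hmemV V hV u).1 hu.1 i
      have h2 := (hmemV V' hV' u).1 hu.2 i
      have h3 := (hmemV V hV w).1 hw i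
      have h4 := (hmemV V' hV' w).1 hw' i
      have h5 := (hab V hV).1 i
      have h6 := (hab V' hV').1 i
      rcases h1 with h1 | h1 <;> rcases h2 with h2 | h2 <;> rcases h3 with h3 | h3 <;>
        rcases h4 with h4 | h4 <;> constructor <;> 
        first | linarith | exact absurd (by linarith) hne
  refine ⟨_, fun V => boxNodal (a V) (b V), fun V hV => isShape_box (hab V hV).1 (hab V hV).2,
    ?_, ?_⟩
  · intro V hV V' hV' x hx hx' v hv hne
    rw [hmemV V' hV']
    intro i
    rcases hdir V hV V' hV' x hx hx' i with ⟨e1, e2⟩ | ⟨u, hu, hu', hxu, -⟩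
    · rw [← e1, ← e2]
      exact (hmemV V hV v).1 hv i
    · have hvu : v i = u i := by
        have h1 := Finset.prod_ne_zero_iff.1 hne i (Finset.mem_univ i)
        by_contra hvu
        apply h1
        have hlt := (hab V hV).1 i
        rcases (hmemV V hV v).1 hv i with h2 | h2 <;> rcases (hmemV V hV u).1 hu i with h3 | h3
        · exact absurd (h2.trans h3.symm) hvu
        · rw [h2, decide_eq_false hlt.ne, boxHat_false, hxu, h3, sub_self, mul_zero]
        · rw [h2, decide_eq_true rfl, boxHat_true, hxu, h3, sub_self, mul_zero]
        · exact absurd (h2.trans h3.symm) hvu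
      rw [hvu]
      exact (hmemV V' hV' u).1 hu' i
  · intro V hV V' hV' x hx hx' v hv hv'
    refine Finset.prod_congr rfl fun i _ => ?_
    rcases hdir V hV V' hV' x hx hx' i with ⟨e1, e2⟩ | ⟨u, hu, hu', hxu, hall⟩
    · rw [e2]
      cases decide (v i = b V' i)
      · rw [boxHat_false, boxHat_false, e1, e2]
      · rw [boxHat_true, boxHat_true, e1, e2]
    · have hvu : x i = v i := hxu.trans (hall v hv hv').symm
      have key : ∀ W ∈ T, v ∈ W → boxHat (a W) (b W) i (decide (v i = b W i)) x = 1 := by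
        intro W hW hvW
        have hlt := (hab W hW).1 i
        have hne := (sub_pos.2 hlt).ne'
        rcases (hmemV W hW v).1 hvW i with h2 | h2
        · rw [h2, decide_eq_false hlt.ne, boxHat_false, hvu, h2, inv_mul_cancel₀ hne]
        · rw [h2, decide_eq_true rfl, boxHat_true, hvu, h2, inv_mul_cancel₀ hne]
      rw [key V hV hv, key V' hV' hv']

theorem IsTriangulation.exists_isMesh (hd : 1 ≤ d) {T : Finset (Finset (E d))}
    (h : IsTriangulation k Ω T) : ∃ G N, IsMesh k T G N := by
  cases k
  · exact h.exists_isMesh_P1 hd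
  · exact h.exists_isMesh_Q1

end OCP

end

/-! ### Faces, the interior of the domain, and finite element functions. -/

noncomputable section

namespace OCP

open Filter Topology

variable {d : ℕ} {Ω : Set (E d)} {k : ElementKind} {T : Finset (Finset (E d))}
  {G : Finset (E d) → Finset (E d →ᵃ[ℝ] ℝ)} {N : Finset (E d) → E d → E d → ℝ}

theorem isCompact_cell (V : Finset (E d)) : IsCompact (cell V) :=
  V.finite_toSet.isCompact_convexHull ℝ

theorem isClosed_cell (V : Finset (E d)) : IsClosed (cell V) := (isCompact_cell V).isClosed

theorem mem_cell_of_mem {V : Finset (E d)} {v : E d} (hv : v ∈ V) : v ∈ cell V :=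
  subset_convexHull ℝ _ hv

theorem continuous_affine (g : E d →ᵃ[ℝ] ℝ) : Continuous g := g.continuous_of_finiteDimensional

theorem affine_eq_zero_of_convexHull {S : Set (E d)} (g : E d →ᵃ[ℝ] ℝ) (h : ∀ v ∈ S, g v = 0)
    {x : E d} (hx : x ∈ convexHull ℝ S) : g x = 0 :=
  affine_eqOn_convexHull g 0 (fun v hv => h v hv) hx

namespace IsShape

variable {V : Finset (E d)} {H : Finset (E d →ᵃ[ℝ] ℝ)} {M : E d → E d → ℝ}

theorem sum_nodal (S : IsShape k V H M) (x : E d) : ∑ v ∈ V, M v x = 1 := by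
  simpa using (S.interp _ (const_mem_localPoly k 1) x).symm

theorem sum_nodal_smul (S : IsShape k V H M) (x : E d) : ∑ v ∈ V, M v x • v = x := by
  ext i
  have := S.interp _ (coord_mem_localPoly k i) x
  simp [this, mul_comm]

theorem nodal_self (S : IsShape k V H M) {v : E d} (hv : v ∈ V) : M v v = 1 := by
  rw [← S.sum_nodal v, Finset.sum_eq_single v
    (fun u hu hne => S.nodal_vertex u hu v hv hne.symm) fun h => absurd hv h]

/-- The nodal functions at `x` are convex weights with centre `x`. The vertices with nonzero weight
span the smallest face containing `x`, so facts about vertices carry over to `x`. -/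
theorem mem_convexHull_support (S : IsShape k V H M) {x : E d} (hx : x ∈ cell V) :
    x ∈ convexHull ℝ {v | v ∈ V ∧ M v x ≠ 0} := by
  classical
  have h1 := S.sum_nodal x
  have h2 := S.sum_nodal_smul x
  rw [← Finset.sum_filter_of_ne (p := fun v => M v x ≠ 0) fun v _ h => h] at h1
  rw [← Finset.sum_filter_of_ne (p := fun v => M v x ≠ 0)
    fun v _ h h' => h (by rw [h', zero_smul])] at h2
  have h3 := (convex_convexHull ℝ {v | v ∈ V ∧ M v x ≠ 0}).sum_mem (z := fun v => v)
    (fun v hv => S.nodal_nonneg v (Finset.mem_filter.1 hv).1 x hx) h1 fun v hv =>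
      subset_convexHull ℝ _ (Finset.mem_filter.1 hv)
  rwa [h2] at h3

theorem facet_nonneg (S : IsShape k V H M) {g} (hg : g ∈ H) {x : E d} (hx : x ∈ cell V) :
    0 ≤ g x := (S.mem_iff x).1 hx g hg

theorem facet_le_one (S : IsShape k V H M) {g} (hg : g ∈ H) {x : E d} (hx : x ∈ cell V) :
    g x ≤ 1 := by
  have hc : Convex ℝ {x | g x ≤ 1} := (convex_Iic (1 : ℝ)).affine_preimage g
  refine convexHull_min (fun v hv => ?_) hc hx
  rcases S.vertex g hg v hv with h | h <;> simp [h]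

theorem mem_interior_iff (S : IsShape k V H M) {x : E d} :
    x ∈ interior (cell V) ↔ ∀ g ∈ H, 0 < g x := by
  constructor
  · intro hx g hg
    refine lt_of_le_of_ne (S.facet_nonneg hg (interior_subset hx)) fun h0 => ?_
    obtain ⟨v, hv, hgv⟩ := S.exists_eq_one g hg
    have ht : Tendsto (fun t : ℝ => x + t • (v - x)) (𝓝 0) (𝓝 x) := by
      have : Continuous fun t : ℝ => x + t • (v - x) := by fun_prop
      simpa using this.tendsto 0
    -- If `g x = 0`, a small step from `x` away from a vertex with `g = 1` makes `g` negative,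
    -- although an interior point allows that step.
    have h1 : ∀ᶠ t : ℝ in 𝓝[<] 0, x + t • (v - x) ∈ cell V :=
      (ht.eventually (mem_interior_iff_mem_nhds.1 hx)).filter_mono nhdsWithin_le_nhds
    obtain ⟨t, ht1, ht2⟩ := (h1.and self_mem_nhdsWithin).exists
    have h2 := S.facet_nonneg hg ht1
    rw [affine_segment, ← h0, hgv] at h2
    have : t < 0 := ht2
    linarith
  · intro h
    rw [mem_interior_iff_mem_nhds]
    have : ∀ᶠ y in 𝓝 x, ∀ g ∈ H, 0 < g y := (Finset.eventually_all H).2 fun g hg =>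
      (continuous_affine g).continuousAt.eventually (lt_mem_nhds (h g hg))
    filter_upwards [this] with y hy
    exact (S.mem_iff y).2 fun g hg => (hy g hg).le

theorem interior_nonempty (S : IsShape k V H M) (hV : V.Nonempty) :
    (interior (cell V)).Nonempty := by
  refine ⟨V.centroid ℝ id, S.mem_interior_iff.2 fun g hg => ?_⟩
  have hn : (V.card : ℝ) ≠ 0 := by simpa using hV.ne_empty
  rw [Finset.centroid_def, Finset.map_affineCombination _ _ _
    (V.sum_centroidWeights_eq_one_of_nonempty ℝ hV), Finset.affineCombination_eq_linear_combination
    _ _ _ (V.sum_centroidWeights_eq_one_of_nonempty ℝ hV)]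
  obtain ⟨v, hv, hgv⟩ := S.exists_eq_one g hg
  refine Finset.sum_pos' (fun w hw => ?_) ⟨v, hv, ?_⟩
  · have := S.facet_nonneg hg (mem_cell_of_mem hw)
    simp only [Finset.centroidWeights_apply, Function.comp, id, smul_eq_mul]
    positivity
  · have : 0 < V.card := hV.card_pos
    simp only [Finset.centroidWeights_apply, Function.comp, id, smul_eq_mul, hgv, mul_one]
    positivity

end IsShape

theorem nonempty_of_isElement {V : Finset (E d)} (h : IsElement k V) : V.Nonempty := by
  cases k
  · exact Finset.card_pos.1 (by rw [h.1]; omega)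
  · obtain ⟨a, b, -, hV⟩ := h
    refine ⟨a, ?_⟩
    rw [← Finset.mem_coe, hV]
    exact fun i => Or.inl rfl

/-- No nodal function of `V` vanishes at an interior point, so all vertices of `V` belong to `V'`.
Then `x` is interior to `V'` as well and the argument can be reversed. -/
theorem IsMesh.eq_of_mem_interior (hM : IsMesh k T G N) {V V' : Finset (E d)} (hV : V ∈ T)
    (hV' : V' ∈ T) {x : E d} (hx : x ∈ interior (cell V)) (hx' : x ∈ cell V') : V = V' := by
  have key : ∀ W ∈ T, ∀ W' ∈ T, x ∈ interior (cell W) → x ∈ cell W' → W ⊆ W' := by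
    intro W hW W' hW' h h' v hv
    refine hM.mem_of_ne_zero W hW W' hW' x (interior_subset h) h' v hv ?_
    exact ((hM.shape W hW).nodal_ne_zero v hv x (interior_subset h)).2 fun g hg h0 =>
      absurd h0 ((hM.shape W hW).mem_interior_iff.1 h g hg).ne'
  have h1 := key V hV V' hV' hx hx'
  have h2 : x ∈ interior (cell V') :=
    interior_mono (convexHull_mono (by exact_mod_cast h1)) hx
  exact h1.antisymm (key V' hV' V hV h2 (interior_subset hx))

theorem eventually_cell_near (T : Finset (Finset (E d))) (z : E d) :
    ∀ᶠ w in 𝓝 z, ∀ V ∈ T, w ∈ cell V → z ∈ cell V :=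
  (Finset.eventually_all T).2 fun V _ => by
    by_cases h : z ∈ cell V
    · exact .of_forall fun _ _ => h
    · filter_upwards [(isClosed_cell V).isOpen_compl.mem_nhds h] with w hw hw'
      exact absurd hw' hw

theorem IsTriangulation.exists_cell (hT : IsTriangulation k Ω T) {x : E d} (hx : x ∈ closure Ω) :
    ∃ V ∈ T, x ∈ cell V := by
  rw [← hT.cover] at hx
  simpa using hx

theorem IsTriangulation.cell_subset (hT : IsTriangulation k Ω T) {V : Finset (E d)} (hV : V ∈ T) :
    cell V ⊆ closure Ω := by
  rw [← hT.cover]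
  exact subset_biUnion_of_mem (u := fun V => cell V) (by exact_mod_cast hV)

theorem affine_translate (g : E d →ᵃ[ℝ] ℝ) (z x y : E d) : g (z + (y - x)) = g z + (g y - g x) := by
  have h1 : g (z + (y - x)) = g.linear (y - x) + g z := by
    rw [add_comm]; exact g.map_vadd z (y - x)
  have h2 : g y = g.linear (y - x) + g x := by
    have := g.map_vadd x (y - x)
    simpa using this
  rw [h1, h2]; ring

/-- If some point of a face lies in the domain, then so do all relatively interior points of it. -/
theorem IsMesh.mem_of_face (hM : IsMesh k T G N) (hT : IsTriangulation k Ω T) (hΩ : IsOpen Ω)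
    (hint : interior (closure Ω) = Ω) {V : Finset (E d)} (hV : V ∈ T) {z x : E d}
    (hz : z ∈ cell V) (hzΩ : z ∈ Ω) (hx : x ∈ cell V) (h : ∀ g ∈ G V, g x = 0 → g z = 0) :
    x ∈ Ω := by
  have S := hM.shape V hV
  obtain ⟨t, htΩ, ht0, ht1⟩ : ∃ t : ℝ, z + t • (x - z) ∈ Ω ∧ 0 < t ∧ t ≤ 1 := by
    have ht : Tendsto (fun t : ℝ => z + t • (x - z)) (𝓝 0) (𝓝 z) := by
      have : Continuous fun t : ℝ => z + t • (x - z) := by fun_prop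
      simpa using this.tendsto 0
    have h1 : ∀ᶠ t : ℝ in 𝓝[>] 0, z + t • (x - z) ∈ Ω :=
      (ht.eventually (hΩ.mem_nhds hzΩ)).filter_mono nhdsWithin_le_nhds
    obtain ⟨t, a, b⟩ := (h1.and (Ioc_mem_nhdsGT zero_lt_one)).exists
    exact ⟨t, a, b.1, b.2⟩
  -- Still in `Ω`, but already on no facet of `V` that does not contain `x`.
  set z1 := z + t • (x - z) with hz1
  have hz1V : z1 ∈ cell V := (convex_convexHull ℝ _).add_smul_sub_mem hz hx ⟨ht0.le, ht1⟩
  have hgz1 : ∀ g ∈ G V, g z1 = 0 → g x = 0 := fun g hg h0 => by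
    rw [hz1, affine_segment] at h0
    have a := S.facet_nonneg hg hz
    have b := S.facet_nonneg hg hx
    nlinarith
  have hev1 : ∀ᶠ y in 𝓝 x, z1 + (y - x) ∈ Ω ∧ ∀ V' ∈ T, z1 + (y - x) ∈ cell V' → z1 ∈ cell V' := by
    have ht : Tendsto (fun y : E d => z1 + (y - x)) (𝓝 x) (𝓝 z1) := by
      have : Continuous fun y : E d => z1 + (y - x) := by fun_prop
      simpa using this.tendsto x
    exact ht.eventually ((hΩ.eventually_mem htΩ).and (eventually_cell_near T z1))
  have hev2 : ∀ᶠ y in 𝓝 x, ∀ V' ∈ T, ∀ g ∈ G V', 0 < g x → 0 < g y :=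
    (Finset.eventually_all T).2 fun V' _ => (Finset.eventually_all _).2 fun g _ => by
      by_cases h0 : 0 < g x
      · filter_upwards [(continuous_affine g).continuousAt.eventually (lt_mem_nhds h0)] with y hy _
        exact hy
      · exact .of_forall fun _ h' => absurd h' h0
  rw [← hint, mem_interior_iff_mem_nhds]
  -- Translate a neighbourhood of `x` to one of `z1` in `Ω`. The element `V'` containing `z1 + (y -
  -- x)` also contains `z1` and hence the face of `x`. Its functionals that vanish at `x` vanish at
  -- `z` and `z1`, so they agree at `y` and at `z1 + (y - x)`; the others remain positive near `x`.
  -- Thus `y` lies in `V'`.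
  filter_upwards [hev1, hev2] with y ⟨hyΩ, hy1⟩ hy2
  obtain ⟨V', hV', hwV'⟩ := hT.exists_cell (subset_closure hyΩ)
  have hz1V' := hy1 V' hV' hwV'
  have hsub : ∀ v ∈ V, N V v x ≠ 0 → v ∈ V' := fun v hv hne =>
    hM.mem_of_ne_zero V hV V' hV' z1 hz1V hz1V' v hv ((S.nodal_ne_zero v hv z1 hz1V).2
      fun g hg h0 => (S.nodal_ne_zero v hv x hx).1 hne g hg (hgz1 g hg h0))
  have hxV' : x ∈ cell V' :=
    convexHull_mono (fun v hv => hsub v hv.1 hv.2) (S.mem_convexHull_support hx)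
  have hzx : ∀ v ∈ V, N V v z ≠ 0 → N V v x ≠ 0 := fun v hv hne =>
    (S.nodal_ne_zero v hv x hx).2 fun g hg h0 =>
      (S.nodal_ne_zero v hv z hz).1 hne g hg (h g hg h0)
  refine hT.cell_subset hV' (((hM.shape V' hV').mem_iff y).2 fun g hg => ?_)
  rcases ((hM.shape V' hV').facet_nonneg hg hxV').eq_or_lt with h0 | h0
  · have hgz : g z = 0 := by
      refine affine_eq_zero_of_convexHull g (fun v hv => ?_) (S.mem_convexHull_support hz)
      have hne := hzx v hv.1 hv.2
      have hvV' := hsub v hv.1 hne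
      rw [hM.agree V hV V' hV' x hx hxV' v hv.1 hvV'] at hne
      exact ((hM.shape V' hV').nodal_ne_zero v hvV' x hxV').1 hne g hg h0.symm
    have h1 := (hM.shape V' hV').facet_nonneg hg hwV'
    rw [affine_translate, hz1, affine_segment, hgz, ← h0] at h1
    linarith
  · exact (hy2 V' hV' g hg h0).le

/-! ### Finite element functions -/

theorem IsFEFunction.eq_sum (hM : IsMesh k T G N) {f : E d → ℝ} (hf : IsFEFunction k Ω T f)
    {V : Finset (E d)} (hV : V ∈ T) {x : E d} (hx : x ∈ cell V) :
    f x = ∑ v ∈ V, f v * N V v x := by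
  obtain ⟨q, hq, hfq⟩ := hf.piecewise V hV
  rw [hfq hx, (hM.shape V hV).interp q hq x]
  exact Finset.sum_congr rfl fun v hv => by rw [hfq (mem_cell_of_mem hv)]

/-- The local interpolants match on common points by `IsMesh`. They vanish off `Ω` because, by
`mem_of_face`, the nodal function of a vertex in `Ω` is zero at every point of the element outside
`Ω`. Continuity follows by gluing over the closed elements and the complement of `Ω`. -/
theorem exists_isFEFunction (hM : IsMesh k T G N) (hT : IsTriangulation k Ω T) (hΩ : IsOpen Ω)
    (hint : interior (closure Ω) = Ω) (c : E d → ℝ) :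
    ∃ f, IsFEFunction k Ω T f ∧ ∀ p ∈ Ω, (∃ V ∈ T, p ∈ V) → f p = c p := by
  classical
  have hex : ∀ x : E d, ∃ V, x ∈ Ω → V ∈ T ∧ x ∈ cell V := fun x => by
    by_cases hx : x ∈ Ω
    · obtain ⟨V, h1, h2⟩ := hT.exists_cell (subset_closure hx)
      exact ⟨V, fun _ => ⟨h1, h2⟩⟩
    · exact ⟨∅, fun h => absurd h hx⟩
  choose W hW using hex
  set c' : E d → ℝ := fun v => if v ∈ Ω then c v else 0 with hc'
  set f : E d → ℝ := fun x => if x ∈ Ω then ∑ v ∈ W x, c' v * N (W x) v x else 0 with hf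
  have hfV : ∀ V ∈ T, ∀ x ∈ cell V, f x = ∑ v ∈ V, c' v * N V v x := by
    intro V hV x hx
    by_cases hxΩ : x ∈ Ω
    · simp only [hf, if_pos hxΩ]
      obtain ⟨hWT, hxW⟩ := hW x hxΩ
      have key : ∀ A ∈ T, ∀ B ∈ T, x ∈ cell A → x ∈ cell B →
          ∑ v ∈ A, c' v * N A v x = ∑ v ∈ A ∩ B, c' v * N A v x := by
        intro A hA B hB hxA hxB
        refine (Finset.sum_subset Finset.inter_subset_left fun v hv hv' => ?_).symm
        have : N A v x = 0 := by
          by_contra hne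
          exact hv' (Finset.mem_inter.2 ⟨hv, hM.mem_of_ne_zero A hA B hB x hxA hxB v hv hne⟩)
        rw [this, mul_zero]
      rw [key _ hWT V hV hxW hx, key V hV _ hWT hx hxW, Finset.inter_comm]
      refine Finset.sum_congr rfl fun v hv => ?_
      rw [Finset.mem_inter] at hv
      rw [hM.agree _ hWT V hV x hxW hx v hv.2 hv.1]
    · simp only [hf, if_neg hxΩ]
      refine (Finset.sum_eq_zero fun v hv => ?_).symm
      by_cases hvΩ : v ∈ Ω
      · have : N V v x = 0 := by
          by_contra hne
          exact hxΩ (hM.mem_of_face hT hΩ hint hV (mem_cell_of_mem hv) hvΩ hx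
            (((hM.shape V hV).nodal_ne_zero v hv x hx).1 hne))
        rw [this, mul_zero]
      · simp [hc', hvΩ]
  have hpoly : ∀ V ∈ T, (fun x => ∑ v ∈ V, c' v * N V v x) ∈ localPoly d k := by
    intro V hV
    have : (fun x => ∑ v ∈ V, c' v * N V v x) = ∑ v ∈ V, c' v • N V v := by
      ext x; simp [Finset.sum_apply]
    rw [this]
    exact sum_mem fun v hv => Submodule.smul_mem _ _ ((hM.shape V hV).nodal_mem v hv)
  have h0 : ∀ x ∉ Ω, f x = 0 := fun x hx => if_neg hx
  refine ⟨f, ⟨?_, h0, fun V hV => ⟨_, hpoly V hV, fun x hx => hfV V hV x hx⟩⟩, ?_⟩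
  · refine LocallyFinite.continuous (f := fun i : Option T => i.elim Ωᶜ fun V => cell V.1)
      (locallyFinite_of_finite _) ?_ ?_ ?_
    · refine eq_univ_of_forall fun x => ?_
      by_cases hx : x ∈ Ω
      · obtain ⟨V, hV, hxV⟩ := hT.exists_cell (subset_closure hx)
        exact mem_iUnion.2 ⟨some ⟨V, hV⟩, hxV⟩
      · exact mem_iUnion.2 ⟨none, hx⟩
    · rintro (_ | V)
      · exact hΩ.isClosed_compl
      · exact isClosed_cell V.1
    · rintro (_ | V)
      · exact continuousOn_const.congr fun x hx => h0 x hx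
      · exact (contDiff_of_mem_localPoly (hpoly V.1 V.2)).continuous.continuousOn.congr
          fun x hx => hfV V.1 V.2 x hx
  · rintro p hp ⟨V, hV, hpV⟩
    rw [hfV V hV p (mem_cell_of_mem hpV), Finset.sum_eq_single p
      (fun u hu hne => by rw [(hM.shape V hV).nodal_vertex u hu p hpV hne.symm, mul_zero])
      fun h => absurd hpV h, (hM.shape V hV).nodal_self hpV, mul_one]
    simp [hc', hp]

theorem IsFEFunction.ext (hM : IsMesh k T G N) (hT : IsTriangulation k Ω T) {f f' : E d → ℝ}
    (hf : IsFEFunction k Ω T f) (hf' : IsFEFunction k Ω T f')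
    (h : ∀ p ∈ Ω, (∃ V ∈ T, p ∈ V) → f p = f' p) : f = f' := by
  ext x
  by_cases hx : x ∈ Ω
  · obtain ⟨V, hV, hxV⟩ := hT.exists_cell (subset_closure hx)
    rw [hf.eq_sum hM hV hxV, hf'.eq_sum hM hV hxV]
    refine Finset.sum_congr rfl fun v hv => ?_
    by_cases hvΩ : v ∈ Ω
    · rw [h v hvΩ ⟨V, hV, hv⟩]
    · rw [hf.eq_zero v hvΩ, hf'.eq_zero v hvΩ]
  · rw [hf.eq_zero x hx, hf'.eq_zero x hx]

/-- Nodal functions sum to one, so any constant `m` may be subtracted from the nodal values. For the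
stability of `Π_H` this will be the mean of `v`. -/
theorem IsFEFunction.abs_sub_le (hM : IsMesh k T G N) {f : E d → ℝ} (hf : IsFEFunction k Ω T f)
    {V : Finset (E d)} (hV : V ∈ T) {ℓ : ℝ} (hℓ : ∀ g ∈ G V, ∀ x y, |g x - g y| ≤ ℓ * ‖x - y‖)
    (m : ℝ) {x y : E d} (hx : x ∈ cell V) (hy : y ∈ cell V) :
    |f x - f y| ≤ (∑ v ∈ V, |f v - m|) * (d * ℓ) * ‖x - y‖ := by
  have S := hM.shape V hV
  have h1 : ∀ z ∈ cell V, f z = m + ∑ v ∈ V, (f v - m) * N V v z := fun z hz => by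
    rw [hf.eq_sum hM hV hz]
    simp only [sub_mul, Finset.sum_sub_distrib, ← Finset.mul_sum, S.sum_nodal]
    ring
  rw [h1 x hx, h1 y hy, add_sub_add_left_eq_sub, ← Finset.sum_sub_distrib, mul_assoc,
    Finset.sum_mul]
  refine (Finset.abs_sum_le_sum_abs _ _).trans (Finset.sum_le_sum fun v hv => ?_)
  rw [← mul_sub, abs_mul]
  gcongr
  exact S.nodal_lipschitz ℓ hℓ v hv x hx y hy

/-- Any finite bound will do: it only serves to show that finite element functions are Lipschitz.
The bound in terms of `σ` is `IsShapeRegular.facet_lipschitz`. -/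
theorem exists_facet_lipschitz (T : Finset (Finset (E d)))
    (G : Finset (E d) → Finset (E d →ᵃ[ℝ] ℝ)) :
    ∃ ℓ : ℝ, 0 ≤ ℓ ∧ ∀ V ∈ T, ∀ g ∈ G V, ∀ x y, |g x - g y| ≤ ℓ * ‖x - y‖ := by
  refine ⟨∑ V ∈ T, ∑ g ∈ G V, ‖LinearMap.toContinuousLinearMap g.linear‖, by positivity,
    fun V hV g hg x y => ?_⟩
  have h1 : g x - g y = LinearMap.toContinuousLinearMap g.linear (x - y) := by
    simpa using (g.linearMap_vsub x y).symm
  rw [h1, ← Real.norm_eq_abs]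
  refine (ContinuousLinearMap.le_opNorm _ _).trans ?_
  gcongr
  calc _ ≤ ∑ g ∈ G V, ‖LinearMap.toContinuousLinearMap g.linear‖ :=
        Finset.single_le_sum (f := fun g : E d →ᵃ[ℝ] ℝ =>
          ‖LinearMap.toContinuousLinearMap g.linear‖) (fun _ _ => norm_nonneg _) hg
    _ ≤ _ := Finset.single_le_sum (f := fun V =>
          ∑ g ∈ G V, ‖LinearMap.toContinuousLinearMap g.linear‖)
          (fun _ _ => Finset.sum_nonneg fun _ _ => norm_nonneg _) hV

/-- A continuous function that is Lipschitz on finitely many closed sets and vanishes elsewhere is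
Lipschitz. -/
theorem lipschitzWith_of_cover {ι : Type*} (s : Finset ι) (C : ι → Set (E d))
    (hC : ∀ i ∈ s, IsClosed (C i)) {f : E d → ℝ} (hf : Continuous f) (hΩ : IsOpen Ω)
    (h0 : ∀ x ∉ Ω, f x = 0) (hcov : ∀ x ∈ Ω, ∃ i ∈ s, x ∈ C i) (L : NNReal)
    (hL : ∀ i ∈ s, ∀ x ∈ C i, ∀ y ∈ C i, |f x - f y| ≤ L * ‖x - y‖) : LipschitzWith L f := by
  refine LipschitzWith.of_dist_le_mul fun x y => ?_
  set γ : ℝ → E d := fun t => y + t • (x - y) with hγ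
  have hγc : Continuous γ := by fun_prop
  have hγd : ∀ s t, ‖γ s - γ t‖ = |s - t| * ‖x - y‖ := fun s t => by
    rw [hγ]
    simp only [add_sub_add_left_eq_sub, ← sub_smul, norm_smul, Real.norm_eq_abs]
  set F : ℝ → ℝ := fun t => f (γ t) - f y with hF
  set M : ℝ := L * ‖x - y‖ with hM
  -- Among finitely many closed pieces, one is met by the path at times arbitrarily close after `t`,
  -- and by closedness it also contains `γ t`. A slope bound along such times is all that the mean
  -- value inequality requires.
  have hslope : ∀ t ∈ Ico (0 : ℝ) 1, ∃ᶠ z in 𝓝[>] t, |F z - F t| ≤ M * (z - t) := by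
    intro t _
    have hev : ∀ᶠ z in 𝓝[>] t, (γ z ∉ Ω ∨ ∃ i ∈ s, γ z ∈ C i) ∧ t < z :=
      (Eventually.of_forall fun z => by
        by_cases h : γ z ∈ Ω
        · exact Or.inr (hcov _ h)
        · exact Or.inl h).and self_mem_nhdsWithin
    have hγt : Tendsto γ (𝓝[>] t) (𝓝 (γ t)) := hγc.continuousAt.tendsto.mono_left nhdsWithin_le_nhds
    have hclosed : ∀ D : Set (E d), IsClosed D → (∃ᶠ z in 𝓝[>] t, γ z ∈ D) → γ t ∈ D :=
      fun D hD h => hD.mem_of_frequently_of_tendsto h hγt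
    have hfr : (∃ᶠ z in 𝓝[>] t, γ z ∉ Ω) ∨ ∃ i ∈ s, ∃ᶠ z in 𝓝[>] t, γ z ∈ C i := by
      by_contra hcon
      push Not at hcon
      have h1 : ∀ᶠ z in 𝓝[>] t, γ z ∈ Ω := hcon.1
      have h2 : ∀ᶠ z in 𝓝[>] t, ∀ i ∈ s, γ z ∉ C i :=
        (Finset.eventually_all s).2 hcon.2
      obtain ⟨z, ⟨hz1, hz2⟩, hz3, hz4⟩ := ((h1.and h2).and hev).exists
      rcases hz3 with h | ⟨i, hi, h⟩
      · exact h hz1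
      · exact hz2 i hi h
    rcases hfr with h | ⟨i, hi, h⟩
    · have ht : γ t ∉ Ω := hclosed Ωᶜ hΩ.isClosed_compl h
      refine (h.and_eventually hev).mono fun z ⟨hz, _, htz⟩ => ?_
      simp only [hF, h0 _ hz, h0 _ ht, sub_self, abs_zero]
      have : 0 ≤ z - t := by linarith
      positivity
    · have ht := hclosed _ (hC i hi) h
      refine (h.and_eventually hev).mono fun z ⟨hz, _, htz⟩ => ?_
      simp only [hF, sub_sub_sub_cancel_right]
      refine (hL i hi _ hz _ ht).trans (le_of_eq ?_)
      rw [hγd, abs_of_pos (by linarith), hM]; ring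
  have key := image_le_of_liminf_slope_right_le_deriv_boundary (f := fun t => |F t|) (a := 0)
    (b := 1) (B := fun t => M * t) (B' := fun _ => M)
    ((hf.comp hγc).sub continuous_const).abs.continuousOn (by simp [hF, hγ])
    (by fun_prop) (fun t _ => by simpa using (hasDerivWithinAt_id t (Ici t)).const_mul M)
    (fun t ht r hr => by
      refine ((hslope t ht).and_eventually self_mem_nhdsWithin).mono fun z ⟨hz, htz⟩ => ?_
      have htz' : 0 < z - t := sub_pos.2 htz
      rw [slope_def_field, div_lt_iff₀ htz']
      calc |F z| - |F t| ≤ |F z - F t| := abs_sub_abs_le_abs_sub _ _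
        _ ≤ M * (z - t) := hz
        _ < r * (z - t) := by gcongr)
    (right_mem_Icc.2 zero_le_one)
  simpa [hF, hγ, hM, Real.dist_eq, dist_eq_norm] using key

theorem exists_represents_of_isFEFunction (hM : IsMesh k T G N) (hT : IsTriangulation k Ω T)
    (hΩ : IsOpen Ω) {f : E d → ℝ} (hf : IsFEFunction k Ω T f) : ∃ v : H10 Ω, Represents f v := by
  obtain ⟨ℓ, hℓ0, hℓ⟩ := exists_facet_lipschitz T G
  have hb : Bornology.IsBounded Ω := by
    have : IsCompact (closure Ω) := by
      rw [← hT.cover]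
      exact T.finite_toSet.isCompact_biUnion fun V _ => isCompact_cell V
    exact this.isBounded.subset subset_closure
  have h0 : 0 ≤ ∑ V ∈ T, (∑ v ∈ V, |f v - 0|) * (d * ℓ) := by positivity
  refine exists_represents_of_lipschitz hΩ hb (L := ⟨_, h0⟩)
    (lipschitzWith_of_cover T cell (fun V _ => isClosed_cell V) hf.continuous hΩ hf.eq_zero
      (fun x hx => hT.exists_cell (subset_closure hx)) _ fun V hV x hx y hy => ?_) hf.eq_zero
  refine (hf.abs_sub_le hM hV (hℓ V hV) 0 hx hy).trans ?_
  gcongr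
  exact Finset.single_le_sum (f := fun V : Finset (E d) => (∑ v ∈ V, |f v - 0|) * (d * ℓ))
    (fun V _ => by positivity) hV

end OCP

end

/-! ### Inverse estimate, local projections and the operator `Π_H`. -/

noncomputable section

namespace OCP

open Filter Topology

variable {d : ℕ} {Ω : Set (E d)} {k : ElementKind} {T : Finset (Finset (E d))}
  {G : Finset (E d) → Finset (E d →ᵃ[ℝ] ℝ)} {N : Finset (E d) → E d → E d → ℝ}

theorem measurableSet_cell (V : Finset (E d)) : MeasurableSet (cell V) :=
  (isClosed_cell V).measurableSet

theorem volume_cell_ne_top (V : Finset (E d)) : volume (cell V) ≠ ⊤ :=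
  (isCompact_cell V).measure_lt_top.ne

/-- The interior of an element lies in `interior (closure Ω) = Ω`, and the frontier of a convex set
is null. -/
theorem IsTriangulation.isEssentialSubset (hT : IsTriangulation k Ω T)
    (hint : interior (closure Ω) = Ω) {V : Finset (E d)} (hV : V ∈ T) :
    IsEssentialSubset (cell V) Ω := by
  refine ⟨measurableSet_cell V, measure_mono_null ?_
    ((convex_convexHull ℝ (V : Set (E d))).addHaar_frontier volume)⟩
  rintro x ⟨hx, hxΩ⟩
  rw [(isClosed_cell V).frontier_eq]
  refine ⟨hx, fun h => hxΩ ?_⟩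
  rw [← hint]
  exact interior_mono (hT.cell_subset hV) h

theorem memLp_of_continuous_of_isCompact {K : Set (E d)} (hK : IsCompact K) {q : E d → ℝ}
    (hq : Continuous q) : MemLp q 2 (volume.restrict K) :=
  (memLp_two_iff_integrable_sq hq.aestronglyMeasurable).2
    ((hq.pow 2).continuousOn.integrableOn_compact hK)

theorem IsMesh.volume_cell_pos (hM : IsMesh k T G N) (hT : IsTriangulation k Ω T)
    {V : Finset (E d)} (hV : V ∈ T) : 0 < volume.real (cell V) := by
  have h1 := (hM.shape V hV).interior_nonempty (nonempty_of_isElement (hT.isElement V hV))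
  refine ENNReal.toReal_pos ?_ (volume_cell_ne_top V)
  exact (Measure.measure_pos_of_nonempty_interior _ h1).ne'

/-- The constant in the inverse estimate `sup |q|² ≤ C |T|⁻¹ ‖q‖²` on an element `T`. -/
def inverseConst (d : ℕ) : ℝ := (1 / (4 * d) : ℝ) ^ d / 4

theorem inverseConst_pos (hd : 1 ≤ d) : 0 < inverseConst d := by
  have : (0 : ℝ) < d := by exact_mod_cast hd
  unfold inverseConst
  positivity

/-- Let `|q|` be largest among the vertices at `w` and shrink the element towards `w` by `ε = 1 / (4
d)`. On the small copy the nodal function of `w` is at least `3/4`, so `|q| ≥ |q w| / 2`. The volume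
factor `ε ^ d` and this square give `inverseConst`. -/
theorem IsShape.inverse_estimate {V : Finset (E d)} {H : Finset (E d →ᵃ[ℝ] ℝ)}
    {M : E d → E d → ℝ} (S : IsShape k V H M) (hd : 1 ≤ d) {q : E d → ℝ}
    (hq : q ∈ localPoly d k) {p : E d} (hp : p ∈ V) :
    q p ^ 2 * (inverseConst d * volume.real (cell V)) ≤ energyOn (cell V) q := by
  have hd0 : (0 : ℝ) < d := by exact_mod_cast hd
  obtain ⟨w, hw, hmax⟩ := V.exists_max_image (fun v => |q v|) ⟨p, hp⟩
  set ε : ℝ := 1 / (4 * d) with hε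
  have hε0 : 0 < ε := by positivity
  have hdε : d * ε = 1 / 4 := by rw [hε]; field_simp
  have hε1 : ε ≤ 1 := by
    have : (1 : ℝ) ≤ d := by exact_mod_cast hd
    nlinarith
  have hqc := (contDiff_of_mem_localPoly hq).continuous
  have hsub : AffineMap.homothety w ε '' cell V ⊆ cell V := by
    rintro _ ⟨x, hx, rfl⟩
    rw [AffineMap.homothety_apply, vsub_eq_sub, vadd_eq_add, add_comm]
    exact (convex_convexHull ℝ _).add_smul_sub_mem (mem_cell_of_mem hw) hx ⟨hε0.le, hε1⟩
  have hlow : ∀ y ∈ AffineMap.homothety w ε '' cell V, (|q w| / 2) ^ 2 ≤ ‖q y‖ ^ 2 := by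
    intro y hy
    have hyV := hsub hy
    obtain ⟨x, hx, rfl⟩ := hy
    rw [AffineMap.homothety_apply, vsub_eq_sub, vadd_eq_add, add_comm] at hyV ⊢
    set y := w + ε • (x - w)
    have hN := S.nodal_near w hw x hx ε ⟨hε0.le, hε1⟩
    rw [hdε] at hN
    have h1 := S.interp q hq y
    have h2 := S.sum_nodal y
    rw [← Finset.add_sum_erase V _ hw] at h1 h2
    have h3 : |∑ v ∈ V.erase w, q v * M v y| ≤ |q w| * (1 - M w y) := by
      have : 1 - M w y = ∑ v ∈ V.erase w, M v y := by linarith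
      rw [this, Finset.mul_sum]
      refine (Finset.abs_sum_le_sum_abs _ _).trans (Finset.sum_le_sum fun v hv => ?_)
      have hv' := Finset.mem_of_mem_erase hv
      rw [abs_mul, abs_of_nonneg (S.nodal_nonneg v hv' y hyV)]
      exact mul_le_mul_of_nonneg_right (hmax v hv') (S.nodal_nonneg v hv' y hyV)
    have h4 : |q w| * M w y ≤ |q y| + |q w| * (1 - M w y) := by
      have : |q w| * M w y = |q w * M w y| := by
        rw [abs_mul, abs_of_nonneg (S.nodal_nonneg w hw y hyV)]
      rw [this, show q w * M w y = q y - ∑ v ∈ V.erase w, q v * M v y by linarith]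
      exact (abs_sub _ _).trans (by linarith)
    have h5 : |q w| / 2 ≤ ‖q y‖ := by
      rw [Real.norm_eq_abs]
      nlinarith [abs_nonneg (q w)]
    exact pow_le_pow_left₀ (by positivity) h5 2
  have hvol : volume.real (AffineMap.homothety w ε '' cell V) = ε ^ d * volume.real (cell V) := by
    rw [measureReal_def, Measure.addHaar_image_homothety, finrank_euclideanSpace_fin,
      ENNReal.toReal_mul, ENNReal.toReal_ofReal (abs_nonneg _), abs_of_pos (by positivity)]
    rfl
  have hm : MeasurableSet (AffineMap.homothety w ε '' cell V) :=
    ((isCompact_cell V).image (AffineMap.homothety_continuous w ε)).isClosed.measurableSet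
  have hqi : IntegrableOn (fun y => ‖q y‖ ^ 2) (cell V) :=
    (hqc.norm.pow 2).continuousOn.integrableOn_compact (isCompact_cell V)
  calc q p ^ 2 * (inverseConst d * volume.real (cell V))
      ≤ |q w| ^ 2 * (inverseConst d * volume.real (cell V)) := by
        have h1 := inverseConst_pos hd
        rw [← sq_abs (q p)]
        exact mul_le_mul_of_nonneg_right
          (pow_le_pow_left₀ (abs_nonneg _) (hmax p hp) 2) (by positivity)
    _ = volume.real (AffineMap.homothety w ε '' cell V) * (|q w| / 2) ^ 2 := by
        rw [hvol, inverseConst]; ring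
    _ = ∫ _ in AffineMap.homothety w ε '' cell V, (|q w| / 2) ^ 2 := by simp
    _ ≤ ∫ y in AffineMap.homothety w ε '' cell V, ‖q y‖ ^ 2 := by
        refine setIntegral_mono_on (integrableOn_const ?_) (hqi.mono_set hsub) hm hlow
        exact ne_top_of_le_ne_top (volume_cell_ne_top V) (measure_mono hsub)
    _ ≤ energyOn (cell V) q :=
        setIntegral_mono_set hqi (.of_forall fun y => by positivity) hsub.eventuallyLE

theorem IsShape.eq_zero_of_energyOn {V : Finset (E d)} {H : Finset (E d →ᵃ[ℝ] ℝ)}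
    {M : E d → E d → ℝ} (S : IsShape k V H M) (hd : 1 ≤ d) (hV : 0 < volume.real (cell V))
    {q : E d → ℝ} (hq : q ∈ localPoly d k) (h : energyOn (cell V) q = 0) : q = 0 := by
  ext x
  rw [S.interp q hq x]
  refine Finset.sum_eq_zero fun v hv => ?_
  have h1 := S.inverse_estimate hd hq hv
  rw [h] at h1
  have h2 := mul_pos (inverseConst_pos hd) hV
  have h3 : q v = 0 := by
    by_contra hne
    have : 0 < q v ^ 2 := by positivity
    nlinarith
  rw [h3, zero_mul]

/-! ### The local projections -/

theorem finite_localPoly (d : ℕ) (k : ElementKind) : FiniteDimensional ℝ (localPoly d k) := by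
  have h1 : FiniteDimensional ℝ (localPoly d .Q1) := by
    refine FiniteDimensional.span_of_finite ℝ ?_
    refine (finite_range fun (s : Finset (Fin d)) (x : E d) => ∏ i ∈ s, x i).subset ?_
    rintro f ⟨s, rfl⟩
    exact ⟨s, rfl⟩
  exact Submodule.finiteDimensional_of_le (localPoly_le_Q1 d k)

theorem exists_isLocalProjection (V : Finset (E d)) (v : H10 Ω)
    (hV : IsEssentialSubset (cell V) Ω) : ∃ q, IsLocalProjection k V v q := by
  have := finite_localPoly d k
  have hm : ∀ q : localPoly d k, MemLp (q : E d → ℝ) 2 (volume.restrict (cell V)) := fun q =>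
    memLp_of_continuous_of_isCompact (isCompact_cell V) (contDiff_of_mem_localPoly q.2).continuous
  let ι : localPoly d k →ₗ[ℝ] Lp ℝ 2 (volume.restrict (cell V)) :=
    { toFun := fun q => (hm q).toLp
      map_add' := fun p q => MemLp.toLp_add (hm p) (hm q)
      map_smul' := fun c q => MemLp.toLp_const_smul c (hm q) }
  have hvm := hV.memLp (toL2 v)
  set u := hvm.toLp
  obtain ⟨q, hq⟩ : ∃ q, ι q = (LinearMap.range ι).starProjection u :=
    LinearMap.mem_range.1 (Submodule.starProjection_apply_mem _ u)
  refine ⟨q, q.2, fun r hr => ?_⟩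
  have h := (LinearMap.range ι).starProjection_inner_eq_zero u (ι ⟨r, hr⟩) ⟨_, rfl⟩
  rw [← hq, L2.inner_def] at h
  rw [← h]
  refine integral_congr_ae ?_
  filter_upwards [hvm.coeFn_toLp, (hm q).coeFn_toLp, (hm ⟨r, hr⟩).coeFn_toLp,
    Lp.coeFn_sub u (ι q)] with x h1 h2 h3 h4
  have h2' : ι q x = (q : E d → ℝ) x := h2
  have h3' : ι ⟨r, hr⟩ x = r x := h3
  rw [h4, Pi.sub_apply, h1, h2', h3']
  simp [mul_comm]

/-- Pythagoras: `q - r` is the projection of `v - r`. It is applied with `r` the mean of `v`. -/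
theorem IsLocalProjection.energyOn_sub_le {V : Finset (E d)} {v : H10 Ω}
    (hV : IsEssentialSubset (cell V) Ω) {q r : E d → ℝ} (hq : IsLocalProjection k V v q)
    (hr : r ∈ localPoly d k) :
    energyOn (cell V) (fun x => q x - r x) ≤ energyOn (cell V) (fun x => toL2 v x - r x) := by
  have hcq := (contDiff_of_mem_localPoly hq.1).continuous
  have hcr := (contDiff_of_mem_localPoly hr).continuous
  have mq : MemLp (fun x => q x - r x) 2 (volume.restrict (cell V)) :=
    memLp_of_continuous_of_isCompact (isCompact_cell V) (hcq.sub hcr)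
  have mv : MemLp (fun x => toL2 v x - q x) 2 (volume.restrict (cell V)) :=
    (hV.memLp (toL2 v)).sub (memLp_of_continuous_of_isCompact (isCompact_cell V) hcq)
  have h0 := hq.2 (q - r) (sub_mem hq.1 hr)
  have e : energyOn (cell V) (fun x => toL2 v x - r x) =
      energyOn (cell V) (fun x => toL2 v x - q x) + energyOn (cell V) (fun x => q x - r x) := by
    have h1 : ∀ x, ‖toL2 v x - r x‖ ^ 2 = (‖toL2 v x - q x‖ ^ 2 + ‖q x - r x‖ ^ 2) +
        2 * ((toL2 v x - q x) * (q x - r x)) := fun x => by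
      simp only [Real.norm_eq_abs, sq_abs]; ring
    have i1 := (memLp_two_iff_integrable_sq_norm mv.1).1 mv
    have i2 := (memLp_two_iff_integrable_sq_norm mq.1).1 mq
    have i3 : Integrable (fun x => (toL2 v x - q x) * (q x - r x))
      (volume.restrict (cell V)) := mv.integrable_mul mq
    have i12 : Integrable (fun x => ‖toL2 v x - q x‖ ^ 2 + ‖q x - r x‖ ^ 2)
      (volume.restrict (cell V)) := i1.add i2
    simp only [energyOn, h1]
    rw [integral_add i12 (i3.const_mul 2), integral_add i1 i2, integral_const_mul]
    simp only [Pi.sub_apply] at h0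
    rw [h0]; ring
  rw [e]
  linarith [energyOn_nonneg (cell V) fun x => toL2 v x - q x]

theorem IsLocalProjection.unique (hd : 1 ≤ d) (hM : IsMesh k T G N)
    (hT : IsTriangulation k Ω T) (hint : interior (closure Ω) = Ω) {V : Finset (E d)}
    (hV : V ∈ T) {v : H10 Ω} {q r : E d → ℝ} (hq : IsLocalProjection k V v q)
    (hr : IsLocalProjection k V v r) : q = r := by
  have hVe := hT.isEssentialSubset hint hV
  have m : ∀ p ∈ localPoly d k, MemLp p 2 (volume.restrict (cell V)) := fun p hp =>
    memLp_of_continuous_of_isCompact (isCompact_cell V) (contDiff_of_mem_localPoly hp).continuous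
  have hqr := sub_mem hq.1 hr.1
  have h1 := hq.2 _ hqr
  have h2 := hr.2 _ hqr
  have h3 : energyOn (cell V) (q - r) = 0 := by
    have i1 : Integrable (fun x => (toL2 v x - q x) * (q - r) x) (volume.restrict (cell V)) :=
      ((hVe.memLp (toL2 v)).sub (m q hq.1)).integrable_mul (m _ hqr)
    have i2 : Integrable (fun x => (toL2 v x - r x) * (q - r) x) (volume.restrict (cell V)) :=
      ((hVe.memLp (toL2 v)).sub (m r hr.1)).integrable_mul (m _ hqr)
    have h4 := integral_sub i2 i1
    rw [h1, h2, sub_zero] at h4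
    rw [energyOn, ← h4]
    refine integral_congr_ae (.of_forall fun x => ?_)
    simp only [Pi.sub_apply, Real.norm_eq_abs, sq_abs]
    ring
  exact sub_eq_zero.1 ((hM.shape V hV).eq_zero_of_energyOn hd (hM.volume_cell_pos hT hV) hqr h3)

/-! ### The projection operator -/

theorem Represents.eq (hΩ : IsOpen Ω) {f : E d → ℝ} {v w : H10 Ω} (hv : Represents f v)
    (hw : Represents f w) : v = w :=
  toL2_injective hΩ (Lp.ext (hv.trans hw.symm))

theorem existsUnique_isPi (hd : 1 ≤ d) (hT : IsTriangulation k Ω T) (hΩ : IsOpen Ω)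
    (hint : interior (closure Ω) = Ω) (v : H10 Ω) : ∃! w : H10 Ω, IsPi k T v w := by
  classical
  obtain ⟨G, N, hM⟩ := hT.exists_isMesh hd
  have hex : ∀ V : Finset (E d), ∃ q, V ∈ T → IsLocalProjection k V v q := fun V => by
    by_cases hV : V ∈ T
    · obtain ⟨q, hq⟩ := exists_isLocalProjection (k := k) V v (hT.isEssentialSubset hint hV)
      exact ⟨q, fun _ => hq⟩
    · exact ⟨0, fun h => absurd h hV⟩
  choose Q hQ using hex
  obtain ⟨f, hf, hfp⟩ := exists_isFEFunction hM hT hΩ hint fun p =>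
    (∑ V ∈ T.filter (fun V => p ∈ V), Q V p) / ((T.filter (fun V => p ∈ V)).card : ℝ)
  obtain ⟨w, hw⟩ := exists_represents_of_isFEFunction hM hT hΩ hf
  have hwPi : IsPi k T v w := ⟨Q, f, hQ, hf, hw, fun p hp hpV => by convert hfp p hp hpV⟩
  refine ⟨w, hwPi, ?_⟩
  rintro w' ⟨Q', f', hQ', hf', hw', hfp'⟩
  have hff : f' = f := by
    refine IsFEFunction.ext hM hT hf' hf fun p hp hpV => ?_
    rw [hfp' p hp hpV, hfp p hp hpV]
    congr 1
    refine Finset.sum_congr (by congr) fun V hV => ?_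
    have hVT : V ∈ T := (Finset.mem_filter.1 hV).1
    rw [(hQ' V hVT).unique hd hM hT hint hVT (hQ V hVT)]
  subst hff
  exact hw'.eq hΩ hw

theorem IsFEFunction.add {f g : E d → ℝ} (hf : IsFEFunction k Ω T f)
    (hg : IsFEFunction k Ω T g) : IsFEFunction k Ω T (f + g) where
  continuous := hf.continuous.add hg.continuous
  eq_zero x hx := by simp [hf.eq_zero x hx, hg.eq_zero x hx]
  piecewise V hV := by
    obtain ⟨p, hp, hfp⟩ := hf.piecewise V hV
    obtain ⟨q, hq, hgq⟩ := hg.piecewise V hV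
    exact ⟨p + q, add_mem hp hq, fun x hx => by simp [hfp hx, hgq hx]⟩

theorem IsFEFunction.smul {f : E d → ℝ} (c : ℝ) (hf : IsFEFunction k Ω T f) :
    IsFEFunction k Ω T (c • f) where
  continuous := hf.continuous.const_smul c
  eq_zero x hx := by simp [hf.eq_zero x hx]
  piecewise V hV := by
    obtain ⟨p, hp, hfp⟩ := hf.piecewise V hV
    exact ⟨c • p, Submodule.smul_mem _ c hp, fun x hx => by simp [hfp hx]⟩

theorem isFEFunction_zero : IsFEFunction k Ω T (0 : E d → ℝ) where
  continuous := continuous_const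
  eq_zero _ _ := rfl
  piecewise _ _ := ⟨0, zero_mem _, fun _ _ => rfl⟩

theorem Represents.add {f g : E d → ℝ} {v w : H10 Ω} (hv : Represents f v)
    (hw : Represents g w) : Represents (f + g) (v + w) := by
  rw [Represents, toL2_add]
  exact (Lp.coeFn_add _ _).trans (Filter.EventuallyEq.add hv hw)

theorem Represents.smul {f : E d → ℝ} {v : H10 Ω} (c : ℝ) (hv : Represents f v) :
    Represents (c • f) (c • v) := by
  rw [Represents, toL2_smul]
  exact (Lp.coeFn_smul _ _).trans (Filter.EventuallyEq.const_smul hv c)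

theorem represents_zero : Represents (0 : E d → ℝ) (0 : H10 Ω) := Lp.coeFn_zero _ _ _

theorem IsLocalProjection.add {V : Finset (E d)} (hV : IsEssentialSubset (cell V) Ω)
    {v w : H10 Ω} {p q : E d → ℝ} (hp : IsLocalProjection k V v p)
    (hq : IsLocalProjection k V w q) : IsLocalProjection k V (v + w) (p + q) := by
  refine ⟨add_mem hp.1 hq.1, fun r hr => ?_⟩
  have m : ∀ p ∈ localPoly d k, MemLp p 2 (volume.restrict (cell V)) := fun p hp =>
    memLp_of_continuous_of_isCompact (isCompact_cell V) (contDiff_of_mem_localPoly hp).continuous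
  have i1 : Integrable (fun x => (toL2 v x - p x) * r x) (volume.restrict (cell V)) :=
    ((hV.memLp (toL2 v)).sub (m p hp.1)).integrable_mul (m r hr)
  have i2 : Integrable (fun x => (toL2 w x - q x) * r x) (volume.restrict (cell V)) :=
    ((hV.memLp (toL2 w)).sub (m q hq.1)).integrable_mul (m r hr)
  have h := integral_add i1 i2
  rw [hp.2 r hr, hq.2 r hr, add_zero] at h
  rw [← h]
  refine integral_congr_ae ?_
  filter_upwards [ae_mono hV.restrict_le (Lp.coeFn_add (toL2 v) (toL2 w))] with x hx
  rw [toL2_add, hx, Pi.add_apply, Pi.add_apply]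
  ring

theorem IsLocalProjection.smul {V : Finset (E d)} (hV : IsEssentialSubset (cell V) Ω) (c : ℝ)
    {v : H10 Ω} {p : E d → ℝ} (hp : IsLocalProjection k V v p) :
    IsLocalProjection k V (c • v) (c • p) := by
  refine ⟨Submodule.smul_mem _ c hp.1, fun r hr => ?_⟩
  have h := integral_const_mul (μ := volume.restrict (cell V)) c fun x =>
    (toL2 v x - p x) * r x
  rw [hp.2 r hr, mul_zero] at h
  rw [← h]
  refine integral_congr_ae ?_
  filter_upwards [ae_mono hV.restrict_le (Lp.coeFn_smul c (toL2 v))] with x hx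
  rw [toL2_smul, hx, Pi.smul_apply, Pi.smul_apply, smul_eq_mul, smul_eq_mul]
  ring

theorem IsPi.add (hT : IsTriangulation k Ω T) (hint : interior (closure Ω) = Ω)
    {v w v' w' : H10 Ω} (h : IsPi k T v w) (h' : IsPi k T v' w') :
    IsPi k T (v + v') (w + w') := by
  obtain ⟨Q, f, h1, h2, h3, h4⟩ := h
  obtain ⟨Q', f', h1', h2', h3', h4'⟩ := h'
  refine ⟨Q + Q', f + f', fun V hV => (h1 V hV).add (hT.isEssentialSubset hint hV) (h1' V hV),
    h2.add h2', h3.add h3', fun p hp hpV => ?_⟩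
  simp only [Pi.add_apply, h4 p hp hpV, h4' p hp hpV, Finset.sum_add_distrib, add_div]

theorem IsPi.smul (hT : IsTriangulation k Ω T) (hint : interior (closure Ω) = Ω) (c : ℝ)
    {v w : H10 Ω} (h : IsPi k T v w) : IsPi k T (c • v) (c • w) := by
  obtain ⟨Q, f, h1, h2, h3, h4⟩ := h
  refine ⟨c • Q, c • f, fun V hV => (h1 V hV).smul (hT.isEssentialSubset hint hV) c,
    h2.smul c, h3.smul c, fun p hp hpV => ?_⟩
  simp only [Pi.smul_apply, h4 p hp hpV, smul_eq_mul, ← Finset.mul_sum, mul_div_assoc]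

end OCP

end

/-! ### Facet neighbours and the elements around a vertex. -/

noncomputable section

namespace OCP

open Filter Topology

variable {d : ℕ} {Ω : Set (E d)} {k : ElementKind} {T : Finset (Finset (E d))}
  {G : Finset (E d) → Finset (E d →ᵃ[ℝ] ℝ)} {N : Finset (E d) → E d → E d → ℝ}

/-- `V` and `V'` have a common facet that contains the vertex `p`, and lie on different sides
of it. -/
def FacetAdj (G : Finset (E d) → Finset (E d →ᵃ[ℝ] ℝ)) (p : E d) (V V' : Finset (E d)) : Prop :=
  ∃ g ∈ G V, ∃ g' ∈ G V', ∃ κ : ℝ, 0 < κ ∧ (∀ x, g' x = -κ * g x) ∧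
    (∀ v, v ∈ V ∧ g v = 0 ↔ v ∈ V' ∧ g' v = 0) ∧ p ∈ V ∧ g p = 0

theorem FacetAdj.symm {p : E d} {V V' : Finset (E d)} (h : FacetAdj G p V V') :
    FacetAdj G p V' V := by
  obtain ⟨g, hg, g', hg', κ, hκ, h1, h2, h3, h4⟩ := h
  refine ⟨g', hg', g, hg, κ⁻¹, inv_pos.2 hκ, fun x => ?_, fun v => (h2 v).symm,
    ((h2 p).1 ⟨h3, h4⟩).1, ((h2 p).1 ⟨h3, h4⟩).2⟩
  rw [h1]; field_simp

theorem tendsto_segment (z y : E d) :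
    Tendsto (fun t : ℝ => z + t • (y - z)) (𝓝[>] 0) (𝓝 z) := by
  have h : Continuous fun t : ℝ => z + t • (y - z) := by fun_prop
  have := h.tendsto 0
  simp only [zero_smul, add_zero] at this
  exact this.mono_left nhdsWithin_le_nhds

theorem eventually_facets_pos (H : Finset (E d →ᵃ[ℝ] ℝ)) (z : E d) :
    ∀ᶠ y in 𝓝 z, ∀ h ∈ H, 0 < h z → 0 < h y :=
  (Finset.eventually_all H).2 fun h _ => by
    by_cases h0 : 0 < h z
    · filter_upwards [(continuous_affine h).continuousAt.eventually (lt_mem_nhds h0)] with y hy _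
      exact hy
    · exact .of_forall fun _ h' => absurd h' h0

namespace IsMesh

/-- As `z` lies on no other facet, the nodal functions of all vertices of this facet are nonzero at
`z`, so every element containing `z` has these vertices. -/
theorem facet_subset (hM : IsMesh k T G N) {V V' : Finset (E d)}
    (hV : V ∈ T) (hV' : V' ∈ T) {z : E d} (hz : z ∈ cell V) (hz' : z ∈ cell V')
    {g : E d →ᵃ[ℝ] ℝ} (huniq : ∀ h ∈ G V, h z = 0 → h = g) {v : E d} (hv : v ∈ V)
    (hgv : g v = 0) : v ∈ V' ∧ N V' v z ≠ 0 := by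
  have h1 : N V v z ≠ 0 := ((hM.shape V hV).nodal_ne_zero v hv z hz).2 fun h hh h0 => by
    rw [huniq h hh h0]; exact hgv
  have h2 := hM.mem_of_ne_zero V hV V' hV' z hz hz' v hv h1
  exact ⟨h2, by rwa [← hM.agree V hV V' hV' z hz hz' v hv h2]⟩

/-- Near `z` the hyperplane `g = 0` stays inside `V`, in the hull of the facet vertices. These
belong to `V'` and `g'` vanishes there, so `g'` vanishes on the whole hyperplane. -/
theorem facet_proportional (hM : IsMesh k T G N) {V V' : Finset (E d)}
    (hV : V ∈ T) (hV' : V' ∈ T) {z : E d} (hz : z ∈ cell V) (hz' : z ∈ cell V')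
    {g : E d →ᵃ[ℝ] ℝ} (hg : g ∈ G V) (hgz : g z = 0) (huniq : ∀ h ∈ G V, h z = 0 → h = g)
    {g' : E d →ᵃ[ℝ] ℝ} (hg' : g' ∈ G V') (hgz' : g' z = 0) : ∃ c : ℝ, ∀ x, g' x = c * g x := by
  have S := hM.shape V hV
  have key : ∀ y, g y = 0 → g' y = 0 := by
    intro y hy
    obtain ⟨t, ht, ht0⟩ := (((tendsto_segment z y).eventually (eventually_facets_pos (G V) z)).and
      self_mem_nhdsWithin).exists
    have ht0' : 0 < t := ht0
    set w := z + t • (y - z) with hw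
    have hgw : g w = 0 := by rw [hw, affine_segment, hgz, hy]; ring
    have hwV : w ∈ cell V := (S.mem_iff w).2 fun h hh => by
      rcases (S.facet_nonneg hh hz).eq_or_lt with h0 | h0
      · rw [huniq h hh h0.symm, hgw]
      · exact (ht h hh h0).le
    have hgw' : g' w = 0 := by
      refine affine_eq_zero_of_convexHull g' (fun v hv => ?_) (S.mem_convexHull_support hwV)
      have hgv := (S.nodal_ne_zero v hv.1 w hwV).1 hv.2 g hg hgw
      obtain ⟨h1, h2⟩ := hM.facet_subset hV hV' hz hz' huniq hv.1 hgv
      exact ((hM.shape V' hV').nodal_ne_zero v h1 z hz').1 h2 g' hg' hgz'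
    rw [hw, affine_segment, hgz'] at hgw'
    have : t * g' y = 0 := by linarith
    exact (mul_eq_zero.1 this).resolve_left ht0'.ne'
  obtain ⟨v, hv, hgv⟩ := S.exists_eq_one g hg
  refine ⟨g' v, fun x => ?_⟩
  -- The point `x - g x • (v - z)` lies on the hyperplane since `g z = 0` and `g v = 1`.
  have h1 := key (x + ((z + (-(g x)) • (v - z)) - z)) (by
    rw [affine_translate, affine_segment, hgz, hgv]; ring)
  rw [affine_translate, affine_segment, hgz'] at h1
  linarith

/-- Different elements share no interior point, so `z` lies on a facet of `V'` too. Its functional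
is a multiple of `g`, and `facet_sep` makes it unique. A positive factor would put points just
inside `V` into `V'`, so the factor is negative and the elements lie on opposite sides. -/
theorem facetAdj (hM : IsMesh k T G N) {V V' : Finset (E d)}
    (hV : V ∈ T) (hV' : V' ∈ T) (hne : V ≠ V') {z : E d} (hz : z ∈ cell V) (hz' : z ∈ cell V')
    {g : E d →ᵃ[ℝ] ℝ} (hg : g ∈ G V) (hgz : g z = 0) (huniq : ∀ h ∈ G V, h z = 0 → h = g)
    {p : E d} (hp : p ∈ V) (hgp : g p = 0) : FacetAdj G p V V' := by
  have S := hM.shape V hV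
  have S' := hM.shape V' hV'
  obtain ⟨g', hg', hgz'⟩ : ∃ g' ∈ G V', g' z = 0 := by
    by_contra hcon
    push Not at hcon
    have : z ∈ interior (cell V') := S'.mem_interior_iff.2 fun h hh =>
      lt_of_le_of_ne (S'.facet_nonneg hh hz') (hcon h hh).symm
    exact hne (hM.eq_of_mem_interior hV' hV this hz).symm
  obtain ⟨c, hc⟩ := hM.facet_proportional hV hV' hz hz' hg hgz huniq hg' hgz'
  have hc0 : c ≠ 0 := by
    rintro rfl
    obtain ⟨v, -, hv⟩ := S'.exists_eq_one g' hg'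
    rw [hc, zero_mul] at hv
    exact zero_ne_one hv
  have huniq' : ∀ h ∈ G V', h z = 0 → h = g' := by
    intro h hh h0
    by_contra hne'
    obtain ⟨c', hc'⟩ := hM.facet_proportional hV hV' hz hz' hg hgz huniq hh h0
    obtain ⟨v, -, hv1, hv2⟩ := S'.facet_sep g' hg' h hh (Ne.symm hne')
    rw [hc] at hv1
    rw [hc', (mul_eq_zero.1 hv1).resolve_left hc0, mul_zero] at hv2
    exact zero_ne_one hv2
  have hcneg : c < 0 := by
    refine lt_of_le_of_ne (not_lt.1 fun hcpos => hne ?_) hc0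
    obtain ⟨v, hv, hgv⟩ := S.exists_eq_one g hg
    obtain ⟨t, ⟨ht1, ht2⟩, ht0⟩ := (((tendsto_segment z v).eventually
      ((eventually_facets_pos (G V) z).and (eventually_facets_pos (G V') z))).and
      self_mem_nhdsWithin).exists
    have ht0' : 0 < t := ht0
    set w := z + t • (v - z) with hw
    have hgw : g w = t := by rw [hw, affine_segment, hgz, hgv]; ring
    refine hM.eq_of_mem_interior hV hV' (x := w) (S.mem_interior_iff.2 fun h hh => ?_)
      ((S'.mem_iff w).2 fun h hh => ?_)
    · rcases (S.facet_nonneg hh hz).eq_or_lt with h0 | h0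
      · rw [huniq h hh h0.symm, hgw]; exact ht0'
      · exact ht1 h hh h0
    · rcases (S'.facet_nonneg hh hz').eq_or_lt with h0 | h0
      · rw [huniq' h hh h0.symm, hc, hgw]; positivity
      · exact (ht2 h hh h0).le
  refine ⟨g, hg, g', hg', -c, neg_pos.2 hcneg, fun x => by rw [neg_neg, hc], fun v => ?_, hp, hgp⟩
  constructor
  · rintro ⟨hv, hgv⟩
    exact ⟨(hM.facet_subset hV hV' hz hz' huniq hv hgv).1, by rw [hc, hgv, mul_zero]⟩
  · rintro ⟨hv, hgv⟩
    refine ⟨(hM.facet_subset hV' hV hz' hz huniq' hv hgv).1, ?_⟩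
    rw [hc] at hgv
    exact (mul_eq_zero.1 hgv).resolve_left hc0

end IsMesh

theorem volume_affine_eq_zero (g : E d →ᵃ[ℝ] ℝ) {x : E d} (hx : g x ≠ 0) :
    volume {y | g y = 0} = 0 := by
  have h := Measure.addHaar_affineSubspace (volume : Measure (E d))
    ((affineSpan ℝ {(0 : ℝ)}).comap g) fun htop => hx (by
      have : x ∈ (affineSpan ℝ {(0 : ℝ)}).comap g := by rw [htop]; trivial
      simpa using this)
  convert h using 2
  ext y
  simp

theorem exists_mem_of_isOpen_of_null {U S : Set (E d)} (hU : IsOpen U) (hne : U.Nonempty)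
    (hS : volume S = 0) : ∃ x ∈ U, x ∉ S := by
  by_contra hcon
  push Not at hcon
  exact (hU.measure_pos volume hne).ne' (measure_mono_null hcon hS)

/-- The elements that can be reached from `V` through common facets at the vertex `p`. -/
def FacetReachable (T : Finset (Finset (E d))) (G : Finset (E d) → Finset (E d →ᵃ[ℝ] ℝ)) (p : E d) :
    Finset (E d) → Finset (E d) → Prop :=
  Relation.ReflTransGen fun A B => A ∈ T ∧ B ∈ T ∧ FacetAdj G p A B

/-- Either the elements that can be reached from an element through facets at the vertex `p` are
all elements at `p`, or one of them has a facet at `p` on the boundary. -/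
theorem IsMesh.reachable_or_boundary (hM : IsMesh k T G N) (hT : IsTriangulation k Ω T)
    (hΩ : IsOpen Ω) (hint : interior (closure Ω) = Ω) {V₀ : Finset (E d)} (hV₀ : V₀ ∈ T)
    {p : E d} (hp : p ∈ V₀) :
    (p ∈ Ω ∧ ∀ V ∈ T, p ∈ V → FacetReachable T G p V₀ V) ∨
      ∃ V ∈ T, p ∈ V ∧ FacetReachable T G p V₀ V ∧
        ∃ g ∈ G V, g p = 0 ∧ ∀ z ∈ cell V, g z = 0 → z ∉ Ω := by
  by_cases hbd : ∃ V ∈ T, p ∈ V ∧ FacetReachable T G p V₀ V ∧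
        ∃ g ∈ G V, g p = 0 ∧ ∀ z ∈ cell V, g z = 0 → z ∉ Ω
  · exact Or.inr hbd
  refine Or.inl ?_
  push Not at hbd
  -- The aim is that this closed union covers a ball `D` around `p`, so small that functionals
  -- positive at `p` stay positive on `D`.
  set U : Set (E d) := ⋃ V ∈ {V | V ∈ T ∧ p ∈ V ∧ FacetReachable T G p V₀ V}, cell V with hU
  have hmemU : ∀ x, x ∈ U ↔ ∃ V ∈ T, p ∈ V ∧ FacetReachable T G p V₀ V ∧ x ∈ cell V := fun x => by
    simp only [hU, mem_iUnion, mem_ofPred_eq]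
    constructor
    · rintro ⟨V, ⟨a, b, c⟩, e⟩; exact ⟨V, a, b, c, e⟩
    · rintro ⟨V, a, b, c, e⟩; exact ⟨V, ⟨a, b, c⟩, e⟩
  have hUc : IsClosed U := Set.Finite.isClosed_biUnion
    (T.finite_toSet.subset fun V hV => hV.1) fun V _ => isClosed_cell V
  obtain ⟨δ, hδ, hD⟩ := Metric.eventually_nhds_iff_ball.1 ((eventually_cell_near T p).and
    ((Finset.eventually_all T).2 fun V _ => eventually_facets_pos (G V) p))
  set D := Metric.ball p δ with hDdef
  have hint0 : ∀ V ∈ T, p ∈ V → (interior (cell V) ∩ D).Nonempty := fun V hV hpV => by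
    have h1 := (hM.shape V hV).interior_nonempty ⟨p, hpV⟩
    have h2 : p ∈ closure (interior (cell V)) := by
      rw [(convex_convexHull ℝ (V : Set (E d))).closure_interior_eq_closure_of_nonempty_interior h1]
      exact subset_closure (mem_cell_of_mem hpV)
    rw [inter_comm]
    exact mem_closure_iff.1 h2 D Metric.isOpen_ball (Metric.mem_ball_self hδ)
  have hDU : D ⊆ U := by
    by_contra hcon
    obtain ⟨y₀, hy₀D, hy₀U⟩ := not_subset.1 hcon
    -- Walk from a point inside `V₀` to a point of `D` outside `U`. The start avoids all facet
    -- hyperplanes; the end is chosen below outside finitely many further null sets, so that the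
    -- segment never meets two facets of one element simultaneously.
    obtain ⟨x, ⟨hx0, hxD⟩, hxS⟩ := exists_mem_of_isOpen_of_null
      (isOpen_interior.inter Metric.isOpen_ball) (hint0 V₀ hV₀ hp)
      (S := ⋃ V ∈ T, ⋃ g ∈ G V, {y | g y = 0}) (by
        refine (measure_biUnion_null_iff T.countable_toSet).2 fun V hV =>
          (measure_biUnion_null_iff (G V).countable_toSet).2 fun g hg => ?_
        obtain ⟨v, -, hv⟩ := (hM.shape V hV).exists_eq_one g hg
        exact volume_affine_eq_zero g (x := v) (by rw [hv]; exact one_ne_zero))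
    have hx : ∀ V ∈ T, ∀ g ∈ G V, g x ≠ 0 := fun V hV g hg h0 =>
      hxS (mem_iUnion₂.2 ⟨V, hV, mem_iUnion₂.2 ⟨g, hg, h0⟩⟩)
    obtain ⟨y, ⟨hyD, hyU⟩, hyS⟩ := exists_mem_of_isOpen_of_null
      (Metric.isOpen_ball.inter hUc.isOpen_compl) ⟨y₀, hy₀D, hy₀U⟩
      (S := ⋃ V ∈ T, ⋃ g ∈ G V, ⋃ g' ∈ (G V : Set _) \ {g},
        {y | (g' x • g - g x • g' : E d →ᵃ[ℝ] ℝ) y = 0}) (by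
        refine (measure_biUnion_null_iff T.countable_toSet).2 fun V hV =>
          (measure_biUnion_null_iff (G V).countable_toSet).2 fun g hg =>
          (measure_biUnion_null_iff ((G V).countable_toSet.mono sdiff_subset)).2 fun g' hg' => ?_
        obtain ⟨v, -, hv1, hv2⟩ := (hM.shape V hV).facet_sep g hg g' hg'.1
          fun h => hg'.2 h.symm
        refine volume_affine_eq_zero _ (x := v) ?_
        simp [hv1, hv2, hx V hV g hg])
    have hy : ∀ V ∈ T, ∀ g ∈ G V, ∀ g' ∈ G V, g' ≠ g → g' x * g y - g x * g' y ≠ 0 :=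
      fun V hV g hg g' hg' hne h0 => hyS (mem_iUnion₂.2 ⟨V, hV, mem_iUnion₂.2 ⟨g, hg,
        mem_iUnion₂.2 ⟨g', ⟨hg', hne⟩, by simpa using h0⟩⟩⟩)
    set γ : ℝ → E d := fun t => x + t • (y - x) with hγ
    have hγc : Continuous γ := by fun_prop
    have hcl := (hUc.preimage hγc).inter (isClosed_Icc (a := (0 : ℝ)) (b := 1))
    have h0U : (0 : ℝ) ∈ γ ⁻¹' U := by
      rw [mem_preimage, hmemU]
      exact ⟨V₀, hV₀, hp, Relation.ReflTransGen.refl, by simpa [hγ] using interior_subset hx0⟩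
    -- Continuous induction: the times spent in `U` form a closed set, and it remains to see that
    -- the path cannot leave `U` just after such a time.
    have h1U := hcl.Icc_subset_of_forall_mem_nhdsWithin h0U (fun t ht => ?_)
      (right_mem_Icc.2 (zero_le_one' ℝ))
    · exact hyU (by simpa [hγ] using h1U)
    · obtain ⟨htU, ht0, ht1⟩ := ht
      obtain ⟨V, hV, hpV, hVr, hzV⟩ := (hmemU _).1 htU
      set z := γ t with hz
      have hzD : z ∈ D := (convex_ball p δ).add_smul_sub_mem hxD hyD ⟨ht0, ht1.le⟩
      have hgz : ∀ g : E d →ᵃ[ℝ] ℝ, g z = g x + t * (g y - g x) := fun g => affine_segment g y x t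
      refine mem_nhdsWithin_of_mem_nhds (hγc.continuousAt.preimage_mem_nhds ?_)
      by_cases hall : ∀ g ∈ G V, 0 < g z
      · have h1 := (hM.shape V hV).mem_interior_iff.2 hall
        filter_upwards [mem_interior_iff_mem_nhds.1 h1] with w hw
        exact (hmemU w).2 ⟨V, hV, hpV, hVr, hw⟩
      · push Not at hall
        obtain ⟨g, hg, hgz0⟩ := hall
        have hgz0 : g z = 0 := le_antisymm hgz0 ((hM.shape V hV).facet_nonneg hg hzV)
        have huniq : ∀ h ∈ G V, h z = 0 → h = g := by
          intro h hh hhz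
          by_contra hne
          have ht : t ≠ 0 := by
            rintro rfl
            refine hx V hV g hg ?_
            have := hgz g
            rw [hgz0] at this
            linarith
          refine hy V hV g hg h hh hne ?_
          have e1 := hgz g
          have e2 := hgz h
          rw [hgz0] at e1
          rw [hhz] at e2
          have : t * (h x * g y - g x * h y) = 0 := by
            linear_combination (-(h x)) * e1 + g x * e2
          exact (mul_eq_zero.1 this).resolve_left ht
        have hgp : g p = 0 := by
          rcases (hM.shape V hV).vertex g hg p hpV with h | h
          · exact h
          · have := (hD z hzD).2 V hV g hg (by rw [h]; exact one_pos)
            linarith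
        -- The facet crossed at `z` contains `p` and, as no boundary facet is reachable, some point
        -- of `Ω`. Since `z` is on no other facet of `V`, it lies in `Ω` too, and each element
        -- covering points near `z` is `V` or its neighbour through this facet.
        obtain ⟨z', hz'V, hgz', hz'Ω⟩ := hbd V hV hpV hVr g hg hgp
        have hzΩ : z ∈ Ω := hM.mem_of_face hT hΩ hint hV hz'V hz'Ω hzV
          fun h hh h0 => by rw [huniq h hh h0]; exact hgz'
        filter_upwards [hΩ.mem_nhds hzΩ, eventually_cell_near T z] with w hwΩ hw
        obtain ⟨V', hV', hwV'⟩ := hT.exists_cell (subset_closure hwΩ)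
        rw [hmemU]
        by_cases hVV : V = V'
        · subst hVV
          exact ⟨V, hV, hpV, hVr, hwV'⟩
        · have hadj := hM.facetAdj hV hV' hVV hzV (hw V' hV' hwV') hg hgz0 huniq hpV hgp
          obtain ⟨_, _, _, _, _, _, _, _, hpV', _⟩ := hadj.symm
          exact ⟨V', hV', hpV', hVr.tail ⟨hV, hV', hadj⟩, hwV'⟩
  constructor
  · rw [← hint, mem_interior_iff_mem_nhds]
    filter_upwards [Metric.ball_mem_nhds p hδ] with x hx
    obtain ⟨V, hV, -, -, hxV⟩ := (hmemU x).1 (hDU hx)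
    exact hT.cell_subset hV hxV
  · intro V hV hpV
    obtain ⟨x, hxV, hxD⟩ := hint0 V hV hpV
    obtain ⟨V', hV', -, hr, hxV'⟩ := (hmemU x).1 (hDU hxD)
    rwa [hM.eq_of_mem_interior hV hV' hxV hxV']

end OCP

end

/-! ### Consequences of shape regularity. -/

noncomputable section

namespace OCP

open Filter Topology

variable {d : ℕ} {Ω : Set (E d)} {k : ElementKind} {T : Finset (Finset (E d))}
  {G : Finset (E d) → Finset (E d →ᵃ[ℝ] ℝ)} {N : Finset (E d) → E d → E d → ℝ} {σ : ℝ}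

theorem norm_sub_le_elementDiam {V : Finset (E d)} {x y : E d} (hx : x ∈ cell V) (hy : y ∈ cell V) :
    ‖x - y‖ ≤ elementDiam V := by
  rw [← dist_eq_norm]
  exact Metric.dist_le_diam_of_mem (isCompact_cell V).isBounded hx hy

theorem elementDiam_nonneg (V : Finset (E d)) : 0 ≤ elementDiam V := Metric.diam_nonneg

theorem elementDiam_le_meshSize {V : Finset (E d)} (hV : V ∈ T) : elementDiam V ≤ meshSize T :=
  le_csSup (T.finite_toSet.image _).bddAbove ⟨V, hV, rfl⟩

/-- The volume of the unit ball. -/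
def unitBallVolume (d : ℕ) : ℝ := volume.real (Metric.ball (0 : E d) 1)

theorem unitBallVolume_pos (d : ℕ) : 0 < unitBallVolume d :=
  ENNReal.toReal_pos (Metric.measure_ball_pos volume _ one_pos).ne' measure_ball_lt_top.ne

theorem volume_real_closedBall (c : E d) {r : ℝ} (hr : 0 ≤ r) :
    volume.real (Metric.closedBall c r) = r ^ d * unitBallVolume d := by
  rw [Measure.addHaar_real_closedBall volume c hr, finrank_euclideanSpace_fin, unitBallVolume]

theorem volume_real_ball (c : E d) {r : ℝ} (hr : 0 < r) :
    volume.real (Metric.ball c r) = r ^ d * unitBallVolume d := by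
  rw [measureReal_def, Measure.addHaar_ball_of_pos volume c hr, finrank_euclideanSpace_fin,
    ENNReal.toReal_mul, ENNReal.toReal_ofReal (by positivity), unitBallVolume, measureReal_def]

theorem volume_real_cell_le {V : Finset (E d)} (hne : V.Nonempty) :
    volume.real (cell V) ≤ elementDiam V ^ d * unitBallVolume d := by
  obtain ⟨v, hv⟩ := hne
  rw [← volume_real_closedBall v (elementDiam_nonneg V)]
  refine measureReal_mono (fun x hx => ?_) measure_closedBall_lt_top.ne
  rw [mem_closedBall_iff_norm]
  exact norm_sub_le_elementDiam hx (mem_cell_of_mem hv)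

namespace IsShapeRegular

variable (hR : IsShapeRegular σ T) {V : Finset (E d)} (hV : V ∈ T)
include hR hV

theorem diam_pos (hd : 1 ≤ d) : 0 < elementDiam V ∧ 2 ≤ σ := by
  obtain ⟨c, r, hr, hc, hσ⟩ := hR.ball V hV
  have : Nonempty (Fin d) := ⟨⟨0, hd⟩⟩
  have : Nontrivial (E d) := inferInstance
  obtain ⟨e, he⟩ := exists_norm_eq (E d) hr.le
  have h1 : c + e ∈ cell V := hc (by simp [he])
  have h2 : c - e ∈ cell V := hc (by simp [he])
  have h3 := norm_sub_le_elementDiam h1 h2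
  have h4 : c + e - (c - e) = (2 : ℝ) • e := by rw [two_smul]; abel
  rw [h4, norm_smul, he] at h3
  norm_num at h3
  exact ⟨by linarith, by nlinarith⟩

/-- An affine function with values in `[0, 1]` on a ball of radius at least `diam / σ` cannot be
steep. -/
theorem facet_lipschitz (hd : 1 ≤ d) (hM : IsMesh k T G N) {g : E d →ᵃ[ℝ] ℝ} (hg : g ∈ G V)
    (x y : E d) : |g x - g y| ≤ σ / elementDiam V * ‖x - y‖ := by
  obtain ⟨hpos, -⟩ := hR.diam_pos hV hd
  obtain ⟨c, r, hr, hc, hσ⟩ := hR.ball V hV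
  rcases eq_or_ne x y with rfl | hxy
  · simp
  have hn : 0 < ‖x - y‖ := norm_pos_iff.2 (sub_ne_zero.2 hxy)
  have key : ∀ s : ℝ, g (c + s • (x - y)) = g c + s * (g x - g y) := fun s => by
    have := g.map_vadd c (s • (x - y))
    rw [vadd_eq_add, add_comm] at this
    rw [this, map_smul, ← vsub_eq_sub x y, g.linearMap_vsub]
    simp [add_comm]
  set t := r / ‖x - y‖ with ht
  have ht0 : 0 < t := div_pos hr hn
  have hts : t * ‖x - y‖ = r := div_mul_cancel₀ _ hn.ne'
  have hin : ∀ s : ℝ, |s| = t → c + s • (x - y) ∈ cell V := fun s hs => by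
    refine hc ?_
    rw [mem_closedBall_iff_norm, add_sub_cancel_left, norm_smul, Real.norm_eq_abs, hs, hts]
  have h1 := hin t (abs_of_pos ht0)
  have h2 := hin (-t) (by rw [abs_neg, abs_of_pos ht0])
  have S := hM.shape V hV
  have a1 := S.facet_nonneg hg h1
  have a2 := S.facet_le_one hg h1
  have b1 := S.facet_nonneg hg h2
  have b2 := S.facet_le_one hg h2
  rw [key] at a1 a2 b1 b2
  have h3 : t * |g x - g y| ≤ 1 := by
    rcases abs_cases (g x - g y) with ⟨h, -⟩ | ⟨h, -⟩ <;> rw [h] <;> linarith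
  have h4 : |g x - g y| ≤ ‖x - y‖ / r := by
    rw [le_div_iff₀ hr, ← hts]
    nlinarith
  refine h4.trans ?_
  rw [div_mul_eq_mul_div, div_le_div_iff₀ hr hpos]
  nlinarith

theorem volume_ge (hd : 1 ≤ d) :
    (elementDiam V / σ) ^ d * unitBallVolume d ≤ volume.real (cell V) := by
  obtain ⟨hpos, hσ2⟩ := hR.diam_pos hV hd
  obtain ⟨c, r, hr, hc, hσ⟩ := hR.ball V hV
  refine le_trans ?_ (measureReal_mono hc (volume_cell_ne_top V))
  rw [volume_real_closedBall c hr.le]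
  have : elementDiam V / σ ≤ r := by rw [div_le_iff₀ (by linarith)]; linarith
  have h0 : 0 ≤ elementDiam V / σ := div_nonneg hpos.le (by linarith)
  exact mul_le_mul_of_nonneg_right (pow_le_pow_left₀ h0 this d) (unitBallVolume_pos d).le

end IsShapeRegular

/-- A facet shared by two elements has two different vertices if `d ≥ 2`. -/
theorem IsShape.exists_two_facet_vertices {V : Finset (E d)} {H : Finset (E d →ᵃ[ℝ] ℝ)}
    {M : E d → E d → ℝ} (S : IsShape k V H M) (hd : 2 ≤ d) {g : E d →ᵃ[ℝ] ℝ} (hg : g ∈ H) :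
    ∃ u ∈ V, ∃ w ∈ V, u ≠ w ∧ g u = 0 ∧ g w = 0 := by
  obtain ⟨p, hp, hgp⟩ := S.facet_nonempty g hg
  by_contra! hcon
  have honly : ∀ v ∈ V, g v = 0 → v = p := fun v hv hgv => by
    by_contra hne
    exact hcon v hv p hp hne hgv hgp
  have hone : ∀ g' ∈ H, g' ≠ g → g' p = 1 := fun g' hg' hne => by
    obtain ⟨v, hv, h1, h2⟩ := S.facet_sep g hg g' hg' hne.symm
    rwa [honly v hv h1] at h2
  -- For `d ≥ 2` there is a direction along the facet. If `p` were its only vertex, all other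
  -- functionals would be one at `p`, and a small step along `w` would stay in a face whose hull is
  -- just `p`.
  obtain ⟨w, hw, hw0⟩ : ∃ w : E d, w ≠ 0 ∧ g.linear w = 0 := by
    have : LinearMap.ker g.linear ≠ ⊥ := by
      apply LinearMap.ker_ne_bot_of_finrank_lt
      simp; omega
    obtain ⟨w, hw, hw0⟩ := Submodule.exists_mem_ne_zero_of_ne_bot this
    exact ⟨w, hw0, hw⟩
  have hcont : ∀ g' ∈ H, g' ≠ g → ∀ᶠ t in 𝓝 (0 : ℝ), 0 < g' (p + t • w) := fun g' hg' hne => by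
    have h1 : ContinuousAt (fun t : ℝ => g' (p + t • w)) 0 :=
      ((continuous_affine g').comp (by fun_prop)).continuousAt
    refine h1.eventually (lt_mem_nhds ?_)
    simp [hone g' hg' hne]
  have hall : ∀ᶠ t in 𝓝 (0 : ℝ), ∀ g' ∈ H, g' ≠ g → 0 < g' (p + t • w) := by
    rw [eventually_all_finset]
    intro g' hg'
    by_cases hne : g' = g
    · exact Eventually.of_forall fun t h => absurd hne h
    · filter_upwards [hcont g' hg' hne] with t ht _ using ht
  have hg0 : ∀ t : ℝ, g (p + t • w) = 0 := fun t => by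
    have := g.map_vadd p (t • w)
    rw [vadd_eq_add, add_comm] at this
    rw [this, map_smul, hw0, hgp]; simp
  obtain ⟨ε, hε, hball⟩ := Metric.eventually_nhds_iff.1 hall
  have hmem : p + (ε / 2) • w ∈ cell V := by
    rw [S.mem_iff]
    intro g' hg'
    by_cases hne : g' = g
    · rw [hne, hg0]
    · refine (hball ?_ g' hg' hne).le
      rw [Real.dist_eq, sub_zero, abs_of_pos (by linarith)]; linarith
  have hsub : {v ∈ (V : Set (E d)) | M v (p + (ε / 2) • w) ≠ 0} ⊆ {p} := fun v hv =>
    honly v hv.1 ((S.nodal_ne_zero v hv.1 _ hmem).1 hv.2 g hg (hg0 _))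
  have h2 := convexHull_mono hsub (S.mem_convexHull_support hmem)
  rw [convexHull_singleton, mem_singleton_iff, add_eq_left, smul_eq_zero] at h2
  exact h2.elim (fun h => by linarith) hw

namespace IsShapeRegular

/-- For `d ≥ 2` the common facet has two vertices. Some functional of `V` grows from zero to one
between them, and its slope bound puts them at least `diam V / σ` apart; both lie in `V'`. For `d =
1` this is part of the hypothesis. -/
theorem diam_le_of_facetAdj (hR : IsShapeRegular σ T) (hd : 1 ≤ d) (hM : IsMesh k T G N)
    {V V' : Finset (E d)} (hV : V ∈ T) (hV' : V' ∈ T) {p : E d} (h : FacetAdj G p V V') :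
    elementDiam V ≤ σ * elementDiam V' := by
  obtain ⟨g, hg, g', hg', κ, hκ, -, hiff, hp, hgp⟩ := h
  rcases hd.eq_or_lt with h1 | h2
  · exact hR.adjacent h1.symm V hV V' hV' ⟨p, hp, ((hiff p).1 ⟨hp, hgp⟩).1⟩
  obtain ⟨u, hu, w, hw, hne, hgu, hgw⟩ := (hM.shape V hV).exists_two_facet_vertices h2 hg
  obtain ⟨f, hf, hfu, hfw⟩ := (hM.shape V hV).vertex_sep u hu w hw hne
  have hl := hR.facet_lipschitz hV hd hM hf u w
  obtain ⟨hpos, hσ2⟩ := hR.diam_pos hV hd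
  rw [hfu, hfw, div_mul_eq_mul_div, le_div_iff₀ hpos] at hl
  norm_num at hl
  refine hl.trans (mul_le_mul_of_nonneg_left (norm_sub_le_elementDiam ?_ ?_) (by linarith))
  · exact mem_cell_of_mem ((hiff u).1 ⟨hu, hgu⟩).1
  · exact mem_cell_of_mem ((hiff w).1 ⟨hw, hgw⟩).1

-- Packing: shrink every element at `p` towards `p` to the diameter `s` of the smallest one. The
-- copies contain disjoint balls of radius `s / σ` within the ball of radius `s` at `p`.
open Classical in
theorem card_star_le (hR : IsShapeRegular σ T) (hd : 1 ≤ d) (hM : IsMesh k T G N)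
    {V : Finset (E d)} (hV : V ∈ T) (p : E d) :
    ((T.filter (fun V => p ∈ V)).card : ℝ) ≤ σ ^ d := by
  set P := T.filter (fun V => p ∈ V) with hP
  rcases P.eq_empty_or_nonempty with h0 | hne
  · have := (hR.diam_pos hV hd).2
    simp only [h0, Finset.card_empty, Nat.cast_zero]
    positivity
  obtain ⟨V₀, hV₀, hmin⟩ := P.exists_min_image elementDiam hne
  have hPT : ∀ V ∈ P, V ∈ T ∧ p ∈ V := fun V hV => Finset.mem_filter.1 hV
  obtain ⟨hs, hσ⟩ := hR.diam_pos (hPT V₀ hV₀).1 hd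
  set s := elementDiam V₀
  have hσ0 : 0 < σ := by linarith
  have hball : ∀ V ∈ P, ∃ z : E d, Metric.ball z (s / σ) ⊆ cell V ∩ Metric.closedBall p s := by
    intro V hV
    obtain ⟨hVT, hpV⟩ := hPT V hV
    obtain ⟨hpos, -⟩ := hR.diam_pos hVT hd
    obtain ⟨c, r, hr, hc, hcr⟩ := hR.ball V hVT
    set t := s / elementDiam V with ht
    have ht0 : 0 < t := div_pos hs hpos
    have ht1 : t ≤ 1 := (div_le_one hpos).2 (hmin V hV)
    have hth : t * elementDiam V = s := div_mul_cancel₀ _ hpos.ne'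
    refine ⟨p + t • (c - p), fun x hx => ?_⟩
    set y := p + t⁻¹ • (x - p) with hy
    have hxy : x = p + t • (y - p) := by
      rw [hy, add_sub_cancel_left, smul_smul, mul_inv_cancel₀ ht0.ne', one_smul]; abel
    have hyc : y ∈ cell V := by
      refine hc ?_
      rw [mem_closedBall_iff_norm]
      rw [mem_ball_iff_norm, hxy, show p + t • (y - p) - (p + t • (c - p)) = t • (y - c) by
        simp only [smul_sub]; abel, norm_smul, Real.norm_of_nonneg ht0.le, lt_div_iff₀ hσ0,
        ← hth, mul_assoc] at hx
      have := lt_of_mul_lt_mul_left hx ht0.le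
      nlinarith
    refine ⟨?_, ?_⟩
    · rw [hxy]
      exact (convex_convexHull ℝ _).add_smul_sub_mem (mem_cell_of_mem hpV) hyc ⟨ht0.le, ht1⟩
    · rw [mem_closedBall_iff_norm, hxy, add_sub_cancel_left, norm_smul, Real.norm_of_nonneg ht0.le,
        ← hth]
      exact mul_le_mul_of_nonneg_left (norm_sub_le_elementDiam hyc (mem_cell_of_mem hpV)) ht0.le
  choose! z hz using hball
  have hdisj : (P : Set (Finset (E d))).PairwiseDisjoint (fun V => Metric.ball (z V) (s / σ)) := by
    intro V hV V' hV' hne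
    refine disjoint_left.2 fun x hx hx' => hne ?_
    exact hM.eq_of_mem_interior (hPT V hV).1 (hPT V' hV').1
      (interior_maximal ((hz V hV).trans inter_subset_left) Metric.isOpen_ball hx)
      ((hz V' hV' hx').1)
  have hvol := measureReal_biUnion_finset (μ := volume) hdisj (fun V _ => measurableSet_ball)
    (fun V _ => measure_ball_lt_top.ne)
  have hle : volume.real (⋃ V ∈ P, Metric.ball (z V) (s / σ)) ≤
      volume.real (Metric.closedBall p s) :=
    measureReal_mono (iUnion₂_subset fun V hV => (hz V hV).trans inter_subset_right)
      measure_closedBall_lt_top.ne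
  rw [hvol, volume_real_closedBall _ hs.le,
    Finset.sum_congr rfl fun V _ => volume_real_ball (z V) (div_pos hs hσ0),
    Finset.sum_const, nsmul_eq_mul, ← mul_assoc] at hle
  have h3 := le_of_mul_le_mul_right hle (unitBallVolume_pos d)
  rw [div_pow, ← mul_div_assoc, div_le_iff₀ (by positivity), mul_comm] at h3
  exact le_of_mul_le_mul_left h3 (by positivity)

end IsShapeRegular

end OCP

end

/-! ### Mean values on neighbouring elements and at the boundary. -/

noncomputable section

namespace OCP

variable {d : ℕ} {Ω : Set (E d)} {k : ElementKind} {T : Finset (Finset (E d))}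
  {G : Finset (E d) → Finset (E d →ᵃ[ℝ] ℝ)} {N : Finset (E d) → E d → E d → ℝ} {σ : ℝ}

theorem affine_sum_smul (g : E d →ᵃ[ℝ] ℝ) {F : Finset (E d)} {w : E d → ℝ} (hw : ∑ v ∈ F, w v = 1) :
    g (∑ v ∈ F, w v • v) = ∑ v ∈ F, w v * g v := by
  have h : ∀ x, g x = g.linear x + g 0 := fun x => congrFun g.decomp x
  have h2 : ∀ v ∈ F, w v * g v = g.linear (w v • v) + w v * g 0 := fun v _ => by
    rw [h v, map_smul, smul_eq_mul, mul_add]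
  rw [h, map_sum, Finset.sum_congr rfl h2, Finset.sum_add_distrib, ← Finset.sum_mul, hw, one_mul]

/-- The centroid of a finite set of points. -/
def barycenter (F : Finset (E d)) : E d := ∑ v ∈ F, (F.card : ℝ)⁻¹ • v

theorem affine_barycenter (g : E d →ᵃ[ℝ] ℝ) {F : Finset (E d)} (hF : F.Nonempty) :
    g (barycenter F) = (F.card : ℝ)⁻¹ * ∑ v ∈ F, g v := by
  have h0 : (F.card : ℝ) ≠ 0 := by exact_mod_cast hF.card_ne_zero
  rw [barycenter, affine_sum_smul g, Finset.mul_sum]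
  rw [Finset.sum_const, nsmul_eq_mul, mul_inv_cancel₀ h0]

/-- Every other functional is one at some vertex of the facet, which has at most `2 ^ d` vertices,
so it is at least `1 / 2 ^ d` at the barycenter and stays nonnegative within distance `ρ`. -/
theorem IsShape.half_ball_subset {V : Finset (E d)} {H : Finset (E d →ᵃ[ℝ] ℝ)} {M : E d → E d → ℝ}
    (S : IsShape k V H M) {g : E d →ᵃ[ℝ] ℝ} (hg : g ∈ H) {F : Finset (E d)}
    (hF : ∀ v, v ∈ F ↔ v ∈ V ∧ g v = 0) {ℓ ρ : ℝ} (hℓ0 : 0 ≤ ℓ)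
    (hℓ : ∀ g ∈ H, ∀ x y, |g x - g y| ≤ ℓ * ‖x - y‖) (hρ : ℓ * ρ ≤ 1 / 2 ^ d) :
    Metric.closedBall (barycenter F) ρ ∩ {x | 0 ≤ g x} ⊆ cell V := by
  rintro x ⟨hx, hgx⟩
  rw [S.mem_iff]
  intro g' hg'
  by_cases hne : g = g'
  · exact hne ▸ hgx
  obtain ⟨v, hv, h0, h1⟩ := S.facet_sep g hg g' hg' hne
  have hvF : v ∈ F := (hF v).2 ⟨hv, h0⟩
  have hcard : (F.card : ℝ) ≤ 2 ^ d := by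
    exact_mod_cast (Finset.card_le_card fun u hu => ((hF u).1 hu).1).trans S.card_le
  have hpos : (0 : ℝ) < F.card := by exact_mod_cast Finset.card_pos.2 ⟨v, hvF⟩
  have hsum : 1 ≤ ∑ u ∈ F, g' u := by
    rw [← h1]
    exact Finset.single_le_sum (f := fun u => g' u)
      (fun u hu => S.facet_nonneg hg' (mem_cell_of_mem ((hF u).1 hu).1)) hvF
  have hc : 1 / 2 ^ d ≤ g' (barycenter F) := by
    rw [affine_barycenter g' ⟨v, hvF⟩, one_div]
    refine (inv_anti₀ hpos hcard).trans ?_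
    exact le_mul_of_one_le_right (inv_nonneg.2 hpos.le) hsum
  have hd := hℓ g' hg' (barycenter F) x
  rw [mem_closedBall_iff_norm'] at hx
  have := (le_abs_self _).trans (hd.trans (mul_le_mul_of_nonneg_left hx hℓ0))
  linarith

/-- Reflection in `c` exchanges the two open halves, and the hyperplane is null. -/
theorem volume_ball_le_two_mul (g : E d →ᵃ[ℝ] ℝ) {c x : E d} (hc : g c = 0) (hx : g x ≠ 0) (ρ : ℝ) :
    volume.real (Metric.closedBall c ρ) ≤ 2 * volume.real (Metric.closedBall c ρ ∩ {x | 0 ≤ g x}) ∧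
    volume.real (Metric.closedBall c ρ) ≤ 2 * volume.real (Metric.closedBall c ρ ∩ {x | g x < 0}) := by
  set B := Metric.closedBall c ρ with hB
  have hfin : ∀ S : Set (E d), volume (B ∩ S) ≠ ⊤ := fun S =>
    measure_ne_top_of_subset inter_subset_left measure_closedBall_lt_top.ne
  have hrefl : ∀ y, g (c + c - y) = -g y := fun y => by
    rw [add_sub_assoc, affine_translate g c y c, hc]; ring
  have hms : MeasurableSet {x | g x < 0} := measurableSet_lt (continuous_affine g).measurable
    measurable_const
  have hmp : MeasurePreserving (fun y : E d => c + c - y) volume volume :=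
    Measure.measurePreserving_sub_left volume (c + c)
  have hpre : (fun y : E d => c + c - y) ⁻¹' (B ∩ {x | g x < 0}) = B ∩ {x | 0 < g x} := by
    ext y
    simp only [mem_preimage, mem_inter_iff, hB, mem_closedBall_iff_norm, mem_ofPred_eq, hrefl,
      neg_lt_zero]
    rw [show c + c - y - c = -(y - c) by abel, norm_neg]
  have heq : volume.real (B ∩ {x | 0 < g x}) = volume.real (B ∩ {x | g x < 0}) := by
    rw [measureReal_def, measureReal_def, ← hpre,
      hmp.measure_preimage (Metric.isClosed_closedBall.measurableSet.inter hms).nullMeasurableSet]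
  have hz : volume.real (B ∩ {x | g x = 0}) = 0 := by
    rw [measureReal_def, measure_mono_null inter_subset_right (volume_affine_eq_zero g hx)]; rfl
  have h1 : volume.real B ≤ volume.real (B ∩ {x | 0 ≤ g x}) + volume.real (B ∩ {x | g x < 0}) := by
    refine (measureReal_mono (fun y hy => ?_) ?_).trans (measureReal_union_le _ _)
    · rcases lt_or_ge (g y) 0 with h | h
      · exact Or.inr ⟨hy, h⟩
      · exact Or.inl ⟨hy, h⟩
    · exact measure_union_ne_top (hfin _) (hfin _)
  have h2 : volume.real (B ∩ {x | 0 ≤ g x}) ≤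
      volume.real (B ∩ {x | 0 < g x}) + volume.real (B ∩ {x | g x = 0}) := by
    refine (measureReal_mono (fun y hy => ?_) ?_).trans (measureReal_union_le _ _)
    · rcases (show 0 ≤ g y from hy.2).eq_or_lt with h | h
      · exact Or.inr ⟨hy.1, h.symm⟩
      · exact Or.inl ⟨hy.1, h⟩
    · exact measure_union_ne_top (hfin _) (hfin _)
  have h3 : volume.real (B ∩ {x | 0 < g x}) ≤ volume.real (B ∩ {x | 0 ≤ g x}) :=
    measureReal_mono (fun y hy => ⟨hy.1, (show 0 < g y from hy.2).le⟩) (hfin _)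
  constructor <;> linarith

theorem volume_ne_zero_of_real_pos {K : Set (E d)} (h : 0 < volume.real K) : volume K ≠ 0 := by
  intro h0
  rw [measureReal_def, h0] at h
  simp at h

/-- The mean value of `v` on the element with vertex set `V`. -/
def cellMean (V : Finset (E d)) (v : H10 Ω) : ℝ := ⨍ y in cell V, toL2 v y

/-- The Dirichlet energy of `v` on the element with vertex set `V`. -/
def cellEnergy (V : Finset (E d)) (v : H10 Ω) : ℝ := energyOn (cell V) (weakGrad v)

theorem cellEnergy_nonneg (V : Finset (E d)) (v : H10 Ω) : 0 ≤ cellEnergy V v := energyOn_nonneg _ _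

theorem energyOn_mono {F : Type*} [NormedAddCommGroup F] {f : E d → F} {A B : Set (E d)} (h : A ⊆ B)
    (hf : MemLp f 2 (volume.restrict B)) : energyOn A f ≤ energyOn B f :=
  setIntegral_mono_set (hf.integrable_norm_pow (by norm_num)) (ae_of_all _ fun x => by positivity)
    h.eventuallyLE

theorem energyOn_union_le {F : Type*} [NormedAddCommGroup F] {f : E d → F} {A B : Set (E d)}
    (hA : MeasurableSet A) (hB : MeasurableSet B) (hf : MemLp f 2 (volume.restrict A))
    (hg : MemLp f 2 (volume.restrict B)) : energyOn (A ∪ B) f ≤ energyOn A f + energyOn B f := by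
  have h1 : IntegrableOn (fun x => ‖f x‖ ^ 2) A := hf.integrable_norm_pow (p := 2) (by norm_num)
  have h2 : IntegrableOn (fun x => ‖f x‖ ^ 2) B := hg.integrable_norm_pow (p := 2) (by norm_num)
  rw [energyOn, ← union_sdiff_self, setIntegral_union disjoint_sdiff_right (hB.diff hA) h1
    (h2.mono_set sdiff_subset)]
  exact add_le_add_right (energyOn_mono sdiff_subset hg) _

theorem IsEssentialSubset.mono {K K' : Set (E d)} (h : IsEssentialSubset K Ω) (hK : K' ⊆ K)
    (hm : MeasurableSet K') : IsEssentialSubset K' Ω :=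
  ⟨hm, measure_mono_null (sdiff_subset_sdiff_left hK) h.null⟩

theorem IsEssentialSubset.union {K K' : Set (E d)} (h : IsEssentialSubset K Ω)
    (h' : IsEssentialSubset K' Ω) : IsEssentialSubset (K ∪ K') Ω :=
  ⟨h.measurableSet.union h'.measurableSet, by
    rw [union_sdiff_distrib]; exact measure_union_null h.null h'.null⟩

/-- The constant in the comparison of mean values on elements with diameters in `[s, D]`. -/
def meanConst (d : ℕ) (σ s D : ℝ) : ℝ :=
  2 ^ (d + 2) * D ^ 2 / ((s / (σ * 2 ^ d)) ^ d * unitBallVolume d)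

theorem sq_le_of_mul_le {m a b c e X : ℝ} (hX : X ≤ 2 * a) (hX0 : 0 < X) (hb : 0 < b)
    (h : m ^ 2 * (b * a) ≤ c * b * e) : m ^ 2 ≤ 2 * c / X * e := by
  have h1 : m ^ 2 * a ≤ c * e := by
    refine le_of_mul_le_mul_right ?_ hb
    nlinarith
  rw [div_mul_eq_mul_div, le_div_iff₀ hX0]
  nlinarith [sq_nonneg m]

theorem IsShapeRegular.facet_lipschitz_radius (hR : IsShapeRegular σ T) (hd : 1 ≤ d) {V : Finset (E d)}
    (hV : V ∈ T) {s : ℝ} (hsV : s ≤ elementDiam V) :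
    σ / elementDiam V * (s / (σ * 2 ^ d)) ≤ 1 / 2 ^ d := by
  obtain ⟨hpos, hσ⟩ := hR.diam_pos hV hd
  have h0 : 0 < σ := by linarith
  rw [div_mul_div_comm, div_le_div_iff₀ (by positivity) (by positivity)]
  have : (0 : ℝ) < 2 ^ d := by positivity
  nlinarith [mul_le_mul_of_nonneg_left hsV (mul_pos h0 this).le]

section Compare

variable (hT : IsTriangulation k Ω T) (hint : interior (closure Ω) = Ω)
include hT hint

/-- A piece of an element with volume at least half of a ball has almost the same mean value. -/
theorem sq_cellMean_sub_average_le {V : Finset (E d)} (hV : V ∈ T) {A : Set (E d)}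
    (hA : A ⊆ cell V) (hAm : MeasurableSet A) {X D : ℝ} (hX : 0 < X)
    (hXA : X ≤ 2 * volume.real A) (hD0 : 0 ≤ D) (hD : elementDiam V ≤ D) (v : H10 Ω) :
    (cellMean V v - ⨍ y in A, toL2 v y) ^ 2 ≤ 2 ^ (d + 1) * D ^ 2 / X * cellEnergy V v := by
  have hA0 : 0 < volume.real A := by linarith
  have hV0 : 0 < volume.real (cell V) :=
    hA0.trans_le (measureReal_mono hA (volume_cell_ne_top V))
  have h := H10.sq_average_sub_average_le (hT.isEssentialSubset hint hV)
    (convex_convexHull ℝ _) subset_rfl hA (measurableSet_cell V) hAm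
    (volume_ne_zero_of_real_pos hV0) (volume_ne_zero_of_real_pos hA0) (volume_cell_ne_top V)
    hD0 (fun x hx y hy => (norm_sub_le_elementDiam hx hy).trans hD) v
  refine (sq_le_of_mul_le hXA hX hV0 h).trans_eq ?_
  rw [cellEnergy, pow_succ]; ring

/-- The mean values on two halves of a ball. -/
theorem sq_average_sub_average_half_ball_le {V V' : Finset (E d)} (hV : V ∈ T) (hV' : V' ∈ T)
    {c : E d} {ρ : ℝ} (hρ : 0 < ρ) {A B : Set (E d)} (hA : A ⊆ cell V) (hB : B ⊆ cell V')
    (hAm : MeasurableSet A) (hBm : MeasurableSet B) (hAB : A ∪ B = Metric.closedBall c ρ)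
    (hXA : volume.real (Metric.closedBall c ρ) ≤ 2 * volume.real A)
    (hXB : volume.real (Metric.closedBall c ρ) ≤ 2 * volume.real B) (v : H10 Ω) :
    ((⨍ y in A, toL2 v y) - ⨍ y in B, toL2 v y) ^ 2 ≤
      2 ^ (d + 4) * ρ ^ 2 / (ρ ^ d * unitBallVolume d) * (cellEnergy V v + cellEnergy V' v) := by
  have hXeq := volume_real_closedBall c hρ.le
  set X := volume.real (Metric.closedBall c ρ) with hXdef
  have hX : 0 < X := by rw [hXeq]; exact mul_pos (pow_pos hρ d) (unitBallVolume_pos d)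
  have hA0 : 0 < volume.real A := by linarith
  have hB0 : 0 < volume.real B := by linarith
  have eA := (hT.isEssentialSubset hint hV).mono hA hAm
  have eB := (hT.isEssentialSubset hint hV').mono hB hBm
  have hball : IsEssentialSubset (Metric.closedBall c ρ) Ω := hAB ▸ eA.union eB
  have h := H10.sq_average_sub_average_le hball (convex_closedBall c ρ)
    (hAB ▸ subset_union_left) (hAB ▸ subset_union_right) hAm hBm
    (volume_ne_zero_of_real_pos hA0) (volume_ne_zero_of_real_pos hB0) measure_closedBall_lt_top.ne
    (D := 2 * ρ) (by positivity) (fun x hx y hy => by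
      rw [mem_closedBall_iff_norm] at hx hy
      calc ‖x - y‖ = ‖(x - c) - (y - c)‖ := by rw [sub_sub_sub_cancel_right]
        _ ≤ ‖x - c‖ + ‖y - c‖ := norm_sub_le _ _
        _ ≤ 2 * ρ := by linarith) v
  have hen : energyOn (Metric.closedBall c ρ) (weakGrad v) ≤ cellEnergy V v + cellEnergy V' v := by
    rw [← hAB]
    refine (energyOn_union_le hAm hBm (eA.memLp _) (eB.memLp _)).trans (add_le_add ?_ ?_)
    · exact energyOn_mono hA ((hT.isEssentialSubset hint hV).memLp _)
    · exact energyOn_mono hB ((hT.isEssentialSubset hint hV').memLp _)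
  set m := (⨍ y in A, toL2 v y) - ⨍ y in B, toL2 v y
  set e := energyOn (Metric.closedBall c ρ) (weakGrad v)
  have h1 : X * X ≤ 4 * (volume.real A * volume.real B) := by nlinarith
  have h2 : m ^ 2 * X ≤ 4 * (2 ^ d * (2 * ρ) ^ 2) * e := by
    refine le_of_mul_le_mul_right ?_ hX
    nlinarith [sq_nonneg m]
  rw [← hXeq, div_mul_eq_mul_div, le_div_iff₀ hX]
  refine h2.trans ?_
  have h3 : 4 * (2 ^ d * (2 * ρ) ^ 2) * e = 2 ^ (d + 4) * ρ ^ 2 * e := by ring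
  rw [h3]
  exact mul_le_mul_of_nonneg_left hen (by positivity)

/-- The union of two elements need not be convex, but a small ball centred on their common facet
lies in it. The means are linked through its two halves: inside `V`, across the ball, inside `V'`.
-/
theorem sq_cellMean_sub_cellMean_le (hR : IsShapeRegular σ T) (hd : 1 ≤ d) (hM : IsMesh k T G N)
    {V V' : Finset (E d)} (hV : V ∈ T) (hV' : V' ∈ T) {p : E d} (h : FacetAdj G p V V') {s D : ℝ}
    (hs : 0 < s) (hsV : s ≤ elementDiam V) (hsV' : s ≤ elementDiam V') (hD : elementDiam V ≤ D)
    (hD' : elementDiam V' ≤ D) (v : H10 Ω) :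
    (cellMean V v - cellMean V' v) ^ 2 ≤
      9 * (meanConst d σ s D * (cellEnergy V v + cellEnergy V' v)) := by
  classical
  obtain ⟨g, hg, g', hg', κ, hκ, hgg, hiff, -⟩ := h
  obtain ⟨hpos, hσ⟩ := hR.diam_pos hV hd
  have h0 : 0 < σ := by linarith
  set ρ := s / (σ * 2 ^ d) with hρdef
  have hρ : 0 < ρ := by positivity
  set F := V.filter fun v => g v = 0 with hFdef
  have hF : ∀ v, v ∈ F ↔ v ∈ V ∧ g v = 0 := fun v => Finset.mem_filter
  have hF' : ∀ v, v ∈ F ↔ v ∈ V' ∧ g' v = 0 := fun v => (hF v).trans (hiff v)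
  have hc : g (barycenter F) = 0 := by
    obtain ⟨u, hu, hgu⟩ := (hM.shape V hV).facet_nonempty g hg
    rw [affine_barycenter g ⟨u, (hF u).2 ⟨hu, hgu⟩⟩,
      Finset.sum_eq_zero fun v hv => ((hF v).1 hv).2, mul_zero]
  obtain ⟨u, -, hu1⟩ := (hM.shape V hV).exists_eq_one g hg
  have hnz : g u ≠ 0 := by rw [hu1]; exact one_ne_zero
  set B := Metric.closedBall (barycenter F) ρ with hBdef
  have hA : B ∩ {x | 0 ≤ g x} ⊆ cell V := (hM.shape V hV).half_ball_subset hg hF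
    (div_nonneg h0.le (elementDiam_nonneg V)) (fun g hg => hR.facet_lipschitz hV hd hM hg)
    (hR.facet_lipschitz_radius hd hV hsV)
  have hB : B ∩ {x | g x ≤ 0} ⊆ cell V' := by
    have hsub := (hM.shape V' hV').half_ball_subset hg' hF'
      (div_nonneg h0.le (elementDiam_nonneg V')) (fun g hg => hR.facet_lipschitz hV' hd hM hg)
      (hR.facet_lipschitz_radius hd hV' hsV')
    refine fun x hx => hsub ⟨hx.1, ?_⟩
    have : g x ≤ 0 := hx.2
    change 0 ≤ g' x
    rw [hgg]; nlinarith
  have hAm : MeasurableSet (B ∩ {x | 0 ≤ g x}) := Metric.isClosed_closedBall.measurableSet.inter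
    (measurableSet_le measurable_const (continuous_affine g).measurable)
  have hBm : MeasurableSet (B ∩ {x | g x ≤ 0}) := Metric.isClosed_closedBall.measurableSet.inter
    (measurableSet_le (continuous_affine g).measurable measurable_const)
  have hAB : (B ∩ {x | 0 ≤ g x}) ∪ (B ∩ {x | g x ≤ 0}) = B := by
    rw [← inter_union_distrib_left, inter_eq_left]
    exact fun x _ => (le_total 0 (g x)).imp id id
  obtain ⟨hXA, hXB⟩ := volume_ball_le_two_mul g hc hnz ρ
  have hXB' : volume.real B ≤ 2 * volume.real (B ∩ {x | g x ≤ 0}) :=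
    hXB.trans (mul_le_mul_of_nonneg_left (measureReal_mono
      (inter_subset_inter_right B fun x hx => (show g x < 0 from hx).le)
      (measure_ne_top_of_subset inter_subset_left measure_closedBall_lt_top.ne)) (by norm_num))
  have hXeq : volume.real B = ρ ^ d * unitBallVolume d := volume_real_closedBall _ hρ.le
  have hX : 0 < ρ ^ d * unitBallVolume d := mul_pos (pow_pos hρ d) (unitBallVolume_pos d)
  have hD0 : 0 ≤ D := hpos.le.trans hD
  have e1 := sq_cellMean_sub_average_le hT hint hV hA hAm hX (hXeq ▸ hXA) hD0 hD v
  have e2 := sq_cellMean_sub_average_le hT hint hV' hB hBm hX (hXeq ▸ hXB') hD0 hD' v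
  have e3 := sq_average_sub_average_half_ball_le hT hint hV hV' hρ hA hB hAm hBm hAB hXA hXB' v
  have hV0 := cellEnergy_nonneg V v
  have hV0' := cellEnergy_nonneg V' v
  have hc1 : 2 ^ (d + 1) * D ^ 2 / (ρ ^ d * unitBallVolume d) ≤ meanConst d σ s D := by
    rw [meanConst, ← hρdef]
    gcongr <;> norm_num
  have hc2 : 2 ^ (d + 4) * ρ ^ 2 / (ρ ^ d * unitBallVolume d) ≤ meanConst d σ s D := by
    rw [meanConst, ← hρdef]
    refine div_le_div_of_nonneg_right ?_ hX.le
    have : 2 * ρ ≤ D := by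
      have h1 : ρ * (σ * 2 ^ d) = s := div_mul_cancel₀ _ (by positivity)
      have h2 : (1 : ℝ) ≤ 2 ^ d := one_le_pow₀ (by norm_num)
      have h3 : 2 ≤ σ * 2 ^ d := by nlinarith
      nlinarith
    have h4 : (2 * ρ) ^ 2 ≤ D ^ 2 := pow_le_pow_left₀ (by positivity) this 2
    calc (2 : ℝ) ^ (d + 4) * ρ ^ 2 = 2 ^ (d + 2) * (2 * ρ) ^ 2 := by ring
      _ ≤ _ := mul_le_mul_of_nonneg_left h4 (by positivity)
  have hm0 : 0 ≤ meanConst d σ s D := le_trans (by positivity) hc2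
  have f1 := e1.trans (mul_le_mul_of_nonneg_right hc1 hV0)
  have f2 := e2.trans (mul_le_mul_of_nonneg_right hc1 hV0')
  have f3 := e3.trans (mul_le_mul_of_nonneg_right hc2 (add_nonneg hV0 hV0'))
  set a := cellMean V v
  set a' := cellMean V' v
  set b := ⨍ y in B ∩ {x | 0 ≤ g x}, toL2 v y
  set b' := ⨍ y in B ∩ {x | g x ≤ 0}, toL2 v y
  have g1 := mul_nonneg hm0 hV0
  have g2 := mul_nonneg hm0 hV0'
  -- The square of a sum of three terms is at most three times the sum of their squares. This gives
  -- the factor 6; 9 is used because it is a square.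
  nlinarith [sq_nonneg ((a - b) - (b - b')), sq_nonneg ((a - b) - (b' - a')),
    sq_nonneg ((b - b') - (b' - a'))]

/-- The same ball at a boundary facet, with `v` replaced by zero on the outer half. What `Ω` looks
like beyond the facet plays no role. -/
theorem sq_cellMean_le_of_boundary (hR : IsShapeRegular σ T) (hd : 1 ≤ d) (hM : IsMesh k T G N)
    {V : Finset (E d)} (hV : V ∈ T) {g : E d →ᵃ[ℝ] ℝ} (hg : g ∈ G V)
    (hΩ : ∀ z ∈ cell V, g z = 0 → z ∉ Ω) {s D : ℝ} (hs : 0 < s) (hsV : s ≤ elementDiam V)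
    (hD : elementDiam V ≤ D) (v : H10 Ω) :
    cellMean V v ^ 2 ≤ 9 * (meanConst d σ s D * cellEnergy V v) := by
  classical
  obtain ⟨hpos, hσ⟩ := hR.diam_pos hV hd
  have h0 : 0 < σ := by linarith
  set ρ := s / (σ * 2 ^ d) with hρdef
  have hρ : 0 < ρ := by positivity
  set F := V.filter fun v => g v = 0 with hFdef
  have hF : ∀ v, v ∈ F ↔ v ∈ V ∧ g v = 0 := fun v => Finset.mem_filter
  have hc : g (barycenter F) = 0 := by
    obtain ⟨u, hu, hgu⟩ := (hM.shape V hV).facet_nonempty g hg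
    rw [affine_barycenter g ⟨u, (hF u).2 ⟨hu, hgu⟩⟩,
      Finset.sum_eq_zero fun v hv => ((hF v).1 hv).2, mul_zero]
  obtain ⟨u, -, hu1⟩ := (hM.shape V hV).exists_eq_one g hg
  have hnz : g u ≠ 0 := by rw [hu1]; exact one_ne_zero
  set B := Metric.closedBall (barycenter F) ρ with hBdef
  have hA : B ∩ {x | 0 ≤ g x} ⊆ cell V := (hM.shape V hV).half_ball_subset hg hF
    (div_nonneg h0.le (elementDiam_nonneg V)) (fun g hg => hR.facet_lipschitz hV hd hM hg)
    (hR.facet_lipschitz_radius hd hV hsV)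
  have hBm : MeasurableSet B := Metric.isClosed_closedBall.measurableSet
  have hAm : MeasurableSet (B ∩ {x | 0 ≤ g x}) := hBm.inter
    (measurableSet_le measurable_const (continuous_affine g).measurable)
  obtain ⟨hXA, hXB⟩ := volume_ball_le_two_mul g hc hnz ρ
  have hXeq : volume.real B = ρ ^ d * unitBallVolume d := volume_real_closedBall _ hρ.le
  have hX : 0 < ρ ^ d * unitBallVolume d := mul_pos (pow_pos hρ d) (unitBallVolume_pos d)
  have hD0 : 0 ≤ D := hpos.le.trans hD
  have e1 := sq_cellMean_sub_average_le hT hint hV hA hAm hX (hXeq ▸ hXA) hD0 hD v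
  have hA0 : 0 < volume.real (B ∩ {x | 0 ≤ g x}) := by
    rw [← hBdef, hXeq] at hXA; linarith
  have hB0 : 0 < volume.real (B ∩ {x | g x < 0}) := by
    rw [← hBdef, hXeq] at hXB; linarith
  have eV := hT.isEssentialSubset hint hV
  have e2 := H10.sq_average_le_of_boundary hBm (convex_closedBall _ ρ) g (eV.mono hA hAm)
    (fun x hx hgx => hΩ x (hA ⟨hx, hgx.ge⟩) hgx) (volume_ne_zero_of_real_pos hA0)
    (volume_ne_zero_of_real_pos hB0) measure_closedBall_lt_top.ne
    (D := 2 * ρ) (by positivity) (fun x hx y hy => by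
      rw [hBdef, mem_closedBall_iff_norm] at hx hy
      calc ‖x - y‖ = ‖(x - barycenter F) - (y - barycenter F)‖ := by rw [sub_sub_sub_cancel_right]
        _ ≤ ‖x - barycenter F‖ + ‖y - barycenter F‖ := norm_sub_le _ _
        _ ≤ 2 * ρ := by linarith) v
  have hen : energyOn (B ∩ {x | 0 ≤ g x}) (weakGrad v) ≤ cellEnergy V v :=
    energyOn_mono hA (eV.memLp _)
  rw [← hBdef, hXeq] at hXA hXB
  rw [hXeq] at e2
  have hV0 := cellEnergy_nonneg V v
  set X := ρ ^ d * unitBallVolume d with hXdef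
  set b := ⨍ y in B ∩ {x | 0 ≤ g x}, toL2 v y
  set e := energyOn (B ∩ {x | 0 ≤ g x}) (weakGrad v)
  have hDρ : 2 * ρ ≤ D := by
    have h1 : ρ * (σ * 2 ^ d) = s := div_mul_cancel₀ _ (by positivity)
    have h2 : (1 : ℝ) ≤ 2 ^ d := one_le_pow₀ (by norm_num)
    have h3 : 2 ≤ σ * 2 ^ d := by nlinarith
    nlinarith
  have h4 : (2 * ρ) ^ 2 ≤ D ^ 2 := pow_le_pow_left₀ (by positivity) hDρ 2
  have h1 : X * X ≤ 4 * (volume.real (B ∩ {x | 0 ≤ g x}) * volume.real (B ∩ {x | g x < 0})) := by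
    nlinarith
  have h2 : b ^ 2 * X ≤ 4 * (2 ^ d * (2 * ρ) ^ 2) * e := by
    refine le_of_mul_le_mul_right ?_ hX
    nlinarith [sq_nonneg b]
  have h3 : b ^ 2 ≤ meanConst d σ s D * cellEnergy V v := by
    rw [meanConst, ← hρdef, ← hXdef, div_mul_eq_mul_div, le_div_iff₀ hX]
    refine h2.trans ?_
    have h5 : 4 * (2 ^ d * (2 * ρ) ^ 2) * e = 2 ^ (d + 2) * (2 * ρ) ^ 2 * e := by ring
    rw [h5]
    have he : 0 ≤ e := energyOn_nonneg _ _
    gcongr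
  have hc1 : 2 ^ (d + 1) * D ^ 2 / X ≤ meanConst d σ s D := by
    rw [meanConst, ← hρdef, ← hXdef]
    gcongr <;> norm_num
  have f1 := e1.trans (mul_le_mul_of_nonneg_right hc1 hV0)
  have g1 : 0 ≤ meanConst d σ s D * cellEnergy V v := (sq_nonneg b).trans h3
  nlinarith [sq_nonneg (cellMean V v - b - b)]

/-- Inverse estimate for the polynomial `q - mean`, whose `L₂` norm is at most that of `v - mean`,
then the Poincaré inequality. -/
theorem sq_localProjection_sub_cellMean_le (hR : IsShapeRegular σ T) (hd : 1 ≤ d)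
    (hM : IsMesh k T G N) {V : Finset (E d)} (hV : V ∈ T) {s D : ℝ} (hs : 0 < s)
    (hsV : s ≤ elementDiam V) (hD : elementDiam V ≤ D) {v : H10 Ω} {q : E d → ℝ}
    (hq : IsLocalProjection k V v q) {p : E d} (hp : p ∈ V) :
    (q p - cellMean V v) ^ 2 ≤ (inverseConst d)⁻¹ * (meanConst d σ s D * cellEnergy V v) := by
  obtain ⟨hpos, hσ⟩ := hR.diam_pos hV hd
  have h0 : 0 < σ := by linarith
  set ρ := s / (σ * 2 ^ d) with hρdef
  have hρ : 0 < ρ := by positivity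
  have eV := hT.isEssentialSubset hint hV
  have hvol : ρ ^ d * unitBallVolume d ≤ volume.real (cell V) := by
    refine le_trans ?_ (hR.volume_ge hV hd)
    refine mul_le_mul_of_nonneg_right (pow_le_pow_left₀ hρ.le ?_ d) (unitBallVolume_pos d).le
    rw [hρdef]
    have h2 : (1 : ℝ) ≤ 2 ^ d := one_le_pow₀ (by norm_num)
    exact div_le_div₀ hpos.le hsV h0 (by nlinarith)
  have hX : 0 < ρ ^ d * unitBallVolume d := mul_pos (pow_pos hρ d) (unitBallVolume_pos d)
  have hconst : (fun _ => cellMean V v : E d → ℝ) ∈ localPoly d k := const_mem_localPoly k _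
  have h1 := (hM.shape V hV).inverse_estimate hd (sub_mem hq.1 hconst) hp
  have h2 := hq.energyOn_sub_le eV hconst
  have h3 := H10.energyOn_sub_average_le eV (convex_convexHull ℝ _)
    (volume_ne_zero_of_real_pos (hX.trans_le hvol)) (volume_cell_ne_top V) (hpos.le.trans hD)
    (fun x hx y hy => (norm_sub_le_elementDiam hx hy).trans hD) v
  have h4 : (q p - cellMean V v) ^ 2 * (inverseConst d * volume.real (cell V)) ≤
      2 ^ d * D ^ 2 * cellEnergy V v := h1.trans (h2.trans h3)
  have hi := inverseConst_pos hd
  have hV0 := cellEnergy_nonneg V v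
  rw [inv_mul_eq_div, le_div_iff₀ hi, meanConst, ← hρdef, div_mul_eq_mul_div, le_div_iff₀ hX]
  calc (q p - cellMean V v) ^ 2 * inverseConst d * (ρ ^ d * unitBallVolume d)
      ≤ (q p - cellMean V v) ^ 2 * inverseConst d * volume.real (cell V) :=
        mul_le_mul_of_nonneg_left hvol (by positivity)
    _ ≤ 2 ^ d * D ^ 2 * cellEnergy V v := by rw [mul_assoc]; exact h4
    _ ≤ 2 ^ (d + 2) * D ^ 2 * cellEnergy V v := by
        gcongr <;> norm_num

end Compare

end OCP

end

/-! ### Nodal values of the quasi-interpolant. -/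

noncomputable section

namespace OCP

variable {d : ℕ} {Ω : Set (E d)} {k : ElementKind} {T : Finset (Finset (E d))}
  {G : Finset (E d) → Finset (E d →ᵃ[ℝ] ℝ)} {N : Finset (E d) → E d → E d → ℝ} {σ : ℝ}

/-- Induction on the distance from `a` for a relation on a finite set. -/
theorem reflTransGen_induction_card {ι : Type*} (P : Finset ι) {r : ι → ι → Prop}
    (hr : ∀ x y, r x y → y ∈ P) {a b : ι} (ha : a ∈ P) (B : ℕ → ι → Prop) (h0 : B 0 a)
    (hmono : ∀ n x, B n x → B (n + 1) x)
    (hstep : ∀ n < P.card, ∀ x y, B n x → r x y → B (n + 1) y)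
    (h : Relation.ReflTransGen r a b) : B P.card b := by
  classical
  -- The points reached in at most `n` steps. Until these sets become closed under `r` they gain a
  -- point at each step, so they are closed after at most `P.card` steps.
  let W : ℕ → Finset ι := fun n => n.rec {a} fun _ S => S ∪ P.filter fun y => ∃ x ∈ S, r x y
  have hW : ∀ n, W (n + 1) = W n ∪ P.filter fun y => ∃ x ∈ W n, r x y := fun n => rfl
  have hWP : ∀ n, W n ⊆ P := by
    intro n
    induction n with
    | zero => exact Finset.singleton_subset_iff.2 ha
    | succ n ih => rw [hW]; exact Finset.union_subset ih (Finset.filter_subset _ _)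
  have haW : ∀ n, a ∈ W n := by
    intro n
    induction n with
    | zero => exact Finset.mem_singleton_self a
    | succ n ih => rw [hW]; exact Finset.mem_union_left _ ih
  have hWB : ∀ n ≤ P.card, ∀ x ∈ W n, B n x := by
    intro n
    induction n with
    | zero => intro _ x hx; rw [Finset.mem_singleton.1 hx]; exact h0
    | succ n ih =>
      intro hn x hx
      rw [hW, Finset.mem_union] at hx
      rcases hx with hx | hx
      · exact hmono n x (ih (by omega) x hx)
      · obtain ⟨-, y, hy, hyx⟩ := Finset.mem_filter.1 hx
        exact hstep n (by omega) y x (ih (by omega) y hy) hyx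
  have hgrow : ∀ n, (∀ x ∈ W n, ∀ y, r x y → y ∈ W n) ∨ n + 1 ≤ (W n).card := by
    intro n
    induction n with
    | zero => exact Or.inr (Finset.card_singleton a).ge
    | succ n ih =>
      rcases Classical.em (∀ x ∈ W n, ∀ y, r x y → y ∈ W n) with hcl | hcl
      · have : W (n + 1) = W n := by
          rw [hW, Finset.union_eq_left]
          intro y hy
          obtain ⟨-, x, hx, hxy⟩ := Finset.mem_filter.1 hy
          exact hcl x hx y hxy
        exact Or.inl (this ▸ hcl)
      · right
        have hn := ih.resolve_left hcl
        push Not at hcl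
        obtain ⟨x, hx, y, hxy, hy⟩ := hcl
        have hss : W n ⊂ W (n + 1) := by
          refine Finset.ssubset_iff.2 ⟨y, hy, ?_⟩
          rw [hW]
          exact Finset.insert_subset (Finset.mem_union_right _
            (Finset.mem_filter.2 ⟨hr x y hxy, x, hx, hxy⟩)) Finset.subset_union_left
        have := Finset.card_lt_card hss
        omega
  have hclosed := (hgrow P.card).resolve_right (by
    have := Finset.card_le_card (hWP P.card)
    omega)
  refine hWB _ le_rfl b ?_
  induction h with
  | refl => exact haW _
  | tail _ hxy ih => exact hclosed _ ih _ hxy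

/-- A bound for the number of elements that share a vertex. -/
def starCard (d : ℕ) (σ : ℝ) : ℕ := ⌊σ ^ d⌋₊

open Classical in
/-- The Dirichlet energy of `v` on the elements with vertex `p`. -/
def starEnergy (T : Finset (Finset (E d))) (p : E d) (v : H10 Ω) : ℝ :=
  ∑ V ∈ T.filter (fun V => p ∈ V), cellEnergy V v

theorem cellEnergy_le_starEnergy {V : Finset (E d)} (hV : V ∈ T) {p : E d} (hp : p ∈ V)
    (v : H10 Ω) : cellEnergy V v ≤ starEnergy T p v :=
  Finset.single_le_sum (f := fun V => cellEnergy V v) (fun V _ => cellEnergy_nonneg V v)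
    (Finset.mem_filter.2 ⟨hV, hp⟩)

theorem starEnergy_nonneg (T : Finset (Finset (E d))) (p : E d) (v : H10 Ω) :
    0 ≤ starEnergy T p v := Finset.sum_nonneg fun V _ => cellEnergy_nonneg V v

/-- The constant in the comparison of mean values on the elements of a star that contains an
element of diameter `h`. -/
def starConst (d : ℕ) (σ h : ℝ) : ℝ :=
  meanConst d σ (h / σ ^ starCard d σ) (σ ^ starCard d σ * h)

/-- The constant in the estimate for the nodal values of the quasi-interpolant. -/
def nodalConst (d : ℕ) (σ : ℝ) : ℝ :=
  2 * (3 * starCard d σ + 3 + √(inverseConst d)⁻¹) ^ 2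

section Star

variable (hT : IsTriangulation k Ω T) (hint : interior (closure Ω) = Ω)
  (hR : IsShapeRegular σ T) (hd : 1 ≤ d) (hM : IsMesh k T G N)

include hR hd hM in
open Classical in
theorem card_star_le_starCard {V : Finset (E d)} (hV : V ∈ T) (p : E d) :
    (T.filter (fun V => p ∈ V)).card ≤ starCard d σ :=
  Nat.le_floor (hR.card_star_le hd hM hV p)

include hR hd in
theorem starConst_nonneg {V : Finset (E d)} (hV : V ∈ T) : 0 ≤ starConst d σ (elementDiam V) := by
  have hσ := (hR.diam_pos hV hd).2
  have h1 := (hR.diam_pos hV hd).1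
  have h2 := unitBallVolume_pos d
  unfold starConst meanConst
  positivity

include hT hint hR hd hM

/-- Each facet crossing changes the diameter by at most a factor `σ`, and at most `starCard d σ`
crossings are needed. All diameters on the way stay in one fixed range, so `starConst` serves for
every crossing. -/
theorem abs_cellMean_sub_le_of_reachable {V₀ V : Finset (E d)} (hV₀ : V₀ ∈ T) {p : E d}
    (hp : p ∈ V₀) (h : FacetReachable T G p V₀ V) (v : H10 Ω) :
    V ∈ T ∧ elementDiam V ≤ σ ^ starCard d σ * elementDiam V₀ ∧
      elementDiam V₀ / σ ^ starCard d σ ≤ elementDiam V ∧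
      |cellMean V v - cellMean V₀ v| ≤
        starCard d σ * (3 * √(starConst d σ (elementDiam V₀) * (2 * starEnergy T p v))) := by
  classical
  obtain ⟨hpos, hσ⟩ := hR.diam_pos hV₀ hd
  have hσ1 : 1 ≤ σ := by linarith
  have hσ0 : 0 < σ := by linarith
  set h₀ := elementDiam V₀
  set M := starCard d σ with hM'
  set c := 3 * √(starConst d σ h₀ * (2 * starEnergy T p v)) with hc
  have hc0 : 0 ≤ c := by positivity
  have hcard : (T.filter (fun V => p ∈ V)).card ≤ M := by
    convert card_star_le_starCard hR hd hM hV₀ p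
  have hrange : ∀ n ≤ M, ∀ V : Finset (E d), elementDiam V ≤ σ ^ n * h₀ →
      h₀ ≤ σ ^ n * elementDiam V → elementDiam V ≤ σ ^ M * h₀ ∧ h₀ / σ ^ M ≤ elementDiam V := by
    intro n hn V h1 h2
    have hp := pow_le_pow_right₀ hσ1 hn
    refine ⟨h1.trans (mul_le_mul_of_nonneg_right hp hpos.le), ?_⟩
    rw [div_le_iff₀' (by positivity)]
    exact h2.trans (mul_le_mul_of_nonneg_right hp (elementDiam_nonneg V))
  have key := reflTransGen_induction_card (T.filter fun V => p ∈ V) (a := V₀) (b := V)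
    (r := fun A B => A ∈ T ∧ B ∈ T ∧ FacetAdj G p A B)
    (fun A B hAB => by
      obtain ⟨-, hB, hadj⟩ := hAB
      obtain ⟨-, -, -, -, -, -, -, -, hpB, -⟩ := hadj.symm
      exact Finset.mem_filter.2 ⟨hB, hpB⟩)
    (Finset.mem_filter.2 ⟨hV₀, hp⟩)
    (fun n V => V ∈ T ∧ elementDiam V ≤ σ ^ n * h₀ ∧ h₀ ≤ σ ^ n * elementDiam V ∧
      |cellMean V v - cellMean V₀ v| ≤ n * c) ⟨hV₀, by simp [h₀], by simp [h₀], by simp⟩ ?_ ?_ h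
  · obtain ⟨h1, h2, h3, h4⟩ := key
    obtain ⟨h5, h6⟩ := hrange _ hcard V h2 h3
    refine ⟨h1, h5, h6, h4.trans (mul_le_mul_of_nonneg_right ?_ hc0)⟩
    exact_mod_cast hcard
  · rintro n A ⟨h1, h2, h3, h4⟩
    have hp := pow_le_pow_right₀ hσ1 n.le_succ
    refine ⟨h1, h2.trans (mul_le_mul_of_nonneg_right hp hpos.le),
      h3.trans (mul_le_mul_of_nonneg_right hp (elementDiam_nonneg A)), h4.trans ?_⟩
    push_cast
    nlinarith
  · rintro n hn A B ⟨h1, h2, h3, h4⟩ ⟨hA, hB, hadj⟩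
    have hAB := hR.diam_le_of_facetAdj hd hM hA hB hadj
    have hBA := hR.diam_le_of_facetAdj hd hM hB hA hadj.symm
    have hpn : 0 < σ ^ n := by positivity
    have b1 : elementDiam B ≤ σ ^ (n + 1) * h₀ := by
      rw [pow_succ]; nlinarith
    have b2 : h₀ ≤ σ ^ (n + 1) * elementDiam B := by
      rw [pow_succ]; nlinarith
    refine ⟨hB, b1, b2, ?_⟩
    obtain ⟨rA1, rA2⟩ := hrange n (by omega) A h2 h3
    obtain ⟨rB1, rB2⟩ := hrange (n + 1) (by omega) B b1 b2
    have hsq := sq_cellMean_sub_cellMean_le hT hint hR hd hM hA hB hadj (s := h₀ / σ ^ M)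
      (D := σ ^ M * h₀) (by positivity) rA2 rB2 rA1 rB1 v
    have hpA : p ∈ A := by
      obtain ⟨-, -, -, -, -, -, -, -, hpA, -⟩ := hadj
      exact hpA
    have hpB : p ∈ B := by
      obtain ⟨-, -, -, -, -, -, -, -, hpB, -⟩ := hadj.symm
      exact hpB
    have hk := starConst_nonneg hR hd hV₀
    have hc2 : c ^ 2 = 9 * (starConst d σ h₀ * (2 * starEnergy T p v)) := by
      rw [hc, mul_pow, Real.sq_sqrt (mul_nonneg hk (by linarith [starEnergy_nonneg T p v]))]
      rw [show (3 : ℝ) ^ 2 = 9 by norm_num]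
    have hle : |cellMean A v - cellMean B v| ≤ c := by
      refine abs_le_of_sq_le_sq ?_ hc0
      rw [hc2]
      refine hsq.trans (mul_le_mul_of_nonneg_left (mul_le_mul_of_nonneg_left ?_ hk) (by norm_num))
      linarith [cellEnergy_le_starEnergy hA hpA v, cellEnergy_le_starEnergy hB hpB v]
    have := abs_sub_le (cellMean B v) (cellMean A v) (cellMean V₀ v)
    rw [abs_sub_comm (cellMean B v) (cellMean A v)] at this
    push_cast
    linarith

open Classical in
/-- The nodal values of the quasi-interpolant are close to the mean values. -/
theorem sq_sub_cellMean_le (hΩ : IsOpen Ω) {Q : Finset (E d) → E d → ℝ} {f : E d → ℝ} {v : H10 Ω}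
    (hQ : ∀ V ∈ T, IsLocalProjection k V v (Q V)) (hf : ∀ p ∉ Ω, f p = 0)
    (hfQ : ∀ p ∈ Ω, (∃ V ∈ T, p ∈ V) →
      f p = (∑ V ∈ T.filter (fun V => p ∈ V), Q V p) / ((T.filter (fun V => p ∈ V)).card : ℝ))
    {V₀ : Finset (E d)} (hV₀ : V₀ ∈ T) {p : E d} (hp : p ∈ V₀) :
    (f p - cellMean V₀ v) ^ 2 ≤
      nodalConst d σ * (starConst d σ (elementDiam V₀) * starEnergy T p v) := by
  obtain ⟨hpos, hσ⟩ := hR.diam_pos hV₀ hd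
  have hσ0 : 0 < σ := by linarith
  set h₀ := elementDiam V₀ with hh₀
  set M := starCard d σ with hM'
  set τ := √(starConst d σ h₀ * (2 * starEnergy T p v)) with hτ
  have hτ0 : 0 ≤ τ := Real.sqrt_nonneg _
  have hk := starConst_nonneg hR hd hV₀
  have hS := starEnergy_nonneg T p v
  have hτ2 : τ ^ 2 = starConst d σ h₀ * (2 * starEnergy T p v) :=
    Real.sq_sqrt (mul_nonneg hk (by linarith))
  have hi := inverseConst_pos hd
  set ι := √(inverseConst d)⁻¹ with hι
  have hι0 : 0 ≤ ι := Real.sqrt_nonneg _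
  have hι2 : ι ^ 2 = (inverseConst d)⁻¹ := Real.sq_sqrt (by positivity)
  have hs : 0 < h₀ / σ ^ M := by positivity
  suffices h : |f p - cellMean V₀ v| ≤ (3 * M + 3 + ι) * τ by
    have h2 := pow_le_pow_left₀ (abs_nonneg _) h 2
    rw [sq_abs, mul_pow, hτ2] at h2
    refine h2.trans_eq ?_
    rw [nodalConst]; ring
  have hen : ∀ V ∈ T, p ∈ V → starConst d σ h₀ * cellEnergy V v ≤ τ ^ 2 := fun V hV hpV => by
    rw [hτ2]
    refine mul_le_mul_of_nonneg_left ?_ hk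
    linarith [cellEnergy_le_starEnergy hV hpV v]
  -- At an interior vertex with all elements reachable, every projected value in the average is
  -- close to the mean on `V₀`. Otherwise `p` lies on a boundary facet, so `f p = 0`, and the mean
  -- on the reached boundary element is small.
  rcases hM.reachable_or_boundary hT hΩ hint hV₀ hp with ⟨hpΩ, hall⟩ | ⟨V, hV, hpV, hreach, g, hg,
    hgp, hgΩ⟩
  · rw [hfQ p hpΩ ⟨V₀, hV₀, hp⟩]
    set P := T.filter (fun V => p ∈ V) with hP
    have hcard : (0 : ℝ) < P.card := by
      exact_mod_cast Finset.card_pos.2 ⟨V₀, Finset.mem_filter.2 ⟨hV₀, hp⟩⟩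
    have heach : ∀ V ∈ P, |Q V p - cellMean V₀ v| ≤ (3 * M + 3 + ι) * τ := by
      intro V hVP
      obtain ⟨hV, hpV⟩ := Finset.mem_filter.1 hVP
      obtain ⟨-, h1, h2, h3⟩ := abs_cellMean_sub_le_of_reachable hT hint hR hd hM hV₀ hp
        (hall V hV hpV) v
      have h4 := sq_localProjection_sub_cellMean_le hT hint hR hd hM hV hs h2 h1 (hQ V hV) hpV
      have h5 : |Q V p - cellMean V v| ≤ ι * τ := by
        refine abs_le_of_sq_le_sq ?_ (by positivity)
        rw [mul_pow, hι2]
        exact h4.trans (mul_le_mul_of_nonneg_left (hen V hV hpV) (by positivity))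
      have h6 := abs_sub_le (Q V p) (cellMean V v) (cellMean V₀ v)
      nlinarith
    have hdiff : (∑ V ∈ P, Q V p) / (P.card : ℝ) - cellMean V₀ v =
        (∑ V ∈ P, (Q V p - cellMean V₀ v)) / P.card := by
      rw [Finset.sum_sub_distrib, Finset.sum_const, nsmul_eq_mul]
      field_simp
    rw [hdiff, abs_div, abs_of_pos hcard, div_le_iff₀ hcard]
    refine (Finset.abs_sum_le_sum_abs _ _).trans ((Finset.sum_le_sum heach).trans_eq ?_)
    rw [Finset.sum_const, nsmul_eq_mul, mul_comm]
  · rw [hf p (hgΩ p (mem_cell_of_mem hpV) hgp)]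
    obtain ⟨-, h1, h2, h3⟩ := abs_cellMean_sub_le_of_reachable hT hint hR hd hM hV₀ hp hreach v
    have h4 := sq_cellMean_le_of_boundary hT hint hR hd hM hV hg hgΩ hs h2 h1 v
    have h5 : |cellMean V v| ≤ 3 * τ := by
      refine abs_le_of_sq_le_sq ?_ (by positivity)
      have := hen V hV hpV
      rw [starConst] at this
      nlinarith
    have h6 := abs_sub_le 0 (cellMean V v) (cellMean V₀ v)
    simp only [zero_sub, abs_neg] at h6 ⊢
    nlinarith [mul_nonneg hι0 hτ0]

end Star

end OCP

end

/-! ### The interpolation error estimate. -/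

noncomputable section

namespace OCP

open Filter Topology

variable {d : ℕ} {Ω : Set (E d)} {k : ElementKind} {T : Finset (Finset (E d))}
  {G : Finset (E d) → Finset (E d →ᵃ[ℝ] ℝ)} {N : Finset (E d) → E d → E d → ℝ} {σ : ℝ}

/-- The factor in the scaling of `starConst`. -/
def starFactor (d : ℕ) (σ : ℝ) : ℝ :=
  2 ^ (d + 2) * (σ ^ starCard d σ) ^ 2 * (σ ^ starCard d σ * (σ * 2 ^ d)) ^ d

/-- `starConst` scales like `h ^ (2 - d)`; multiplied by the volume of an element it leaves `h ^ 2`,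
whatever the dimension. -/
theorem starConst_mul {h : ℝ} (hσ : 0 < σ) (hh : 0 < h) :
    starConst d σ h * (h ^ d * unitBallVolume d) = starFactor d σ * h ^ 2 := by
  have := unitBallVolume_pos d
  rw [starConst, meanConst, starFactor, div_div, div_pow]
  field_simp

/-- The Dirichlet energy of `v` near the element with vertex set `V`. -/
def patchEnergy (T : Finset (Finset (E d))) (V : Finset (E d)) (v : H10 Ω) : ℝ :=
  ∑ p ∈ V, starEnergy T p v

theorem cellEnergy_le_patchEnergy {V : Finset (E d)} (hV : V ∈ T) (hne : V.Nonempty) (v : H10 Ω) :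
    cellEnergy V v ≤ patchEnergy T V v := by
  obtain ⟨p, hp⟩ := hne
  exact (cellEnergy_le_starEnergy hV hp v).trans
    (Finset.single_le_sum (f := fun p => starEnergy T p v) (fun p _ => starEnergy_nonneg T p v) hp)

theorem patchEnergy_nonneg (T : Finset (Finset (E d))) (V : Finset (E d)) (v : H10 Ω) :
    0 ≤ patchEnergy T V v := Finset.sum_nonneg fun p _ => starEnergy_nonneg T p v

theorem energyOn_le_of_norm_le {F : Type*} [NormedAddCommGroup F] {f : E d → F} {K : Set (E d)}
    (hK : volume K ≠ ⊤) {R : ℝ} (hf : ∀ᵐ x ∂volume.restrict K, ‖f x‖ ^ 2 ≤ R) :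
    energyOn K f ≤ R * volume.real K := by
  have : IsFiniteMeasure (volume.restrict K) := ⟨by simpa using hK.lt_top⟩
  refine (integral_mono_of_nonneg (ae_of_all _ fun x => by positivity) (integrable_const R)
    hf).trans_eq ?_
  rw [setIntegral_const, smul_eq_mul, mul_comm]

theorem energyOn_sub_le {F : Type*} [NormedAddCommGroup F] {f g : E d → F} {K : Set (E d)}
    (hf : MemLp f 2 (volume.restrict K)) (hg : MemLp g 2 (volume.restrict K)) :
    energyOn K (fun x => f x - g x) ≤ 2 * energyOn K f + 2 * energyOn K g := by
  have h1 : IntegrableOn (fun x => ‖f x‖ ^ 2) K := hf.integrable_norm_pow (p := 2) (by norm_num)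
  have h2 : IntegrableOn (fun x => ‖g x‖ ^ 2) K := hg.integrable_norm_pow (p := 2) (by norm_num)
  rw [energyOn, energyOn, energyOn, ← integral_const_mul, ← integral_const_mul,
    ← integral_add (h1.const_mul 2) (h2.const_mul 2)]
  refine integral_mono_of_nonneg (ae_of_all _ fun x => by positivity)
    ((h1.const_mul 2).add (h2.const_mul 2)) (ae_of_all _ fun x => ?_)
  have := norm_sub_le (f x) (g x)
  have h0 := norm_nonneg (f x - g x)
  simp only
  nlinarith [sq_nonneg (‖f x‖ - ‖g x‖)]

theorem energyOn_interior_cell {F : Type*} [NormedAddCommGroup F] (u : E d → F)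
    (V : Finset (E d)) : energyOn (interior (cell V)) u = energyOn (cell V) u :=
  setIntegral_congr_set (interior_ae_eq_of_null_frontier
    ((convex_convexHull ℝ (V : Set (E d))).addHaar_frontier volume))

section Patch

variable (hT : IsTriangulation k Ω T) (hint : interior (closure Ω) = Ω)
include hT hint

theorem energyOn_biUnion_le {F : Type*} [NormedAddCommGroup F] (u : Lp F 2 (volume.restrict Ω))
    (S : Finset (Finset (E d))) (hS : S ⊆ T) :
    IsEssentialSubset (⋃ V ∈ S, cell V) Ω ∧
      energyOn (⋃ V ∈ S, cell V) u ≤ ∑ V ∈ S, energyOn (cell V) u := by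
  classical
  induction S using Finset.induction_on with
  | empty => simp [energyOn]; exact ⟨MeasurableSet.empty, by simp⟩
  | insert V S hV ih =>
    obtain ⟨h1, h2⟩ := ih ((Finset.subset_insert V S).trans hS)
    have eV := hT.isEssentialSubset hint (hS (Finset.mem_insert_self V S))
    rw [Finset.set_biUnion_insert, Finset.sum_insert hV]
    exact ⟨eV.union h1, (energyOn_union_le eV.measurableSet h1.measurableSet (eV.memLp u)
      (h1.memLp u)).trans (by linarith)⟩

theorem norm_sq_le_sum_energyOn {F : Type*} [NormedAddCommGroup F]
    (u : Lp F 2 (volume.restrict Ω)) : ‖u‖ ^ 2 ≤ ∑ V ∈ T, energyOn (cell V) u := by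
  obtain ⟨h1, h2⟩ := energyOn_biUnion_le hT hint u T subset_rfl
  rw [norm_sq_eq_integral]
  refine le_trans (energyOn_mono ?_ (h1.memLp u)) h2
  have := hT.cover
  exact subset_closure.trans_eq this.symm

theorem IsTriangulation.interior_cell_subset {V : Finset (E d)} (hV : V ∈ T) :
    interior (cell V) ⊆ Ω := by
  rw [← hint]
  exact interior_mono (hT.cell_subset hV)

theorem sum_energyOn_le_norm_sq (hM : IsMesh k T G N) {F : Type*} [NormedAddCommGroup F]
    (u : Lp F 2 (volume.restrict Ω)) : ∑ V ∈ T, energyOn (cell V) u ≤ ‖u‖ ^ 2 := by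
  have hi : IntegrableOn (fun x => ‖u x‖ ^ 2) Ω :=
    (Lp.memLp u).integrable_norm_pow (p := 2) (by norm_num)
  have hsub : ∀ V ∈ T, interior (cell V) ⊆ Ω := fun V hV => hT.interior_cell_subset hint hV
  have h := integral_biUnion_finset (f := fun x => ‖u x‖ ^ 2) (μ := volume) T
    (s := fun V => interior (cell V)) (fun V _ => isOpen_interior.measurableSet)
    (fun V hV V' hV' hne => disjoint_left.2 fun x hx hx' =>
      hne (hM.eq_of_mem_interior hV hV' hx (interior_subset hx')))
    (fun V hV => hi.mono_set (hsub V hV))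
  have h2 : ∫ x in ⋃ V ∈ T, interior (cell V), ‖u x‖ ^ 2 ≤ ∫ x in Ω, ‖u x‖ ^ 2 :=
    setIntegral_mono_set hi (ae_of_all _ fun x => by positivity)
      (iUnion₂_subset hsub).eventuallyLE
  rw [norm_sq_eq_integral]
  refine le_trans (le_of_eq ?_) (h.symm.trans_le h2)
  exact Finset.sum_congr rfl fun V _ => (energyOn_interior_cell u V).symm

/-- Finite overlap: the energy of an element is counted once for each of its at most `2 ^ d`
vertices and each of the at most `starCard d σ` elements there. -/
theorem sum_patchEnergy_le (hR : IsShapeRegular σ T) (hd : 1 ≤ d) (hM : IsMesh k T G N)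
    (v : H10 Ω) :
    ∑ V ∈ T, patchEnergy T V v ≤ 2 ^ d * starCard d σ * h1Seminorm v ^ 2 := by
  classical
  have h1 : ∑ V ∈ T, patchEnergy T V v =
      ∑ V' ∈ T, ∑ p ∈ V', ((T.filter fun V => p ∈ V).card : ℝ) * cellEnergy V' v := by
    calc ∑ V ∈ T, patchEnergy T V v
        = ∑ V ∈ T, ∑ V' ∈ T, ∑ p ∈ V'.filter (· ∈ V), cellEnergy V' v := by
          refine Finset.sum_congr rfl fun V _ => Finset.sum_comm' fun p V' => ?_
          simp only [Finset.mem_filter]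
          tauto
      _ = ∑ V' ∈ T, ∑ V ∈ T, ∑ p ∈ V'.filter (· ∈ V), cellEnergy V' v := Finset.sum_comm
      _ = ∑ V' ∈ T, ∑ p ∈ V', ∑ V ∈ T.filter fun V => p ∈ V, cellEnergy V' v := by
          refine Finset.sum_congr rfl fun V' _ => Finset.sum_comm' fun V p => ?_
          simp only [Finset.mem_filter]
          tauto
      _ = _ := by simp only [Finset.sum_const, nsmul_eq_mul]
  have h2 : ∀ V' ∈ T, ∑ p ∈ V', ((T.filter fun V => p ∈ V).card : ℝ) * cellEnergy V' v ≤
      2 ^ d * starCard d σ * cellEnergy V' v := by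
    intro V' hV'
    have h3 : ∀ p ∈ V', ((T.filter fun V => p ∈ V).card : ℝ) * cellEnergy V' v ≤
        starCard d σ * cellEnergy V' v := fun p _ => by
      refine mul_le_mul_of_nonneg_right ?_ (cellEnergy_nonneg _ _)
      have := card_star_le_starCard hR hd hM hV' p
      convert (Nat.cast_le (α := ℝ)).2 this
    refine (Finset.sum_le_card_nsmul _ _ _ h3).trans ?_
    rw [nsmul_eq_mul, mul_assoc]
    refine mul_le_mul_of_nonneg_right ?_ (mul_nonneg (Nat.cast_nonneg _) (cellEnergy_nonneg _ _))
    exact_mod_cast (hM.shape V' hV').card_le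
  rw [h1]
  refine (Finset.sum_le_sum h2).trans ?_
  rw [← Finset.mul_sum]
  exact mul_le_mul_of_nonneg_left (sum_energyOn_le_norm_sq hT hint hM (weakGrad v)) (by positivity)

/-- Bounds on one element for a finite element function with controlled nodal values. -/
theorem energyOn_cell_le (hΩ : IsOpen Ω) (hR : IsShapeRegular σ T) (hd : 1 ≤ d)
    (hM : IsMesh k T G N) {v w : H10 Ω} (hvw : IsPi k T v w) {V : Finset (E d)} (hV : V ∈ T) :
    energyOn (cell V) (toL2 (v - w)) ≤
        (2 ^ (d + 1) + 2 ^ (d + 1) * nodalConst d σ * starFactor d σ) *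
          elementDiam V ^ 2 * patchEnergy T V v ∧
      energyOn (cell V) (weakGrad w) ≤
        2 ^ d * nodalConst d σ * starFactor d σ * (d * σ) ^ 2 * patchEnergy T V v := by
  classical
  obtain ⟨Q, f, hQ, hf, hfw, hfQ⟩ := hvw
  obtain ⟨hpos, hσ⟩ := hR.diam_pos hV hd
  have hσ0 : 0 < σ := by linarith
  set h := elementDiam V with hh
  set m := cellMean V v with hm
  have S := hM.shape V hV
  have hne : V.Nonempty := nonempty_of_isElement (hT.isElement V hV)
  have eV := hT.isEssentialSubset hint hV
  have hk := starConst_nonneg hR hd hV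
  have hn : 0 ≤ nodalConst d σ := by unfold nodalConst; positivity
  have hP := patchEnergy_nonneg T V v
  have hnodes : ∑ u ∈ V, (f u - m) ^ 2 ≤
      nodalConst d σ * (starConst d σ h * patchEnergy T V v) := by
    rw [patchEnergy, Finset.mul_sum, Finset.mul_sum]
    refine Finset.sum_le_sum fun u hu => ?_
    refine sq_sub_cellMean_le hT hint hR hd hM hΩ hQ hf.eq_zero (fun p hp hpV => ?_) hV hu
    rw [hfQ p hp hpV]
  set R := 2 ^ d * (nodalConst d σ * (starConst d σ h * patchEnergy T V v)) with hRdef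
  have habs : (∑ u ∈ V, |f u - m|) ^ 2 ≤ R := by
    refine (sq_sum_le_card_mul_sum_sq (s := V)).trans ?_
    simp only [sq_abs]
    refine mul_le_mul ?_ hnodes (Finset.sum_nonneg fun u _ => sq_nonneg _) (by positivity)
    exact_mod_cast S.card_le
  have hR0 : 0 ≤ R := (sq_nonneg _).trans habs
  have hvol : volume.real (cell V) ≤ h ^ d * unitBallVolume d := volume_real_cell_le hne
  have hRvol : R * volume.real (cell V) ≤
      2 ^ d * nodalConst d σ * starFactor d σ * h ^ 2 * patchEnergy T V v := by
    refine (mul_le_mul_of_nonneg_left hvol hR0).trans_eq ?_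
    have := starConst_mul (d := d) hσ0 hpos
    calc R * (h ^ d * unitBallVolume d) = 2 ^ d * nodalConst d σ * patchEnergy T V v *
        (starConst d σ h * (h ^ d * unitBallVolume d)) := by rw [hRdef]; ring
      _ = _ := by rw [this]; ring
  have hpt : ∀ x ∈ cell V, ‖f x - m‖ ^ 2 ≤ R := fun x hx => by
    refine le_trans (pow_le_pow_left₀ (norm_nonneg _) ?_ 2) habs
    have h1 : f x - m = ∑ u ∈ V, (f u - m) * N V u x := by
      simp only [sub_mul, Finset.sum_sub_distrib, ← Finset.mul_sum, S.sum_nodal x, mul_one]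
      rw [hf.eq_sum hM hV hx]
    rw [h1]
    refine (norm_sum_le _ _).trans (Finset.sum_le_sum fun u hu => ?_)
    rw [norm_mul, Real.norm_eq_abs]
    refine mul_le_of_le_one_right (abs_nonneg _) ?_
    rw [Real.norm_of_nonneg (S.nodal_nonneg u hu x hx), ← S.sum_nodal x]
    exact Finset.single_le_sum (fun u hu => S.nodal_nonneg u hu x hx) hu
  have hvolpos := hM.volume_cell_pos hT hV
  constructor
  · have e1 : toL2 (v - w) =ᵐ[volume.restrict (cell V)]
        fun x => (toL2 v x - m) - (f x - m) := by
      refine Filter.Eventually.filter_mono (ae_mono eV.restrict_le) ?_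
      filter_upwards [Lp.coeFn_sub (toL2 v) (toL2 w), hfw] with x h1 h2
      rw [toL2_sub, h1, Pi.sub_apply, h2]
      ring
    have e2 : MemLp (fun x => toL2 v x - m) 2 (volume.restrict (cell V)) := by
      have : IsFiniteMeasure (volume.restrict (cell V)) :=
        ⟨by simpa using (volume_cell_ne_top V).lt_top⟩
      exact (eV.memLp _).sub (memLp_const m)
    have e3 : MemLp (fun x => f x - m) 2 (volume.restrict (cell V)) :=
      memLp_of_continuous_of_isCompact (isCompact_cell V) (hf.continuous.sub continuous_const)
    have e4 : energyOn (cell V) (fun x => toL2 v x - m) ≤ 2 ^ d * h ^ 2 * cellEnergy V v :=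
      H10.energyOn_sub_average_le eV (convex_convexHull ℝ _) (volume_ne_zero_of_real_pos hvolpos)
        (volume_cell_ne_top V) hpos.le (fun x hx y hy => norm_sub_le_elementDiam hx hy) v
    have e5 : energyOn (cell V) (fun x => f x - m) ≤ R * volume.real (cell V) :=
      energyOn_le_of_norm_le (volume_cell_ne_top V)
        ((ae_restrict_iff' (measurableSet_cell V)).2 (ae_of_all _ hpt))
    have e6 : 2 ^ d * h ^ 2 * cellEnergy V v ≤ 2 ^ d * h ^ 2 * patchEnergy T V v :=
      mul_le_mul_of_nonneg_left (cellEnergy_le_patchEnergy hV hne v) (by positivity)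
    rw [energyOn_congr_ae e1]
    refine (energyOn_sub_le e2 e3).trans ?_
    rw [pow_succ]
    nlinarith
  · obtain ⟨q, hq, hfq⟩ := hf.piecewise V hV
    have hU := hT.interior_cell_subset hint hV
    -- In the open element `w` is a polynomial, so its weak gradient is classical and is bounded by
    -- the Lipschitz constant of `f`.
    have e1 : weakGrad w =ᵐ[volume.restrict (interior (cell V))] ∇ q := by
      refine weakGrad_ae_eq_gradient w isOpen_interior hU (contDiff_of_mem_localPoly hq) ?_
      have h1 : toL2 w =ᵐ[volume.restrict (interior (cell V))] f :=
        Filter.Eventually.filter_mono (ae_mono (Measure.restrict_mono hU le_rfl)) hfw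
      refine h1.trans ((ae_restrict_iff' isOpen_interior.measurableSet).2 (ae_of_all _ fun x hx => ?_))
      exact hfq (interior_subset hx)
    set L := (∑ u ∈ V, |f u - m|) * (d * (σ / h)) with hL
    have hL0 : 0 ≤ L := by positivity
    have hL2 : L ^ 2 ≤ R * (d * (σ / h)) ^ 2 := by
      rw [hL, mul_pow]
      exact mul_le_mul_of_nonneg_right habs (by positivity)
    have e2 : ∀ x ∈ interior (cell V), ‖∇ q x‖ ^ 2 ≤ R * (d * (σ / h)) ^ 2 := fun x hx => by
      refine le_trans (pow_le_pow_left₀ (norm_nonneg _) ?_ 2) hL2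
      rw [norm_gradient]
      refine norm_fderiv_le_of_lip' ℝ hL0 ?_
      filter_upwards [isOpen_interior.mem_nhds hx] with y hy
      rw [← hfq (interior_subset hx), ← hfq (interior_subset hy)]
      exact hf.abs_sub_le hM hV (fun g hg => hR.facet_lipschitz hV hd hM hg) m
        (interior_subset hy) (interior_subset hx)
    rw [← energyOn_interior_cell, energyOn_congr_ae e1]
    refine (energyOn_le_of_norm_le (measure_ne_top_of_subset interior_subset
      (volume_cell_ne_top V)) ((ae_restrict_iff' isOpen_interior.measurableSet).2
      (ae_of_all _ e2))).trans ?_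
    have e3 : volume.real (interior (cell V)) ≤ volume.real (cell V) :=
      measureReal_mono interior_subset (volume_cell_ne_top V)
    calc R * (d * (σ / h)) ^ 2 * volume.real (interior (cell V))
        ≤ R * (d * (σ / h)) ^ 2 * volume.real (cell V) :=
          mul_le_mul_of_nonneg_left e3 (by positivity)
      _ = R * volume.real (cell V) * (d * (σ / h)) ^ 2 := by ring
      _ ≤ 2 ^ d * nodalConst d σ * starFactor d σ * h ^ 2 * patchEnergy T V v *
          (d * (σ / h)) ^ 2 := mul_le_mul_of_nonneg_right hRvol (by positivity)
      _ = _ := by field_simp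

end Patch

/-- The constant in the interpolation error estimate. -/
def interpolationConst (d : ℕ) (σ : ℝ) : ℝ :=
  max 1 (√((2 ^ (d + 1) + 2 ^ (d + 1) * nodalConst d σ * starFactor d σ) *
      (2 ^ d * starCard d σ)) +
    √(2 ^ d * nodalConst d σ * starFactor d σ * (d * σ) ^ 2 * (2 ^ d * starCard d σ)))

theorem meshSize_pos (hT : IsTriangulation k Ω T) (hR : IsShapeRegular σ T) (hd : 1 ≤ d)
    (hne : Ω.Nonempty) : 0 < meshSize T := by
  obtain ⟨x, hx⟩ := hne
  obtain ⟨V, hV, -⟩ := hT.exists_cell (subset_closure hx)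
  exact (hR.diam_pos hV hd).1.trans_le (elementDiam_le_meshSize hV)

/-- Sum the bounds on the elements. The diameters enter only the `L₂` part, where the mesh size
replaces them; the gradient bound is free of scale, so no quasi-uniformity is required. -/
theorem interpolationEstimate (hΩ : IsOpen Ω) (hne : Ω.Nonempty)
    (hT : IsTriangulation k Ω T) (hint : interior (closure Ω) = Ω)
    (hR : IsShapeRegular σ T) (hd : 1 ≤ d) :
    InterpolationEstimate k Ω T (interpolationConst d σ) := by
  obtain ⟨G, N, hM⟩ := hT.exists_isMesh hd
  intro v w hvw
  have hH := meshSize_pos hT hR hd hne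
  obtain ⟨x, hx⟩ := hne
  obtain ⟨V₀, hV₀, -⟩ := hT.exists_cell (subset_closure hx)
  have hσ0 : 0 < σ := by linarith [(hR.diam_pos hV₀ hd).2]
  have hv : 0 ≤ h1Seminorm v := norm_nonneg _
  have hn : 0 ≤ nodalConst d σ := by unfold nodalConst; positivity
  have hs : 0 ≤ starFactor d σ := by unfold starFactor; positivity
  set Ka := 2 ^ (d + 1) + 2 ^ (d + 1) * nodalConst d σ * starFactor d σ with hKa
  set Kb := 2 ^ d * nodalConst d σ * starFactor d σ * (d * σ) ^ 2 with hKb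
  set Ko : ℝ := 2 ^ d * starCard d σ with hKo
  have hKa0 : 0 ≤ Ka := by positivity
  have hKb0 : 0 ≤ Kb := by positivity
  have hsum := sum_patchEnergy_le hT hint hR hd hM v
  have h1 : l2Norm (v - w) ^ 2 ≤ Ka * Ko * (meshSize T * h1Seminorm v) ^ 2 := by
    refine (norm_sq_le_sum_energyOn hT hint (toL2 (v - w))).trans ?_
    calc ∑ V ∈ T, energyOn (cell V) (toL2 (v - w))
        ≤ ∑ V ∈ T, Ka * meshSize T ^ 2 * patchEnergy T V v := by
          refine Finset.sum_le_sum fun V hV =>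
            (energyOn_cell_le hT hint hΩ hR hd hM hvw hV).1.trans ?_
          refine mul_le_mul_of_nonneg_right (mul_le_mul_of_nonneg_left ?_ hKa0)
            (patchEnergy_nonneg T V v)
          exact pow_le_pow_left₀ (elementDiam_nonneg V) (elementDiam_le_meshSize hV) 2
      _ = Ka * meshSize T ^ 2 * ∑ V ∈ T, patchEnergy T V v := by rw [Finset.mul_sum]
      _ ≤ Ka * meshSize T ^ 2 * (Ko * h1Seminorm v ^ 2) :=
          mul_le_mul_of_nonneg_left hsum (by positivity)
      _ = _ := by ring
  have h2 : h1Seminorm w ^ 2 ≤ Kb * Ko * h1Seminorm v ^ 2 := by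
    refine (norm_sq_le_sum_energyOn hT hint (weakGrad w)).trans ?_
    calc ∑ V ∈ T, energyOn (cell V) (weakGrad w)
        ≤ ∑ V ∈ T, Kb * patchEnergy T V v := Finset.sum_le_sum fun V hV =>
          (energyOn_cell_le hT hint hΩ hR hd hM hvw hV).2
      _ = Kb * ∑ V ∈ T, patchEnergy T V v := by rw [Finset.mul_sum]
      _ ≤ Kb * (Ko * h1Seminorm v ^ 2) := mul_le_mul_of_nonneg_left hsum hKb0
      _ = _ := by ring
  have h3 : l2Norm (v - w) ≤ √(Ka * Ko) * (meshSize T * h1Seminorm v) := by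
    refine le_of_sq_le_sq ?_ (by positivity)
    rwa [mul_pow, Real.sq_sqrt (by positivity)]
  have h4 : h1Seminorm w ≤ √(Kb * Ko) * h1Seminorm v := by
    refine le_of_sq_le_sq ?_ (by positivity)
    rwa [mul_pow, Real.sq_sqrt (by positivity)]
  have h5 : (meshSize T)⁻¹ * l2Norm (v - w) ≤ √(Ka * Ko) * h1Seminorm v := by
    rw [inv_mul_le_iff₀ hH]
    linarith
  calc (meshSize T)⁻¹ * l2Norm (v - w) + h1Seminorm w
      ≤ (√(Ka * Ko) + √(Kb * Ko)) * h1Seminorm v := by linarith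
    _ ≤ interpolationConst d σ * h1Seminorm v :=
        mul_le_mul_of_nonneg_right (le_max_right _ _) hv

end OCP

end

/-! ### Galerkin problems for symmetric nondegenerate forms, and the form `B`. -/

noncomputable section

namespace OCP

section Galerkin

variable {X : Type*} [AddCommGroup X] [Module ℝ X] (B : X →ₗ[ℝ] X →ₗ[ℝ] ℝ)

/-- A bilinear form is nondegenerate on a subspace. -/
def NondegenerateOn (W : Submodule ℝ X) : Prop := ∀ x ∈ W, (∀ w ∈ W, B x w = 0) → x = 0

variable {B}

theorem NondegenerateOn.existsUnique {W : Submodule ℝ X} [FiniteDimensional ℝ W]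
    (h : NondegenerateOn B W) (F : X →ₗ[ℝ] ℝ) : ∃! u, u ∈ W ∧ ∀ w ∈ W, B u w = F w := by
  let L : W →ₗ[ℝ] Module.Dual ℝ W := (W.subtype.dualMap ∘ₗ B) ∘ₗ W.subtype
  have hL : ∀ u w : W, L u w = B u w := fun u w => rfl
  have hinj : Function.Injective L := by
    refine (injective_iff_map_eq_zero L).2 fun u hu => ?_
    refine Subtype.ext (h u u.2 fun w hw => ?_)
    rw [← hL u ⟨w, hw⟩, hu]; rfl
  have hsurj : Function.Surjective L :=
    (LinearMap.injective_iff_surjective_of_finrank_eq_finrank Subspace.dual_finrank_eq.symm).1 hinj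
  obtain ⟨u, hu⟩ := hsurj (F ∘ₗ W.subtype)
  refine ⟨u, ⟨u.2, fun w hw => ?_⟩, ?_⟩
  · rw [← hL u ⟨w, hw⟩, hu]; rfl
  · rintro u' ⟨hu', h'⟩
    rw [← sub_eq_zero]
    refine h _ (W.sub_mem hu' u.2) fun w hw => ?_
    rw [map_sub, LinearMap.sub_apply, h' w hw, ← hL u ⟨w, hw⟩, hu]
    exact sub_self _

/-- The `B`-orthogonal complement of `K` in `W`. -/
def orthogonalIn (B : X →ₗ[ℝ] X →ₗ[ℝ] ℝ) (W K : Submodule ℝ X) : Submodule ℝ X where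
  carrier := {v | v ∈ W ∧ ∀ w ∈ K, B v w = 0}
  zero_mem' := ⟨W.zero_mem, fun w _ => by simp⟩
  add_mem' := fun {u v} hu hv => ⟨W.add_mem hu.1 hv.1, fun w hw => by simp [hu.2 w hw, hv.2 w hw]⟩
  smul_mem' := fun c v hv => ⟨W.smul_mem c hv.1, fun w hw => by simp [hv.2 w hw]⟩

variable {W K : Submodule ℝ X} [FiniteDimensional ℝ W]

/-- The component `y` solves the Galerkin problem in `K` with data `B x`; nondegeneracy on `K`
replaces definiteness. -/
theorem exists_sub_mem_orthogonalIn (hKW : K ≤ W) (hK : NondegenerateOn B K) {x : X} (hx : x ∈ W) :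
    ∃ y ∈ K, x - y ∈ orthogonalIn B W K := by
  have : FiniteDimensional ℝ K := Submodule.finiteDimensional_of_le hKW
  obtain ⟨y, ⟨hy, h⟩, -⟩ := hK.existsUnique (B x)
  refine ⟨y, hy, W.sub_mem hx (hKW hy), fun w hw => ?_⟩
  rw [map_sub, LinearMap.sub_apply, h w hw, sub_self]

/-- A member of the complement annihilates `K` anyway, so testing it on the complement amounts to
testing it on all of `W`. -/
theorem nondegenerateOn_orthogonalIn (hKW : K ≤ W) (hW : NondegenerateOn B W)
    (hK : NondegenerateOn B K) : NondegenerateOn B (orthogonalIn B W K) := by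
  refine fun x hx h => hW x hx.1 fun w hw => ?_
  obtain ⟨y, hy, hwy⟩ := exists_sub_mem_orthogonalIn hKW hK hw
  have h1 := h _ hwy
  rwa [map_sub, hx.2 y hy, sub_zero] at h1

/-- The error of the Galerkin solution in the orthogonal complement of `K` is the Galerkin
solution in `K`. -/
theorem sub_mem_of_galerkin (hsymm : ∀ x y, B x y = B y x) (hKW : K ≤ W)
    (hW : NondegenerateOn B W) (hK : NondegenerateOn B K) {F : X →ₗ[ℝ] ℝ} {u u' : X}
    (hu : u ∈ W) (hF : ∀ w ∈ W, B u w = F w) (hu' : u' ∈ orthogonalIn B W K)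
    (hF' : ∀ w ∈ orthogonalIn B W K, B u' w = F w) :
    u - u' ∈ K ∧ ∀ w ∈ K, B (u - u') w = F w := by
  have he : u - u' ∈ W := W.sub_mem hu hu'.1
  obtain ⟨y, hy, hey⟩ := exists_sub_mem_orthogonalIn hKW hK he
  -- The remainder lies in the complement and is orthogonal to it: both Galerkin equations have the
  -- same data there, and `y ∈ K` is invisible by symmetry.
  have h0 : u - u' - y = 0 := by
    refine nondegenerateOn_orthogonalIn hKW hW hK _ hey fun w hw => ?_
    rw [map_sub, map_sub, LinearMap.sub_apply, LinearMap.sub_apply, hF w hw.1, hF' w hw,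
      hsymm y w, hw.2 y hy]
    ring
  refine ⟨sub_eq_zero.1 h0 ▸ hy, fun w hw => ?_⟩
  rw [map_sub, LinearMap.sub_apply, hF w (hKW hw), hu'.2 w hw, sub_zero]

end Galerkin

variable {d : ℕ} {Ω : Set (E d)} {α β : ℝ} {A : E d → Matrix (Fin d) (Fin d) ℝ}

theorem integral_mul_eq_inner (f g : L2 Ω) : ∫ x in Ω, f x * g x = inner ℝ f g := by
  rw [L2.inner_def]
  refine integral_congr_ae (ae_of_all _ fun x => ?_)
  simp [mul_comm]

theorem mulVec_dotProduct_comm {M : Matrix (Fin d) (Fin d) ℝ} (hM : M.IsSymm) (x y : Fin d → ℝ) :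
    (M *ᵥ x) ⬝ᵥ y = (M *ᵥ y) ⬝ᵥ x := by
  rw [dotProduct_comm, Matrix.dotProduct_mulVec, ← Matrix.mulVec_transpose, hM.eq]

theorem le_mulVec_dotProduct {M : Matrix (Fin d) (Fin d) ℝ} (hM : M.IsSymm)
    (hα : ∀ μ ∈ spectrum ℝ M, α ≤ μ) (x : Fin d → ℝ) : α * (x ⬝ᵥ x) ≤ (M *ᵥ x) ⬝ᵥ x := by
  have h1 : M.IsHermitian := by
    rw [Matrix.IsHermitian, Matrix.conjTranspose_eq_transpose_of_trivial, hM.eq]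
  have h2 : (M - algebraMap ℝ _ α).PosSemidef := by
    rw [Matrix.posSemidef_iff_isHermitian_and_spectrum_nonneg, ← spectrum.sub_singleton_eq]
    refine ⟨h1.sub ?_, ?_⟩
    · rw [Algebra.algebraMap_eq_smul_one, Matrix.IsHermitian]
      simp
    · rintro _ ⟨μ, hμ, ν, hν, rfl⟩
      rw [mem_singleton_iff] at hν
      have := hα μ hμ
      simp only [hν, mem_ofPred_eq]
      linarith
  have h3 := h2.dotProduct_mulVec_nonneg x
  rw [Matrix.sub_mulVec, Algebra.algebraMap_eq_smul_one, Matrix.smul_mulVec, Matrix.one_mulVec,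
    dotProduct_sub, dotProduct_smul, star_trivial, smul_eq_mul, dotProduct_comm x (M *ᵥ x)] at h3
  linarith

theorem memLp_coord (u : L2Vec Ω) (i : Fin d) :
    MemLp (fun x => u x i) 2 (volume.restrict Ω) :=
  (EuclideanSpace.proj (𝕜 := ℝ) i).comp_memLp u

theorem aForm_smul_left (A : E d → Matrix (Fin d) (Fin d) ℝ) (c : ℝ) (u v : H10 Ω) :
    aForm A (c • u) v = c * aForm A u v := by
  rw [aForm, aForm, ← integral_const_mul]
  refine integral_congr_ae ?_
  filter_upwards [Lp.coeFn_smul c (weakGrad u)] with x hx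
  rw [weakGrad_smul, hx, Pi.smul_apply, WithLp.ofLp_smul, Matrix.mulVec_smul, smul_dotProduct,
    smul_eq_mul]

theorem bForm_smul_left (A : E d → Matrix (Fin d) (Fin d) ℝ) (c : ℝ)
    (u v : H10 Ω × H10 Ω) : bForm A (c • u) v = c * bForm A u v := by
  simp only [bForm, integral_mul_eq_inner, Prod.smul_fst, Prod.smul_snd, aForm_smul_left, toL2_smul,
    real_inner_smul_left]
  ring

namespace IsDiffusion

variable (hA : IsDiffusion Ω α β A)
include hA

theorem integrable (u v : H10 Ω) :
    Integrable (fun x => (A x *ᵥ (weakGrad u x).ofLp) ⬝ᵥ (weakGrad v x).ofLp)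
      (volume.restrict Ω) := by
  simp only [Matrix.mulVec, dotProduct]
  refine integrable_finsetSum _ fun i _ => ?_
  have h : MemLp (fun x => ∑ j, A x i j * weakGrad u x j) 2 (volume.restrict Ω) :=
    memLp_finsetSum _ fun j _ => (memLp_coord (weakGrad u) j).mul' (hA.memLp i j)
  exact h.integrable_mul (memLp_coord (weakGrad v) i)

theorem aForm_add_left (u u' v : H10 Ω) : aForm A (u + u') v = aForm A u v + aForm A u' v := by
  rw [aForm, aForm, aForm, ← integral_add (hA.integrable u v) (hA.integrable u' v)]
  refine integral_congr_ae ?_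
  filter_upwards [Lp.coeFn_add (weakGrad u) (weakGrad u')] with x hx
  rw [weakGrad_add, hx, Pi.add_apply, WithLp.ofLp_add, Matrix.mulVec_add, add_dotProduct]

theorem aForm_comm (u v : H10 Ω) : aForm A u v = aForm A v u := by
  refine integral_congr_ae ?_
  filter_upwards [hA.symm] with x hx
  exact mulVec_dotProduct_comm hx _ _

theorem le_aForm (v : H10 Ω) : α * h1Seminorm v ^ 2 ≤ aForm A v v := by
  rw [h1Seminorm, norm_sq_eq_integral, ← integral_const_mul, aForm]
  refine integral_mono_ae (((Lp.memLp (weakGrad v)).integrable_norm_pow (by norm_num)).const_mul α)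
    (hA.integrable v v) ?_
  filter_upwards [hA.symm, hA.eigenvalues] with x hs he
  have := le_mulVec_dotProduct hs (fun μ hμ => (he μ hμ).1) (weakGrad v x).ofLp
  rw [EuclideanSpace.real_norm_sq_eq]
  simpa [dotProduct, sq] using this

theorem bForm_comm (u v : H10 Ω × H10 Ω) : bForm A u v = bForm A v u := by
  simp only [bForm, integral_mul_eq_inner, hA.aForm_comm u.1 v.1, hA.aForm_comm u.2 v.2,
    real_inner_comm (toL2 v.1), real_inner_comm (toL2 u.1)]
  ring

theorem bForm_add_left (u u' v : H10 Ω × H10 Ω) :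
    bForm A (u + u') v = bForm A u v + bForm A u' v := by
  simp only [bForm, integral_mul_eq_inner, Prod.fst_add, Prod.snd_add, hA.aForm_add_left, toL2_add,
    inner_add_left]
  ring

/-- The form `B` as a bilinear map. -/
def bilin : H10 Ω × H10 Ω →ₗ[ℝ] H10 Ω × H10 Ω →ₗ[ℝ] ℝ :=
  LinearMap.mk₂ ℝ (bForm A) hA.bForm_add_left (bForm_smul_left A)
    (fun u v w => by
      rw [hA.bForm_comm, hA.bForm_add_left, hA.bForm_comm v, hA.bForm_comm w])
    (fun c u v => by rw [hA.bForm_comm, bForm_smul_left, hA.bForm_comm v, smul_eq_mul])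

theorem bilin_apply (u v : H10 Ω × H10 Ω) : hA.bilin u v = bForm A u v := rfl

/-- The coupling terms cancel and the sign of `a(y, y)` is reversed, so the indefinite form yields
an energy. -/
theorem bForm_twist (p y : H10 Ω) : bForm A (p, y) (p, -y) = aForm A p p + aForm A y y := by
  have h : aForm A y (-y) = -aForm A y y := by
    rw [hA.aForm_comm, ← neg_one_smul ℝ y, aForm_smul_left]; simp
  simp only [bForm, integral_mul_eq_inner, toL2_neg, inner_neg_right, h,
    real_inner_comm (toL2 p) (toL2 y)]
  ring

theorem bForm_snd (p y z : H10 Ω) : bForm A (p, y) (0, z) = inner ℝ (toL2 p) (toL2 z) - aForm A y z := by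
  have h : aForm A p 0 = 0 := by
    rw [hA.aForm_comm, ← zero_smul ℝ (0 : H10 Ω), aForm_smul_left]; simp
  simp only [bForm, integral_mul_eq_inner, toL2_zero, inner_zero_right, h]
  ring

/-- The test pair `(p, -y)` stays in `W × W` for every subspace `W`, so the fine space and the
kernel of `Π_H` are covered at once. -/
theorem nondegenerateOn (hΩ : IsOpen Ω) {C : ℝ} (hC : PoincareFriedrichs Ω C)
    (W : Submodule ℝ (H10 Ω)) : NondegenerateOn hA.bilin (W.prod W) := by
  rintro ⟨p, y⟩ ⟨hp, hy⟩ h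
  have h1 := h (p, -y) ⟨hp, W.neg_mem hy⟩
  rw [bilin_apply, hA.bForm_twist] at h1
  have hzero : ∀ v : H10 Ω, h1Seminorm v ^ 2 ≤ 0 → v = 0 := fun v hv => by
    have h0 : h1Seminorm v ^ 2 = 0 := le_antisymm hv (sq_nonneg _)
    have h2 := hC v
    rw [h0, mul_zero] at h2
    have h3 : ‖toL2 v‖ = 0 := by
      have := le_antisymm h2 (sq_nonneg _)
      exact pow_eq_zero_iff (two_ne_zero) |>.1 this
    exact toL2_injective hΩ (norm_eq_zero.1 h3)
  have hp' := hA.le_aForm p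
  have hy' := hA.le_aForm y
  have hα := hA.pos
  have a1 := mul_nonneg hα.le (sq_nonneg (h1Seminorm p))
  have a2 := mul_nonneg hα.le (sq_nonneg (h1Seminorm y))
  rw [Prod.mk_eq_zero]
  exact ⟨hzero p (by nlinarith), hzero y (by nlinarith)⟩

end IsDiffusion

end OCP

end

/-! ### The discrete spaces and the error in the kernel of `Π_H`. -/

noncomputable section

namespace OCP

variable {d : ℕ} {Ω : Set (E d)} {k : ElementKind} {T TH : Finset (Finset (E d))} {α β σ : ℝ}
  {A : E d → Matrix (Fin d) (Fin d) ℝ}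

/-- The pairs of a finite element function and the member of `H^1_0(Ω)` that it represents. -/
def fePairs (k : ElementKind) (Ω : Set (E d)) (T : Finset (Finset (E d))) :
    Submodule ℝ ((E d → ℝ) × H10 Ω) where
  carrier := {u | IsFEFunction k Ω T u.1 ∧ Represents u.1 u.2}
  zero_mem' := ⟨isFEFunction_zero, represents_zero⟩
  add_mem' := fun hu hv => ⟨hu.1.add hv.1, hu.2.add hv.2⟩
  smul_mem' := fun c _ hu => ⟨hu.1.smul c, hu.2.smul c⟩

/-- The finite element space as a subspace of `H^1_0(Ω)`. -/
def feSubmodule (k : ElementKind) (Ω : Set (E d)) (T : Finset (Finset (E d))) :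
    Submodule ℝ (H10 Ω) := (fePairs k Ω T).map (LinearMap.snd ℝ _ _)

theorem mem_feSubmodule {v : H10 Ω} : v ∈ feSubmodule k Ω T ↔ v ∈ feSpace k Ω T := by
  constructor
  · rintro ⟨⟨f, w⟩, ⟨h1, h2⟩, rfl⟩
    exact ⟨f, h1, h2⟩
  · rintro ⟨f, h1, h2⟩
    exact ⟨(f, v), ⟨h1, h2⟩, rfl⟩

/-- Finite element functions are determined by their vertex values. These are read off from pairs,
since members of `H^1_0` are classes without point values. -/
theorem finiteDimensional_feSubmodule (hd : 1 ≤ d) (hΩ : IsOpen Ω) (hT : IsTriangulation k Ω T) :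
    FiniteDimensional ℝ (feSubmodule k Ω T) := by
  classical
  obtain ⟨G, N, hM⟩ := hT.exists_isMesh hd
  let L : fePairs k Ω T →ₗ[ℝ] (T.biUnion id → ℝ) :=
    { toFun := fun u p => u.1.1 p
      map_add' := fun u v => rfl
      map_smul' := fun c u => rfl }
  have hinj : Function.Injective L := by
    rintro ⟨⟨f, v⟩, hf, hv⟩ ⟨⟨g, w⟩, hg, hw⟩ h
    have hfg : f = g := hf.ext hM hT hg fun p _ ⟨V, hV, hp⟩ =>
      congrFun h ⟨p, Finset.mem_biUnion.2 ⟨V, hV, hp⟩⟩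
    subst hfg
    exact Subtype.ext (Prod.ext rfl (Represents.eq hΩ hv hw))
  have : FiniteDimensional ℝ (fePairs k Ω T) := FiniteDimensional.of_injective L hinj
  exact inferInstanceAs (FiniteDimensional ℝ ((fePairs k Ω T).map (LinearMap.snd ℝ _ _)))

theorem isPi_zero (hd : 1 ≤ d) (hΩ : IsOpen Ω) (hint : interior (closure Ω) = Ω)
    (hT : IsTriangulation k Ω T) : IsPi k T (0 : H10 Ω) 0 := by
  obtain ⟨w, hw, -⟩ := existsUnique_isPi hd hT hΩ hint (0 : H10 Ω)
  have := hw.smul hT hint 0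
  rwa [zero_smul, zero_smul] at this

/-- The kernel of `Π_H` on the fine space as a subspace of `H^1_0(Ω)`. -/
def kernelSubmodule (T : Finset (Finset (E d))) (hd : 1 ≤ d) (hΩ : IsOpen Ω)
    (hint : interior (closure Ω) = Ω) (hTH : IsTriangulation k Ω TH) : Submodule ℝ (H10 Ω) where
  carrier := kernelPi k Ω TH T
  zero_mem' := ⟨mem_feSubmodule.1 (zero_mem _), isPi_zero hd hΩ hint hTH⟩
  add_mem' := fun hu hv => ⟨mem_feSubmodule.1 (add_mem (mem_feSubmodule.2 hu.1)
    (mem_feSubmodule.2 hv.1)), by simpa using hu.2.add hTH hint hv.2⟩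
  smul_mem' := fun c _ hu => ⟨mem_feSubmodule.1 (Submodule.smul_mem _ c (mem_feSubmodule.2 hu.1)),
    by simpa using hu.2.smul hTH hint c⟩

/-- The right-hand side of the state equation. -/
def load (yd : L2 Ω) : H10 Ω × H10 Ω →ₗ[ℝ] ℝ where
  toFun w := inner ℝ yd (toL2 w.1)
  map_add' u v := by simp [inner_add_right]
  map_smul' c u := by simp [inner_smul_right]

theorem isGalerkinSolution_iff (hA : IsDiffusion Ω α β A) {yd : L2 Ω} {S : Set (H10 Ω × H10 Ω)}
    {W : Submodule ℝ (H10 Ω × H10 Ω)} (hS : ∀ u, u ∈ S ↔ u ∈ W) (u : H10 Ω × H10 Ω) :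
    IsGalerkinSolution A yd S u ↔ u ∈ W ∧ ∀ w ∈ W, hA.bilin u w = load yd w := by
  simp only [IsGalerkinSolution, hS, integral_mul_eq_inner]
  rfl

theorem l2l2Norm_le_add (x : H10 Ω × H10 Ω) : l2l2Norm x ≤ l2Norm x.1 + l2Norm x.2 := by
  have h1 : 0 ≤ l2Norm x.1 := norm_nonneg _
  have h2 : 0 ≤ l2Norm x.2 := norm_nonneg _
  refine Real.sqrt_le_iff.2 ⟨by positivity, ?_⟩
  nlinarith

/-- The estimate that follows from testing with `(p, -y)` and `(0, y)`; here `a = ‖p‖`, `b = ‖y‖`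
are the `L₂` norms and `a'`, `b'` the `H^1` seminorms. -/
theorem add_le_of_energy_bounds {α C t a b a' b' f : ℝ} (hα : 0 < α) (hC : 0 ≤ C) (ha : 0 ≤ a)
    (hb : 0 ≤ b) (ha' : 0 ≤ a') (hf : 0 ≤ f) (h1 : α * a' ^ 2 + α * b' ^ 2 ≤ f * a)
    (h2 : α * b' ^ 2 ≤ a * b) (hta : a ≤ t * a') (hCb : b ^ 2 ≤ C * b' ^ 2) :
    a + b ≤ (1 + C / α) * (t ^ 2 / α * f) := by
  have hb2 : 0 ≤ α * b' ^ 2 := by positivity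
  have h3 : a ≤ t ^ 2 / α * f := by
    rcases ha'.eq_or_lt with h0 | h0
    · rw [← h0, mul_zero] at hta
      exact hta.trans (by positivity)
    -- The sign of `t` is not assumed, as `C_†` is arbitrary; it follows from `0 ≤ a ≤ t a'` with
    -- `a' > 0`.
    · have ht0 : 0 ≤ t := by
        by_contra hneg
        nlinarith
      have h4 : α * a' ≤ t * f := by
        refine le_of_mul_le_mul_right ?_ h0
        nlinarith
      rw [div_mul_eq_mul_div, le_div_iff₀ hα]
      nlinarith
  have h5 : b ≤ C / α * a := by
    rcases hb.eq_or_lt with h0 | h0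
    · rw [← h0]; positivity
    · rw [div_mul_eq_mul_div, le_div_iff₀ hα]
      refine le_of_mul_le_mul_right ?_ h0
      nlinarith [mul_le_mul_of_nonneg_left hCb hα.le]
  have h9 : 0 ≤ C / α := by positivity
  calc a + b ≤ (1 + C / α) * a := by linarith
    _ ≤ _ := mul_le_mul_of_nonneg_left h3 (by linarith)

/-- The error estimate for functions in the kernel of `Π_H`. -/
theorem l2l2Norm_le_of_kernel (hA : IsDiffusion Ω α β A) {K : Submodule ℝ (H10 Ω)} {yd : L2 Ω}
    {e : H10 Ω × H10 Ω} (he : e ∈ K.prod K)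
    (hB : ∀ w ∈ K.prod K, hA.bilin e w = load yd w) {C t : ℝ} (hC0 : 0 ≤ C)
    (hC : PoincareFriedrichs Ω C) (ht : ∀ v ∈ K, l2Norm v ≤ t * h1Seminorm v) :
    l2l2Norm e ≤ (1 + C / α) * (t ^ 2 / α * ‖yd‖) := by
  obtain ⟨p, y⟩ := e
  have hp : p ∈ K := he.1
  have hy : y ∈ K := he.2
  have hα := hA.pos
  have hp1 := hA.le_aForm p
  have hy1 := hA.le_aForm y
  have h1 : aForm A p p + aForm A y y = inner ℝ yd (toL2 p) := by
    rw [← hA.bForm_twist]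
    exact hB (p, -y) ⟨hp, K.neg_mem hy⟩
  -- The load acts on the first component only, so it vanishes at `(0, y)`.
  have h2 : inner ℝ (toL2 p) (toL2 y) - aForm A y y = 0 := by
    rw [← hA.bForm_snd]
    refine (hB (0, y) ⟨K.zero_mem, hy⟩).trans ?_
    exact inner_zero_right yd
  have h3 : inner ℝ yd (toL2 p) ≤ ‖yd‖ * l2Norm p := real_inner_le_norm yd (toL2 p)
  have h4 : inner ℝ (toL2 p) (toL2 y) ≤ l2Norm p * l2Norm y := real_inner_le_norm _ _
  refine (l2l2Norm_le_add (p, y)).trans ?_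
  exact add_le_of_energy_bounds (a := l2Norm p) (b := l2Norm y) (a' := h1Seminorm p)
    (b' := h1Seminorm y) hα hC0 (norm_nonneg _) (norm_nonneg _) (norm_nonneg _)
    (norm_nonneg _) (by linarith) (by linarith) (ht p hp) (hC y)

theorem IsTriangulation.isBounded (hT : IsTriangulation k Ω T) : Bornology.IsBounded Ω := by
  refine Bornology.IsBounded.subset ?_ (subset_closure.trans_eq hT.cover.symm)
  exact (Bornology.isBounded_biUnion_finset T).2 fun V _ => (isCompact_cell V).isBounded

end OCP

end

/-! ### The theorem. -/

theorem theorem3p5 (d : ℕ) (hd : 1 ≤ d ∧ d ≤ 3) (k : OCP.ElementKind) (σ : ℝ) :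
    ∃ C₀ : ℝ, 1 ≤ C₀ ∧
      ∀ (Ω : Set (OCP.E d)) (TH : Finset (Finset (OCP.E d))),
        OCP.IsPolyhedralDomain Ω → OCP.IsTriangulation k Ω TH → OCP.IsShapeRegular σ TH →
        -- the projection operator is well defined and `C₀` is admissible as `C_†`
        (∀ v : OCP.H10 Ω, ∃! w : OCP.H10 Ω, OCP.IsPi k TH v w) ∧
        OCP.InterpolationEstimate k Ω TH C₀ ∧
        -- the Poincaré-Friedrichs constant exists
        (∃ CPF : ℝ, OCP.PoincareFriedrichs Ω CPF) ∧
        ∀ (Th : Finset (Finset (OCP.E d))) (α β : ℝ)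
          (A : OCP.E d → Matrix (Fin d) (Fin d) ℝ) (yd : OCP.L2 Ω),
          OCP.IsTriangulation k Ω Th → OCP.IsRefinement Th TH → OCP.IsDiffusion Ω α β A →
          -- the fine and the multiscale problem are uniquely solvable
          (∃! u : OCP.H10 Ω × OCP.H10 Ω, OCP.IsGalerkinSolution A yd
            (OCP.feSpace k Ω Th ×ˢ OCP.feSpace k Ω Th) u) ∧
          (∃! u : OCP.H10 Ω × OCP.H10 Ω, OCP.IsGalerkinSolution A yd
            (OCP.msSpace k Ω A TH Th) u) ∧
          -- the error estimate
          ∀ (u uMS : OCP.H10 Ω × OCP.H10 Ω) (CPF Cdag : ℝ),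
            OCP.IsGalerkinSolution A yd (OCP.feSpace k Ω Th ×ˢ OCP.feSpace k Ω Th) u →
            OCP.IsGalerkinSolution A yd (OCP.msSpace k Ω A TH Th) uMS →
            OCP.PoincareFriedrichs Ω CPF →
            OCP.InterpolationEstimate k Ω TH Cdag →
            OCP.l2l2Norm (u - uMS) ≤
              (1 + CPF / α) * (Cdag ^ 2 / α) * OCP.meshSize TH ^ 2 * ‖yd‖ := by
  open OCP in
  refine ⟨interpolationConst d σ, le_max_left _ _, fun Ω TH hΩ hTH hR => ?_⟩
  have hd1 := hd.1
  have hop := hΩ.isOpen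
  have hint := hΩ.interior_closure
  have hne := hΩ.isConnected.nonempty
  obtain ⟨C, hC⟩ := exists_poincareFriedrichs hd1 hop hTH.isBounded
  refine ⟨existsUnique_isPi hd1 hTH hop hint, interpolationEstimate hop hne hTH hint hR hd1,
    ⟨C, hC⟩, fun Th α β A yd hTh _ hA => ?_⟩
  let W := feSubmodule k Ω Th
  let K := kernelSubmodule Th hd1 hop hint hTH
  have hKW : K.prod K ≤ W.prod W := fun w hw =>
    ⟨mem_feSubmodule.2 hw.1.1, mem_feSubmodule.2 hw.2.1⟩
  have : FiniteDimensional ℝ W := finiteDimensional_feSubmodule hd1 hop hTh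
  have : FiniteDimensional ℝ (W.prod W) := 
    Module.Finite.iff_fg.2 ((Module.Finite.iff_fg.1 this).prod (Module.Finite.iff_fg.1 this))
  have : FiniteDimensional ℝ (orthogonalIn hA.bilin (W.prod W) (K.prod K)) :=
    Submodule.finiteDimensional_of_le fun v hv => hv.1
  have ndW := hA.nondegenerateOn hop hC W
  have ndK := hA.nondegenerateOn hop hC K
  have hfe : ∀ u, u ∈ feSpace k Ω Th ×ˢ feSpace k Ω Th ↔ u ∈ W.prod W := fun u =>
    and_congr mem_feSubmodule.symm mem_feSubmodule.symm
  have hms : ∀ u, u ∈ msSpace k Ω A TH Th ↔ u ∈ orthogonalIn hA.bilin (W.prod W) (K.prod K) :=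
    fun u => and_congr (hfe u) Iff.rfl
  refine ⟨?_, ?_, fun u uMS CPF Cdag hu huMS hCPF hCdag => ?_⟩
  · simp only [isGalerkinSolution_iff hA hfe]
    exact ndW.existsUnique (load yd)
  · simp only [isGalerkinSolution_iff hA hms]
    exact (nondegenerateOn_orthogonalIn hKW ndW ndK).existsUnique (load yd)
  · rw [isGalerkinSolution_iff hA hfe] at hu
    rw [isGalerkinSolution_iff hA hms] at huMS
    obtain ⟨he, hB⟩ := sub_mem_of_galerkin hA.bForm_comm hKW ndW ndK hu.1 hu.2 huMS.1 huMS.2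
    have hH := meshSize_pos hTH hR hd1 hne
    refine (l2l2Norm_le_of_kernel hA he hB (hCPF.pos hop hne).le hCPF
      (t := Cdag * meshSize TH) fun v hv => ?_).trans_eq (by ring)
    -- With `Π_H v = 0`, estimate (1) reduces to `‖v‖ ≤ C_† H |v|`, which supplies `t = C_† H`.
    have h := hCdag v 0 hv.2
    have h0 : h1Seminorm (0 : H10 Ω) = 0 := norm_zero
    rw [sub_zero, h0, add_zero, inv_mul_le_iff₀ hH] at h
    linarith
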